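/- Automata with translucent letters (returning mode). An NIDPDAwtl is a system $M=\langle Q,\Sigma,\Gamma,q_0,\vartriangleleft,\bot,\tau,\delta_D,\delta_R,\delta_N\rangle$ with finite sets $Q$ (states), $\Sigma$ (input letters, partitioned into $\Sigma_D,\Sigma_R,\Sigma_N$) and $\Gamma$ (pushdown symbols), an initial state $q_0\in Q$, an endmarker $\vartriangleleft\notin\Sigma$, a bottom symbol $\bot\notin\Gamma$, a translucency mapping $\tau:Q\to 2^{\Sigma}$, and partial transition functions $\delta_D:Q\times\Sigma_D\times(\Gamma\cup\{\bot\})\to 2^{Q\times\Gamma}\cup\{\mathtt{accept}\}$, $\delta_R:Q\times\Sigma_R\times(\Gamma\cup\{\bot\})\to 2^{Q}\cup\{\mathtt{accept}\}$, $\delta_N:Q\times(\Sigma_N\cup\{\vartriangleleft\})\times(\Gamma\cup\{\bot\})\to 2^{Q}\cup\{\mathtt{accept}\}$. A configuration is $\mathtt{accept}$ or consists of a state $q$, a remaining input $w\in\Sigma^*$ (followed by $\vartriangleleft$) and a pushdown content in $\Gamma^*\bot$, top first; the computation on $w$ starts with $q_0$, $w$ and $\bot$. In state $q$ with top symbol $z$,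 let $a$ be the first symbol of $w\vartriangleleft$ that is not in $\tau(q)$. If $a\in\Sigma_D$ and $(q',z')\in\delta_D(q,a,z)$, then $M$ may delete this occurrence of $a$, push $z'$ and enter $q'$; if $a\in\Sigma_R$ and $q'\in\delta_R(q,a,z)$, it may delete it, pop $z$ (nothing is popped if $z=\bot$) and enter $q'$; if $a\in\Sigma_N$ and $q'\in\delta_N(q,a,z)$, it may delete it and enter $q'$; if $a=\vartriangleleft$ and $q'\in\delta_N(q,\vartriangleleft,z)$, it may enter $q'$ with input and pushdown unchanged. If the transition function has the value $\mathtt{accept}$, the next configuration is $\mathtt{accept}$. After each step the scan restarts at the left end of the remaining input. $L(M)$ is the set of all $w\in\Sigma^*$ on which some computation reaches $\mathtt{accept}$. $M$ is a DIDPDAwtl if every set that is a value of $\delta_D$, $\delta_R$ or $\delta_N$ (the values on $\vartriangleleft$ included) has at most one element. A DPDAwtl is defined in the same way without a partition of $\Sigma$ and with one partial transition function $\delta:Q\times(\Sigma\cup\{\lambda,\vartriangleleft\})\times(\Gamma\cup\{\bot\})\to(Q\times\Gamma^*)\cup\{\mathtt{accept}\}$ such that, whenever $\delta(q,\lambda,z)$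 is defined, $\delta(q,a,z)$ is undefined for all $a\in\Sigma\cup\{\vartriangleleft\}$. If $\delta(q,a,z)=(q',u)$, where $a\in\Sigma\cup\{\vartriangleleft\}$ is the first symbol of the remaining input followed by $\vartriangleleft$ that is not in $\tau(q)$, then $M$ deletes this occurrence of $a$ (unless $a=\vartriangleleft$), replaces the top symbol $z$ by $u$ (puts $u$ on top of $\bot$ if $z=\bot$) and enters $q'$; if $\delta(q,\lambda,z)=(q',u)$, it does the same without deleting anything from the input. Theorem. For a DIDPDAwtl or a DPDAwtl $M$ given as input, it is decidable whether $L(M)=\emptyset$, whether $L(M)$ is finite, and whether $L(M)=\Sigma^*$. For an NIDPDAwtl $M$ given as input, it is decidable whether $L(M)=\emptyset$ and whether $L(M)$ is finite. -/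

import Mathlib

/-- A letter of an input alphabet that is partitioned into push letters `D`, pop letters `R` and
neutral letters `N`. -/
inductive Letter (D R N : Type*) where
  | push (a : D)
  | pop (a : R)
  | neutral (a : N)

/-- A defined value of a nondeterministic transition function: `accept`, or a set of choices. -/
inductive Outcome (α : Type*) where
  | accept
  | goto (choices : Set α)

/-- A value consists of at most one choice (`accept` counts as one). -/
def Outcome.AtMostOne {α : Type*} : Outcome α → Prop
  | .accept => True
  | .goto T => T.Subsingleton

/-- A configuration of an automaton working in the returning mode: the halting configuration
`accept`, or a state with the remaining input (the endmarker on its right is left implicit) and the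
pushdown content, top first (the bottom symbol is left implicit). -/
inductive Config (Q S G : Type*) where
  | run (q : Q) (w : List S) (γ : List G)
  | accept

/-- Input-driven pushdown automata with translucent input letters, with states `Q`, push letters
`D`, pop letters `R`, neutral letters `N` and pushdown symbols `G`. In the last argument of the
transition functions `none` is the bottom-of-pushdown symbol; in the second argument of `δN`
`none` is the endmarker. As a value of a transition function, `none` means undefined. -/
structure NIDPDAwtl (Q D R N G : Type*) where
  init : Q
  transl : Q → Set (Letter D R N)
  δD : Q → D → Option G → Option (Outcome (Q × G))
  δR : Q → R → Option G → Option (Outcome Q)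
  δN : Q → Option N → Option G → Option (Outcome Q)

namespace NIDPDAwtl

variable {Q D R N G : Type*}

/-- One step. The input is scanned from the left for the first letter that is not translucent for
the current state; if there is none, the endmarker is scanned. The top of the pushdown is
`γ.head?`, which is `none` exactly if only the bottom symbol is left; popping then changes
nothing. -/
inductive Step (M : NIDPDAwtl Q D R N G) :
    Config Q (Letter D R N) G → Config Q (Letter D R N) G → Prop
  | push {q q' : Q} {x y : List (Letter D R N)} {a : D} {γ : List G} {z' : G}
      {T : Set (Q × G)} (hx : ∀ b ∈ x, b ∈ M.transl q) (ha : Letter.push a ∉ M.transl q)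
      (hδ : M.δD q a γ.head? = some (.goto T)) (hT : (q', z') ∈ T) :
      Step M (.run q (x ++ Letter.push a :: y) γ) (.run q' (x ++ y) (z' :: γ))
  | pop {q q' : Q} {x y : List (Letter D R N)} {a : R} {γ : List G}
      {T : Set Q} (hx : ∀ b ∈ x, b ∈ M.transl q) (ha : Letter.pop a ∉ M.transl q)
      (hδ : M.δR q a γ.head? = some (.goto T)) (hT : q' ∈ T) :
      Step M (.run q (x ++ Letter.pop a :: y) γ) (.run q' (x ++ y) γ.tail)
  | neutral {q q' : Q} {x y : List (Letter D R N)} {a : N} {γ : List G}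
      {T : Set Q} (hx : ∀ b ∈ x, b ∈ M.transl q) (ha : Letter.neutral a ∉ M.transl q)
      (hδ : M.δN q (some a) γ.head? = some (.goto T)) (hT : q' ∈ T) :
      Step M (.run q (x ++ Letter.neutral a :: y) γ) (.run q' (x ++ y) γ)
  | endmarker {q q' : Q} {x : List (Letter D R N)} {γ : List G}
      {T : Set Q} (hx : ∀ b ∈ x, b ∈ M.transl q)
      (hδ : M.δN q none γ.head? = some (.goto T)) (hT : q' ∈ T) :
      Step M (.run q x γ) (.run q' x γ)
  | pushAccept {q : Q} {x y : List (Letter D R N)} {a : D} {γ : List G}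
      (hx : ∀ b ∈ x, b ∈ M.transl q) (ha : Letter.push a ∉ M.transl q)
      (hδ : M.δD q a γ.head? = some .accept) :
      Step M (.run q (x ++ Letter.push a :: y) γ) .accept
  | popAccept {q : Q} {x y : List (Letter D R N)} {a : R} {γ : List G}
      (hx : ∀ b ∈ x, b ∈ M.transl q) (ha : Letter.pop a ∉ M.transl q)
      (hδ : M.δR q a γ.head? = some .accept) :
      Step M (.run q (x ++ Letter.pop a :: y) γ) .accept
  | neutralAccept {q : Q} {x y : List (Letter D R N)} {a : N} {γ : List G}
      (hx : ∀ b ∈ x, b ∈ M.transl q) (ha : Letter.neutral a ∉ M.transl q)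
      (hδ : M.δN q (some a) γ.head? = some .accept) :
      Step M (.run q (x ++ Letter.neutral a :: y) γ) .accept
  | endmarkerAccept {q : Q} {x : List (Letter D R N)} {γ : List G}
      (hx : ∀ b ∈ x, b ∈ M.transl q)
      (hδ : M.δN q none γ.head? = some .accept) :
      Step M (.run q x γ) .accept

/-- The accepted language. -/
def language (M : NIDPDAwtl Q D R N G) : Language (Letter D R N) :=
  {w | Relation.ReflTransGen M.Step (.run M.init w []) .accept}

/-- `M` is deterministic, that is, a DIDPDAwtl: every value of a transition function, those on the
endmarker included, has at most one choice. -/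
def IsDeterministic (M : NIDPDAwtl Q D R N G) : Prop :=
  (∀ q a z v, M.δD q a z = some v → v.AtMostOne) ∧
  (∀ q a z v, M.δR q a z = some v → v.AtMostOne) ∧
  (∀ q a z v, M.δN q a z = some v → v.AtMostOne)

end NIDPDAwtl

/-- What a move of a (not input-driven) pushdown automaton scans. -/
inductive Scan (S : Type*) where
  | letter (a : S)
  | endmarker
  | lambda

/-- A defined value of a single-valued transition function: `accept`, or a new state with the word
that replaces the top of the pushdown (its first letter is the new top). -/
inductive Move (Q G : Type*) where
  | accept
  | goto (q : Q) (u : List G)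

/-- Pushdown automata with translucent input letters `S`, states `Q` and pushdown symbols `G`, with
a single-valued partial transition function. The last argument of `δ` is the top of the pushdown,
`none` being the bottom-of-pushdown symbol, which is never removed: a word is then put on top of
it. As a value of `δ`, `none` means undefined. -/
structure PDAwtl (Q S G : Type*) where
  init : Q
  transl : Q → Set S
  δ : Q → Scan S → Option G → Option (Move Q G)

namespace PDAwtl

variable {Q S G : Type*}

/-- `M` is a DPDAwtl: where a `λ`-move is defined, no other move is. -/
def IsDeterministic (M : PDAwtl Q S G) : Prop :=
  ∀ q z, M.δ q .lambda z ≠ none →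
    (∀ a, M.δ q (.letter a) z = none) ∧ M.δ q .endmarker z = none

/-- One step, in the returning mode. -/
inductive Step (M : PDAwtl Q S G) : Config Q S G → Config Q S G → Prop
  | letter {q q' : Q} {x y : List S} {a : S} {γ u : List G}
      (hx : ∀ b ∈ x, b ∈ M.transl q) (ha : a ∉ M.transl q)
      (hδ : M.δ q (.letter a) γ.head? = some (.goto q' u)) :
      Step M (.run q (x ++ a :: y) γ) (.run q' (x ++ y) (u ++ γ.tail))
  | endmarker {q q' : Q} {x : List S} {γ u : List G}
      (hx : ∀ b ∈ x, b ∈ M.transl q)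
      (hδ : M.δ q .endmarker γ.head? = some (.goto q' u)) :
      Step M (.run q x γ) (.run q' x (u ++ γ.tail))
  | lambda {q q' : Q} {w : List S} {γ u : List G}
      (hδ : M.δ q .lambda γ.head? = some (.goto q' u)) :
      Step M (.run q w γ) (.run q' w (u ++ γ.tail))
  | letterAccept {q : Q} {x y : List S} {a : S} {γ : List G}
      (hx : ∀ b ∈ x, b ∈ M.transl q) (ha : a ∉ M.transl q)
      (hδ : M.δ q (.letter a) γ.head? = some .accept) :
      Step M (.run q (x ++ a :: y) γ) .accept
  | endmarkerAccept {q : Q} {x : List S} {γ : List G}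
      (hx : ∀ b ∈ x, b ∈ M.transl q)
      (hδ : M.δ q .endmarker γ.head? = some .accept) :
      Step M (.run q x γ) .accept
  | lambdaAccept {q : Q} {w : List S} {γ : List G}
      (hδ : M.δ q .lambda γ.head? = some .accept) :
      Step M (.run q w γ) .accept

/-- The accepted language. -/
def language (M : PDAwtl Q S G) : Language S :=
  {w | Relation.ReflTransGen M.Step (.run M.init w []) .accept}

end PDAwtl

/-- A finite description of an input-driven automaton: the numbers of states (minus one), letters
of the three kinds and pushdown symbols, the initial state, the translucency mapping as lists of
pairs (state, letter), and the transition functions as finite tables in which the value `none`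
stands for `accept` and an argument without an entry is one where the function is undefined. -/
structure IDCode where
  numStates : ℕ
  numD : ℕ
  numR : ℕ
  numN : ℕ
  numG : ℕ
  init : ℕ
  translD : List (ℕ × ℕ)
  translR : List (ℕ × ℕ)
  translN : List (ℕ × ℕ)
  tableD : List ((ℕ × ℕ × Option ℕ) × Option (List (ℕ × ℕ)))
  tableR : List ((ℕ × ℕ × Option ℕ) × Option (List ℕ))
  tableN : List ((ℕ × Option ℕ × Option ℕ) × Option (List ℕ))

namespace IDCode

/-- A description as a tuple of lists and numbers. -/
def equivProd : IDCode ≃ ℕ × ℕ × ℕ × ℕ × ℕ × ℕ × List (ℕ × ℕ) × List (ℕ × ℕ) × List (ℕ × ℕ) ×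
    List ((ℕ × ℕ × Option ℕ) × Option (List (ℕ × ℕ))) ×
    List ((ℕ × ℕ × Option ℕ) × Option (List ℕ)) ×
    List ((ℕ × Option ℕ × Option ℕ) × Option (List ℕ)) where
  toFun c := ⟨c.numStates, c.numD, c.numR, c.numN, c.numG, c.init, c.translD, c.translR,
    c.translN, c.tableD, c.tableR, c.tableN⟩
  invFun p := match p with
    | ⟨a, b, c, d, e, f, g, h, i, j, k, l⟩ => ⟨a, b, c, d, e, f, g, h, i, j, k, l⟩
  left_inv _ := rfl
  right_inv _ := rfl

instance : Primcodable IDCode := Primcodable.ofEquiv _ equivProd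

/-- The value described by a table entry. -/
def outcome {α β : Type*} (f : α → β) : Option (List β) → Outcome α
  | none => .accept
  | some l => .goto {p | f p ∈ l}

/-- The automaton that is described. -/
def automaton (c : IDCode) :
    NIDPDAwtl (Fin (c.numStates + 1)) (Fin c.numD) (Fin c.numR) (Fin c.numN) (Fin c.numG) where
  init := Fin.ofNat (c.numStates + 1) c.init
  transl q := {s | match s with
    | .push a => (q.val, a.val) ∈ c.translD
    | .pop a => (q.val, a.val) ∈ c.translR
    | .neutral a => (q.val, a.val) ∈ c.translN}
  δD q a z := (c.tableD.lookup (q.val, a.val, z.map Fin.val)).map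
    (outcome fun p => (p.1.val, p.2.val))
  δR q a z := (c.tableR.lookup (q.val, a.val, z.map Fin.val)).map (outcome Fin.val)
  δN q a z := (c.tableN.lookup (q.val, a.map Fin.val, z.map Fin.val)).map (outcome Fin.val)

end IDCode

/-- A finite description of an automaton that is not input-driven, in the same style. In the table,
a scanned symbol is `none` for a `λ`-move, `some none` for the endmarker and `some (some a)` for
the letter `a`. -/
structure PDCode where
  numStates : ℕ
  numS : ℕ
  numG : ℕ
  init : ℕ
  transl : List (ℕ × ℕ)
  table : List ((ℕ × Option (Option ℕ) × Option ℕ) × Option (ℕ × List ℕ))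

namespace PDCode

/-- A description as a tuple of lists and numbers. -/
def equivProd : PDCode ≃ ℕ × ℕ × ℕ × ℕ × List (ℕ × ℕ) ×
    List ((ℕ × Option (Option ℕ) × Option ℕ) × Option (ℕ × List ℕ)) where
  toFun c := ⟨c.numStates, c.numS, c.numG, c.init, c.transl, c.table⟩
  invFun p := match p with
    | ⟨a, b, c, d, e, f⟩ => ⟨a, b, c, d, e, f⟩
  left_inv _ := rfl
  right_inv _ := rfl

instance : Primcodable PDCode := Primcodable.ofEquiv _ equivProd

/-- The code of a scanned symbol in a table. -/
def scanCode {n : ℕ} : Scan (Fin n) → Option (Option ℕ)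
  | .letter a => some (some a.val)
  | .endmarker => some none
  | .lambda => none

/-- The value described by a table entry. States are read modulo the number of states, and numbers
that are no pushdown symbols are skipped. -/
def move (k g : ℕ) : Option (ℕ × List ℕ) → Move (Fin (k + 1)) (Fin g)
  | none => .accept
  | some (q, u) => .goto (Fin.ofNat (k + 1) q)
      (u.filterMap fun i => if h : i < g then some ⟨i, h⟩ else none)

/-- The automaton that is described. -/
def automaton (c : PDCode) :
    PDAwtl (Fin (c.numStates + 1)) (Fin c.numS) (Fin c.numG) where
  init := Fin.ofNat (c.numStates + 1) c.init
  transl q := {a | (q.val, a.val) ∈ c.transl}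
  δ q s z := (c.table.lookup (q.val, scanCode s, z.map Fin.val)).map (move c.numStates c.numG)

end PDCode

/-- A finite partial function is given by a table. -/
theorem exists_table {κ K V : Type*} [Finite κ] [BEq K] [LawfulBEq K] (key : κ → K)
    (hkey : Function.Injective key) (F : κ → Option V) :
    ∃ l : List (K × V), ∀ k, l.lookup (key k) = F k := by
  classical
  have : Fintype κ := Fintype.ofFinite κ
  have main : ∀ L : List κ, ∃ l : List (K × V),
      (∀ k ∈ L, l.lookup (key k) = F k) ∧ ∀ k ∉ L, l.lookup (key k) = none := by
    intro L
    induction L with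
    | nil => exact ⟨[], by simp, by simp⟩
    | cons a L ih =>
      obtain ⟨l, h1, h2⟩ := ih
      cases hF : F a with
      | none =>
        refine ⟨l, ?_, fun k hk => h2 k fun h => hk (List.mem_cons_of_mem _ h)⟩
        intro k hk
        by_cases hL : k ∈ L
        · exact h1 k hL
        · obtain rfl : k = a := by simpa [hL] using hk
          rw [h2 k hL, hF]
      | some v =>
        refine ⟨(key a, v) :: l, ?_, ?_⟩
        · intro k hk
          by_cases hka : k = a
          · subst hka
            simp [hF]
          · have : (key k == key a) = false := by simpa using fun h => hka (hkey h)
            rw [List.lookup_cons, this]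
            exact h1 k (by simpa [hka] using hk)
        · intro k hk
          have hka : k ≠ a := fun h => hk (by simp [h])
          have : (key k == key a) = false := by simpa using fun h => hka (hkey h)
          rw [List.lookup_cons, this]
          exact h2 k fun h => hk (List.mem_cons_of_mem _ h)
  obtain ⟨l, h1, -⟩ := main Finset.univ.toList
  exact ⟨l, fun k => h1 k (by simp)⟩

/-- A finite set is given by a list of codes of its elements. -/
theorem exists_codes {κ K : Type*} [Finite κ] (key : κ → K) (hkey : Function.Injective key)
    (T : Set κ) : ∃ l : List K, ∀ k, key k ∈ l ↔ k ∈ T := by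
  classical
  have : Fintype κ := Fintype.ofFinite κ
  refine ⟨(Finset.univ.filter (· ∈ T)).toList.map key, fun k => ?_⟩
  simp [hkey.eq_iff]

theorem IDCode.outcome_surjective {α β : Type*} [Finite α] (f : α → β)
    (hf : Function.Injective f) : Function.Surjective (IDCode.outcome f) := by
  rintro (_ | T)
  · exact ⟨none, rfl⟩
  · obtain ⟨l, hl⟩ := exists_codes f hf T
    exact ⟨some l, by simp [IDCode.outcome, hl]⟩

theorem PDCode.move_surjective (k g : ℕ) : Function.Surjective (PDCode.move k g) := by
  rintro (_ | ⟨q, u⟩)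
  · exact ⟨none, rfl⟩
  · refine ⟨some (q.val, u.map Fin.val), ?_⟩
    have : (u.map Fin.val).filterMap
        (fun i => if h : i < g then some (⟨i, h⟩ : Fin g) else none) = u := by
      simp [List.filterMap_map]
    simp only [PDCode.move, this]
    simp

/-- Every input-driven automaton (over the sets `{0, …, n - 1}`) has a description. -/
theorem IDCode.exists_automaton_eq {k d r n g : ℕ}
    (M : NIDPDAwtl (Fin (k + 1)) (Fin d) (Fin r) (Fin n) (Fin g)) :
    ∃ i tD tR tN δD δR δN, (IDCode.mk k d r n g i tD tR tN δD δR δN).automaton = M := by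
  have hv : ∀ n, Function.Injective (Fin.val : Fin n → ℕ) := fun n => Fin.val_injective
  have hz : ∀ n, Function.Injective (Option.map (Fin.val : Fin n → ℕ)) :=
    fun n => Option.map_injective (hv n)
  obtain ⟨tD, hD⟩ := exists_codes (fun p : Fin (k + 1) × Fin d => (p.1.val, p.2.val))
    ((hv _).prodMap (hv _)) {p | Letter.push p.2 ∈ M.transl p.1}
  obtain ⟨tR, hR⟩ := exists_codes (fun p : Fin (k + 1) × Fin r => (p.1.val, p.2.val))
    ((hv _).prodMap (hv _)) {p | Letter.pop p.2 ∈ M.transl p.1}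
  obtain ⟨tN, hN⟩ := exists_codes (fun p : Fin (k + 1) × Fin n => (p.1.val, p.2.val))
    ((hv _).prodMap (hv _)) {p | Letter.neutral p.2 ∈ M.transl p.1}
  choose oD hoD using IDCode.outcome_surjective
    (fun p : Fin (k + 1) × Fin g => (p.1.val, p.2.val)) ((hv _).prodMap (hv _))
  choose o ho using IDCode.outcome_surjective (Fin.val : Fin (k + 1) → ℕ) (hv _)
  obtain ⟨δD, hδD⟩ := exists_table
    (fun p : Fin (k + 1) × Fin d × Option (Fin g) => (p.1.val, p.2.1.val, p.2.2.map Fin.val))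
    ((hv _).prodMap ((hv _).prodMap (hz _))) (fun p => (M.δD p.1 p.2.1 p.2.2).map oD)
  obtain ⟨δR, hδR⟩ := exists_table
    (fun p : Fin (k + 1) × Fin r × Option (Fin g) => (p.1.val, p.2.1.val, p.2.2.map Fin.val))
    ((hv _).prodMap ((hv _).prodMap (hz _))) (fun p => (M.δR p.1 p.2.1 p.2.2).map o)
  obtain ⟨δN, hδN⟩ := exists_table
    (fun p : Fin (k + 1) × Option (Fin n) × Option (Fin g) =>
      (p.1.val, p.2.1.map Fin.val, p.2.2.map Fin.val))
    ((hv _).prodMap ((hz _).prodMap (hz _))) (fun p => (M.δN p.1 p.2.1 p.2.2).map o)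
  refine ⟨M.init.val, tD, tR, tN, δD, δR, δN, ?_⟩
  obtain ⟨q0, τ, fD, fR, fN⟩ := M
  simp only [IDCode.automaton, NIDPDAwtl.mk.injEq]
  refine ⟨by simp, ?_, ?_, ?_, ?_⟩
  · funext q
    ext s
    cases s with
    | push a => simpa using hD (q, a)
    | pop a => simpa using hR (q, a)
    | neutral a => simpa using hN (q, a)
  · funext q a z
    have := hδD (q, a, z)
    simp only at this
    rw [this]
    simp [Function.comp_def, hoD]
  · funext q a z
    have := hδR (q, a, z)
    simp only at this
    rw [this]
    simp [Function.comp_def, ho]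
  · funext q a z
    have := hδN (q, a, z)
    simp only at this
    rw [this]
    simp [Function.comp_def, ho]

/-- Every automaton that is not input-driven (over the sets `{0, …, n - 1}`) has a description. -/
theorem PDCode.exists_automaton_eq {k n g : ℕ} (M : PDAwtl (Fin (k + 1)) (Fin n) (Fin g)) :
    ∃ i t δ, (PDCode.mk k n g i t δ).automaton = M := by
  have hv : ∀ n, Function.Injective (Fin.val : Fin n → ℕ) := fun n => Fin.val_injective
  have hz : ∀ n, Function.Injective (Option.map (Fin.val : Fin n → ℕ)) :=
    fun n => Option.map_injective (hv n)
  have hs : Function.Injective (PDCode.scanCode (n := n)) := by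
    rintro (a | _ | _) (b | _ | _) h <;> simp_all [PDCode.scanCode, Fin.val_inj]
  have : Finite (Scan (Fin n)) :=
    Finite.of_surjective (fun o : Option (Option (Fin n)) => match o with
      | none => Scan.lambda
      | some none => Scan.endmarker
      | some (some a) => Scan.letter a) (by
        rintro (a | _ | _)
        exacts [⟨some (some a), rfl⟩, ⟨some none, rfl⟩, ⟨none, rfl⟩])
  obtain ⟨t, ht⟩ := exists_codes (fun p : Fin (k + 1) × Fin n => (p.1.val, p.2.val))
    ((hv _).prodMap (hv _)) {p | p.2 ∈ M.transl p.1}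
  choose o ho using PDCode.move_surjective k g
  obtain ⟨δ, hδ⟩ := exists_table
    (fun p : Fin (k + 1) × Scan (Fin n) × Option (Fin g) =>
      (p.1.val, PDCode.scanCode p.2.1, p.2.2.map Fin.val))
    ((hv _).prodMap (hs.prodMap (hz _))) (fun p => (M.δ p.1 p.2.1 p.2.2).map o)
  refine ⟨M.init.val, t, δ, ?_⟩
  obtain ⟨q0, τ, f⟩ := M
  simp only [PDCode.automaton, PDAwtl.mk.injEq]
  refine ⟨by simp, ?_, ?_⟩
  · funext q
    ext a
    simpa using ht (q, a)
  · funext q a z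
    have := hδ (q, a, z)
    simp only at this
    rw [this]
    simp [Function.comp_def, ho]

/-- The property `p` is decidable for inputs of the class `inst`: some algorithm that halts on
every input answers correctly on all inputs from `inst`. -/
def DecidableFor {α : Type*} [Primcodable α] (inst p : α → Prop) : Prop :=
  ∃ f : α → Bool, Computable f ∧ ∀ x, inst x → (f x = true ↔ p x)

/-! The order of the letters of a word matters only through the order of their deletion. Rearrange
an accepted word so that its letters stand in the order in which they are deleted, the undeleted
ones last: then the letter to be deleted is always the first one left, and a move on the endmarker,
which needs every remaining letter to be translucent, still sees the same letters. Up to such a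
rearrangement, which keeps the length, a computation is a run of an ordinary pushdown system whose
control states are pairs of a state and a set of letters that may still occur; a move on the
endmarker shrinks this set to its translucent letters (`Mach.exists_oRun`, `Mach.ORun.exists_word`).
Hence the language is nonempty if and only if an accepting move is reachable. It is infinite if and
only if accepting runs delete unboundedly many letters, or some accepting move leaves a letter
allowed, which can then be repeated at the end of the word.

A deterministic automaton rejects a word if and only if its run gets stuck or is infinite. An
infinite run deletes nothing from some point on, and the input left there can be dropped. If
deletion-free runs that start on a single reachable top symbol and never go below it have at most
`M` steps, then a deletion-free run on a pushdown of height `h`, the bottom included, has at most `M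
* h` steps, so every run ends. If their lengths are unbounded, they are so for one pair of a state
and a top symbol, and determinism turns this into a rejected word (`Mach.accepts_of_finite`,
`Mach.exists_not_accepts_of_infinite`).

All three questions thus become one: does a weighted pushdown system have halting runs of infinitely
many weights? Composing rules with runs that remove a symbol gives derived rules. There are finitely
many, as their words are suffixes of words of the given rules, so they can be computed by
saturation. The weights are unbounded if and only if some derived rule that is used for the goal
occurs in its own derivation with additional positive weight (`infinite_der_iff`). Both kinds of
automata are translated into the common form `Mach` by primitive recursive functions. -/

/-- The closure of a list under a partial binary operation. -/
inductive Clo {β : Type*} (comb : β → β → Option β) (B : List β) : β → Prop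
  | base {x} (h : x ∈ B) : Clo comb B x
  | comb {x y z} (h : comb x y = some z) (hx : Clo comb B x) (hy : Clo comb B y) : Clo comb B z

/-! ### Computing finite closures by saturation. -/

section Saturation

variable {β : Type*} (comb : β → β → Option β)

/-- One round of saturation under a partial binary operation. -/
def satStep (T : List β) : List β :=
  T ++ T.flatMap fun x => T.filterMap fun y => comb x y

variable {comb}

theorem mem_satStep {T : List β} {z : β} :
    z ∈ satStep comb T ↔ z ∈ T ∨ ∃ x ∈ T, ∃ y ∈ T, comb x y = some z := by
  simp [satStep]

theorem clo_of_mem_iterate {B : List β} (n : ℕ) :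
    ∀ z ∈ (satStep comb)^[n] B, Clo comb B z := by
  induction n with
  | zero => exact fun z hz => .base hz
  | succ n ih =>
    intro z hz
    rw [Function.iterate_succ_apply', mem_satStep] at hz
    rcases hz with hz | ⟨x, hx, y, hy, h⟩
    · exact ih z hz
    · exact .comb h (ih x hx) (ih y hy)

theorem iterate_satStep_mono {B : List β} {m n : ℕ} (h : m ≤ n) :
    (satStep comb)^[m] B ⊆ (satStep comb)^[n] B := by
  induction h with
  | refl => exact List.Subset.refl _
  | step _ ih =>
    intro z hz
    rw [Function.iterate_succ_apply', mem_satStep]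
    exact .inl (ih hz)

theorem mem_iterate_of_clo {B : List β} {z : β} (hz : Clo comb B z) :
    ∃ n, z ∈ (satStep comb)^[n] B := by
  induction hz with
  | base h => exact ⟨0, h⟩
  | comb h _ _ ihx ihy =>
    obtain ⟨m, hm⟩ := ihx
    obtain ⟨n, hn⟩ := ihy
    refine ⟨max m n + 1, ?_⟩
    rw [Function.iterate_succ_apply', mem_satStep]
    exact .inr ⟨_, iterate_satStep_mono (le_max_left _ _) hm, _,
      iterate_satStep_mono (le_max_right _ _) hn, h⟩

/-- Each element of the closure appears in some round; finitely many elements have a last such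
round, after which nothing new can appear. -/
theorem exists_iterate_satStep_closed {B : List β} (hfin : {x | Clo comb B x}.Finite) :
    ∃ n, satStep comb ((satStep comb)^[n] B) ⊆ (satStep comb)^[n] B := by
  choose! f hf using fun z (hz : Clo comb B z) => mem_iterate_of_clo hz
  obtain ⟨n, hn⟩ := (hfin.image f).bddAbove
  refine ⟨n, fun z hz => ?_⟩
  have hz' : Clo comb B z := by
    rw [← Function.iterate_succ_apply' (satStep comb)] at hz
    exact clo_of_mem_iterate _ z hz
  exact iterate_satStep_mono (hn ⟨z, hz', rfl⟩) (hf z hz')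

theorem mem_iff_clo_of_closed {B : List β} {n : ℕ}
    (h : satStep comb ((satStep comb)^[n] B) ⊆ (satStep comb)^[n] B) (z : β) :
    z ∈ (satStep comb)^[n] B ↔ Clo comb B z := by
  refine ⟨clo_of_mem_iterate n z, fun hz => ?_⟩
  induction hz with
  | base hb => exact iterate_satStep_mono (Nat.zero_le n) hb
  | comb hc _ _ ihx ihy => exact h (mem_satStep.2 (.inr ⟨_, ihx, _, ihy, hc⟩))

theorem primrecPred_list_subset {β : Type*} [Primcodable β] :
    PrimrecRel fun (S T : List β) => S ⊆ T := by
  have hm : PrimrecRel fun (a : β) (T : List β) => a ∈ T := by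
    have := PrimrecRel.exists_mem_list (Primrec.eq (α := β))
    exact (this.comp Primrec.snd Primrec.fst).of_eq fun p => by simp
  exact (PrimrecRel.forall_mem_list hm).of_eq fun _ _ => Iff.rfl

/-- Closures under a primitive recursive partial binary operation are computable if they are
finite. -/
theorem exists_computable_sat [Primcodable β] (hcomb : Primrec₂ comb)
    (hfin : ∀ B, {x | Clo comb B x}.Finite) :
    ∃ sat : List β → List β, Computable sat ∧ ∀ B x, x ∈ sat B ↔ Clo comb B x := by
  classical
  have hstep : Primrec (satStep comb) := by
    refine Primrec.list_append.comp .id (Primrec.list_flatMap .id ?_)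
    exact Primrec.listFilterMap .fst (hcomb.comp (Primrec.snd.comp .fst) .snd)
  have hiter : Primrec₂ fun (B : List β) (n : ℕ) => (satStep comb)^[n] B :=
    Primrec.nat_iterate .snd .fst (hstep.comp .snd)
  have hclosed : PrimrecPred fun p : List β × ℕ =>
      satStep comb ((satStep comb)^[p.2] p.1) ⊆ (satStep comb)^[p.2] p.1 :=
    primrecPred_list_subset.comp (hstep.comp hiter) hiter
  obtain ⟨_, hdec⟩ := hclosed
  have hex : ∀ B, ∃ n, satStep comb ((satStep comb)^[n] B) ⊆ (satStep comb)^[n] B :=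
    fun B => exists_iterate_satStep_closed (hfin B)
  -- The number of rounds is found by unbounded search. Finiteness of the closure guarantees that
  -- the search ends, so no explicit bound is needed.
  have hfind : Computable fun B : List β => Nat.find (hex B) := by
    let p : List β → ℕ → Bool := fun B n =>
      decide (satStep comb ((satStep comb)^[n] B) ⊆ (satStep comb)^[n] B)
    have hp : Computable₂ p := by
      refine Computable.of_eq hdec.to_comp fun q => ?_
      simp [p]
    refine (Partrec.rfind hp.partrec₂).of_eq_tot fun B => ?_
    refine Nat.mem_rfind.2 ⟨?_, fun {m} hm => ?_⟩
    · simpa [p] using Nat.find_spec (hex B)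
    · simpa [p] using Nat.find_min (hex B) hm
  refine ⟨fun B => (satStep comb)^[Nat.find (hex B)] B,
    (hiter.to_comp).comp .id hfind, fun B x => mem_iff_clo_of_closed (Nat.find_spec (hex B)) x⟩

end Saturation

/-! ### Derivations with unbounded weights. -/

/-- Derivations from the facts of a list under a partial binary operation, with weights: a fact of
the list weighs zero or one, and weights add up. -/
inductive Der {α : Type*} (comb : α → α → Option α) (B : List (α × Bool)) : α → ℕ → Prop
  | base {x b} (h : (x, b) ∈ B) : Der comb B x b.toNat
  | comb {x y z m n} (h : comb x y = some z) (hx : Der comb B x m) (hy : Der comb B y n) :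
      Der comb B z (m + n)

section Weights

variable {α : Type*} (comb : α → α → Option α)

/-- The operation on facts that are flagged if they have been derived with positive weight. -/
def flagComb (x y : α × Bool) : Option (α × Bool) :=
  (comb x.1 y.1).map fun z => (z, x.2 || y.2)

/-- The pairs (conclusion, premise) of the derivation steps between flagged facts; a pair is flagged
if the other premise has positive weight. -/
def flagEdges [DecidableEq α] (T : List (α × Bool)) : List ((α × α) × Bool) :=
  T.flatMap fun x => T.flatMap fun y =>
    ((comb x.1 y.1).map fun z => [((z, x.1), y.2), ((z, y.1), x.2)]).getD []

/-- Composition of flagged pairs. -/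
def edgeComb [DecidableEq α] (x y : (α × α) × Bool) : Option ((α × α) × Bool) :=
  if x.1.2 = y.1.1 then some ((x.1.1, y.1.2), x.2 || y.2) else none

variable {comb}

/-- Weights form an infinite set, but whether they are positive can be computed with flags alone: a
sum is positive exactly if one of its terms is. This keeps the closure finite. -/
theorem clo_flagComb_iff {B : List (α × Bool)} {x : α} {b : Bool} :
    Clo (flagComb comb) B (x, b) ↔ ∃ n, Der comb B x n ∧ b = decide (0 < n) := by
  constructor
  · intro h
    generalize hp : (x, b) = p at h
    induction h generalizing x b with
    | base h =>
      subst hp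
      exact ⟨_, .base h, by cases b <;> simp⟩
    | @comb u v z h _ _ ihx ihy =>
      subst hp
      obtain ⟨m, hm, hm'⟩ := ihx rfl
      obtain ⟨n, hn, hn'⟩ := ihy rfl
      simp only [flagComb, Option.map_eq_some_iff, Prod.mk.injEq] at h
      obtain ⟨z, hz, rfl, rfl⟩ := h
      refine ⟨_, .comb hz hm hn, ?_⟩
      rw [hm', hn', Bool.eq_iff_iff]
      simp
  · rintro ⟨n, h, rfl⟩
    induction h with
    | @base x b h =>
      have : decide (0 < b.toNat) = b := by cases b <;> simp
      rw [this]
      exact .base h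
    | @comb x y z m n h _ _ ihx ihy =>
      refine .comb ?_ ihx ihy
      simp only [flagComb, h, Option.map_some, Option.some.injEq, Prod.mk.injEq, true_and]
      rw [Bool.eq_iff_iff]
      simp

variable [DecidableEq α]

theorem mem_flagEdges {T : List (α × Bool)} {f g : α} {b : Bool} :
    ((f, g), b) ∈ flagEdges comb T ↔ ∃ x ∈ T, ∃ y ∈ T, comb x.1 y.1 = some f ∧
      ((g = x.1 ∧ b = y.2) ∨ (g = y.1 ∧ b = x.2)) := by
  simp only [flagEdges, List.mem_flatMap]
  refine exists_congr fun x => and_congr_right fun _ => exists_congr fun y =>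
    and_congr_right fun _ => ?_
  cases h : comb x.1 y.1 with
  | none => simp
  | some z =>
    simp
    grind

/-- `g` occurs in a derivation of `f`, where the flag tells that it does so with an additional
positive weight. -/
def Ctx (comb : α → α → Option α) (T : List (α × Bool)) (f g : α) (b : Bool) : Prop :=
  Clo edgeComb (flagEdges comb T) ((f, g), b)

theorem Ctx.trans {T : List (α × Bool)} {f g h : α} {b b' : Bool} (h₁ : Ctx comb T f g b)
    (h₂ : Ctx comb T g h b') : Ctx comb T f h (b || b') :=
  .comb (by simp [edgeComb]) h₁ h₂

/-- A chain of steps from `g` up to `f` is a derivation with a hole at `g`. Fixing derivations of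
the side premises, any derivation of `g` can be plugged in, and a flag means that some side premise
contributes at least one. -/
theorem Ctx.exists_der {B T : List (α × Bool)} (hT : ∀ x, x ∈ T ↔ Clo (flagComb comb) B x)
    {f g : α} {b : Bool} (h : Ctx comb T f g b) :
    (∃ n, Der comb B g n) ∧ ∀ n, Der comb B g n → ∃ m, Der comb B f m ∧ n + b.toNat ≤ m := by
  unfold Ctx at h
  generalize hp : ((f, g), b) = p at h
  induction h generalizing f g b with
  | base h =>
    subst hp
    obtain ⟨⟨x, bx⟩, hx, ⟨y, by'⟩, hy, hz, h⟩ := mem_flagEdges.1 h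
    rw [hT, clo_flagComb_iff] at hx hy
    obtain ⟨m, hm, rfl⟩ := hx
    obtain ⟨n, hn, rfl⟩ := hy
    rcases h with ⟨rfl, rfl⟩ | ⟨rfl, rfl⟩
    · refine ⟨⟨m, hm⟩, fun k hk => ⟨_, .comb hz hk hn, ?_⟩⟩
      rcases Nat.eq_zero_or_pos n with rfl | hn <;> simp [*]
      omega
    · refine ⟨⟨n, hn⟩, fun k hk => ⟨_, .comb hz hm hk, ?_⟩⟩
      rcases Nat.eq_zero_or_pos m with rfl | hm <;> simp [*]
  | @comb u v w h _ _ ihx ihy =>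
    subst hp
    obtain ⟨⟨u1, u2⟩, ub⟩ := u
    obtain ⟨⟨v1, v2⟩, vb⟩ := v
    simp only [edgeComb, Option.ite_none_right_eq_some, Option.some.injEq, Prod.mk.injEq] at h
    obtain ⟨rfl, ⟨rfl, rfl⟩, rfl⟩ := h
    obtain ⟨h1, h2⟩ := ihy rfl
    refine ⟨h1, fun n hn => ?_⟩
    obtain ⟨m, hm, hle⟩ := h2 n hn
    obtain ⟨k, hk, hle'⟩ := (ihx rfl).2 m hm
    refine ⟨k, hk, ?_⟩
    have : (ub || vb).toNat ≤ ub.toNat + vb.toNat := by cases ub <;> cases vb <;> simp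
    omega

theorem Der.ctx {B T : List (α × Bool)} (hT : ∀ x, x ∈ T ↔ Clo (flagComb comb) B x)
    {x y z : α} {m n : ℕ} (h : comb x y = some z) (hx : Der comb B x m) (hy : Der comb B y n) :
    Ctx comb T z x (decide (0 < n)) ∧ Ctx comb T z y (decide (0 < m)) := by
  have hx' := (hT _).2 (clo_flagComb_iff.2 ⟨m, hx, rfl⟩)
  have hy' := (hT _).2 (clo_flagComb_iff.2 ⟨n, hy, rfl⟩)
  exact ⟨.base (mem_flagEdges.2 ⟨_, hx', _, hy', h, .inl ⟨rfl, rfl⟩⟩),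
    .base (mem_flagEdges.2 ⟨_, hx', _, hy', h, .inr ⟨rfl, rfl⟩⟩)⟩

/-- The derivations of a fact have unbounded weights if and only if some fact that occurs in them
occurs in its own derivation with an additional positive weight. -/
theorem infinite_der_iff {B T : List (α × Bool)} (hT : ∀ x, x ∈ T ↔ Clo (flagComb comb) B x)
    (hfin : {x | ∃ n, Der comb B x n}.Finite) (goal : α) :
    {n | Der comb B goal n}.Infinite ↔
      ∃ g, Ctx comb T g g true ∧ (g = goal ∨ ∃ b, Ctx comb T goal g b) := by
  constructor
  · intro hinf
    by_contra hno
    push Not at hno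
    let U : Set α := {x | (∃ n, Der comb B x n) ∧ (x = goal ∨ ∃ b, Ctx comb T goal x b)}
    have hU : U.Finite := hfin.subset fun x hx => hx.1
    have : Finite U := hU
    let r : U → U → Prop := fun x y => Ctx comb T y.1 x.1 true
    -- Contexts compose, and an element of `U` below itself would be a positive cycle relevant for
    -- the goal, which is excluded. On a finite set such a relation is well-founded.
    have hwf : WellFounded r := by
      have h1 : IsTrans U r := ⟨fun a b c hab hbc => by simpa using Ctx.trans hbc hab⟩
      have h2 : Std.Irrefl r := ⟨fun a haa => by
        rcases a.2.2 with h | ⟨b, hb⟩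
        · exact (hno _ haa).1 h
        · exact (hno _ haa).2 b hb⟩
      exact Finite.wellFounded_of_trans_of_irrefl r
    have main : ∀ f : U, ∃ N, ∀ n, Der comb B f.1 n → n ≤ N := by
      intro f
      induction f using hwf.induction with
      | _ f ih =>
        choose! N hN using ih
        obtain ⟨M, hM⟩ := (Set.finite_range N).bddAbove
        have hpos : ∀ x n, Der comb B x n → Ctx comb T f.1 x true → n ≤ M := by
          intro x n hx hc
          have hxU : x ∈ U := by
            refine ⟨⟨n, hx⟩, .inr ?_⟩
            rcases f.2.2 with h | ⟨b, hb⟩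
            · exact ⟨true, h ▸ hc⟩
            · exact ⟨_, hb.trans hc⟩
          exact (hN ⟨x, hxU⟩ hc n hx).trans (hM ⟨_, rfl⟩)
        -- Descend into a derivation as long as one of the two premises weighs zero; the weight does
        -- not change. The descent ends at a listed fact, of weight at most one, or at two premises
        -- of positive weight. Each of those is a positive context for the other, so both lie below
        -- `f` and weigh at most `M`.
        have : ∀ g n, Der comb B g n → (g = f.1 ∨ ∃ b, Ctx comb T f.1 g b) → n ≤ 1 + 2 * M := by
          intro g n hg
          induction hg with
          | @base x b h =>
            intro _
            have := b.toNat_le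
            omega
          | @comb x y z m n h hx hy ihx ihy =>
            intro hz
            obtain ⟨cx, cy⟩ := hx.ctx hT h hy
            have key : ∀ w b, Ctx comb T z w b →
                ∃ b', Ctx comb T f.1 w b' ∧ (b = true → b' = true) := by
              intro w b hw
              rcases hz with rfl | ⟨b', hb'⟩
              · exact ⟨b, hw, id⟩
              · exact ⟨_, hb'.trans hw, by simp +contextual⟩
            obtain ⟨b1, h1, h1'⟩ := key _ _ cx
            obtain ⟨b2, h2, h2'⟩ := key _ _ cy
            rcases Nat.eq_zero_or_pos n with rfl | hn
            · simpa using ihx (.inr ⟨_, h1⟩)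
            rcases Nat.eq_zero_or_pos m with rfl | hm
            · simpa using ihy (.inr ⟨_, h2⟩)
            have e1 := hpos _ _ hx (h1' (by simpa using hn) ▸ h1)
            have e2 := hpos _ _ hy (h2' (by simpa using hm) ▸ h2)
            omega
        exact ⟨_, fun n hn => this _ n hn (.inl rfl)⟩
    obtain ⟨n0, hn0⟩ := hinf.nonempty
    obtain ⟨N, hN⟩ := main ⟨goal, ⟨n0, hn0⟩, .inl rfl⟩
    exact hinf ((Set.finite_Iic N).subset fun n hn => hN n hn)
  · rintro ⟨g, hg, h⟩
    -- Going once around the positive cycle raises the weight by at least one.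
    have hunb : ∀ N, ∃ n, N ≤ n ∧ Der comb B g n := by
      intro N
      induction N with
      | zero =>
        obtain ⟨n, hn⟩ := (hg.exists_der hT).1
        exact ⟨n, Nat.zero_le _, hn⟩
      | succ N ih =>
        obtain ⟨n, hle, hn⟩ := ih
        obtain ⟨m, hm, hle'⟩ := (hg.exists_der hT).2 n hn
        simp only [Bool.toNat_true] at hle'
        exact ⟨m, by omega, hm⟩
    refine Set.infinite_of_forall_exists_gt fun N => ?_
    obtain ⟨n, hle, hn⟩ := hunb (N + 1)
    rcases h with rfl | ⟨b, hb⟩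
    · exact ⟨n, hn, by omega⟩
    · obtain ⟨m, hm, hle'⟩ := (hb.exists_der hT).2 n hn
      exact ⟨m, hm, by omega⟩

/-- It is decidable whether the derivations of a fact have unbounded weights. -/
theorem computablePred_infinite_der [Primcodable α] (hcomb : Primrec₂ comb)
    (hfin : ∀ B, {x | Clo comb B x}.Finite) :
    ComputablePred fun p : List (α × Bool) × α => {n | Der comb p.1 p.2 n}.Infinite := by
  have hfin' : ∀ B, {x | Clo (flagComb comb) B x}.Finite := by
    intro B
    refine ((hfin (B.map Prod.fst)).prod (Set.finite_univ (α := Bool))).subset fun x hx => ?_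
    refine ⟨?_, trivial⟩
    induction hx with
    | base h => exact .base (List.mem_map_of_mem h)
    | comb h _ _ ihx ihy =>
      simp only [flagComb, Option.map_eq_some_iff] at h
      obtain ⟨z, hz, rfl⟩ := h
      exact .comb hz ihx ihy
  have hfinE : ∀ B : List ((α × α) × Bool), {x | Clo edgeComb B x}.Finite := by
    intro B
    have h1 := (B.map fun e => e.1.1).finite_toSet
    have h2 := (B.map fun e => e.1.2).finite_toSet
    refine ((h1.prod h2).prod (Set.finite_univ (α := Bool))).subset fun x hx => ?_
    refine ⟨?_, trivial⟩
    induction hx with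
    | base h => exact ⟨List.mem_map_of_mem (f := fun e => e.1.1) h,
        List.mem_map_of_mem (f := fun e => e.1.2) h⟩
    | comb h _ _ ihx ihy =>
      simp only [edgeComb, Option.ite_none_right_eq_some, Option.some.injEq] at h
      obtain ⟨_, rfl⟩ := h
      exact ⟨ihx.1, ihy.2⟩
  have hflag : Primrec₂ (flagComb comb) := by
    refine Primrec.option_map (hcomb.comp (Primrec.fst.comp .fst) (Primrec.fst.comp .snd)) ?_
    exact Primrec.pair .snd (Primrec.or.comp (Primrec.snd.comp (Primrec.fst.comp .fst))
      (Primrec.snd.comp (Primrec.snd.comp .fst)))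
  have hedge : Primrec₂ (edgeComb (α := α)) := by
    refine Primrec.ite (Primrec.eq.comp (Primrec.snd.comp (Primrec.fst.comp .fst))
      (Primrec.fst.comp (Primrec.fst.comp .snd))) (Primrec.option_some.comp ?_) (.const none)
    exact .pair (.pair (Primrec.fst.comp (Primrec.fst.comp .fst))
      (Primrec.snd.comp (Primrec.fst.comp .snd)))
      (Primrec.or.comp (Primrec.snd.comp .fst) (Primrec.snd.comp .snd))
  have hedges : Primrec (flagEdges comb) := by
    refine Primrec.list_flatMap .id (Primrec.list_flatMap .fst ?_)
    have hx : Primrec fun p : (List (α × Bool) × (α × Bool)) × (α × Bool) => p.1.2 :=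
      Primrec.snd.comp .fst
    have hy : Primrec fun p : (List (α × Bool) × (α × Bool)) × (α × Bool) => p.2 := .snd
    refine Primrec.option_getD.comp (Primrec.option_map
      (hcomb.comp (Primrec.fst.comp hx) (Primrec.fst.comp hy)) ?_) (.const [])
    refine Primrec.list_cons.comp (.pair (.pair .snd (Primrec.fst.comp (hx.comp .fst)))
      (Primrec.snd.comp (hy.comp .fst))) (Primrec.list_cons.comp
      (.pair (.pair .snd (Primrec.fst.comp (hy.comp .fst))) (Primrec.snd.comp (hx.comp .fst)))
      (.const []))
  obtain ⟨sat, hsat, hsat'⟩ := exists_computable_sat hflag hfin'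
  obtain ⟨satE, hsatE, hsatE'⟩ := exists_computable_sat hedge hfinE
  have hcheck : PrimrecPred fun p : List ((α × α) × Bool) × α =>
      ∃ e ∈ p.1, (e.1.1 = e.1.2 ∧ e.2 = true) ∧
        (e.1.1 = p.2 ∨ ∃ e' ∈ p.1, e'.1.1 = p.2 ∧ e'.1.2 = e.1.1) := by
    have hin : PrimrecRel fun (L : List ((α × α) × Bool)) (q : α × α) =>
        ∃ e' ∈ L, e'.1.1 = q.2 ∧ e'.1.2 = q.1 := by
      refine PrimrecRel.exists_mem_list
        (R := fun (e' : (α × α) × Bool) (q : α × α) => e'.1.1 = q.2 ∧ e'.1.2 = q.1) ?_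
      exact (Primrec.eq.comp (Primrec.fst.comp (Primrec.fst.comp .fst)) (Primrec.snd.comp .snd)).and
        (Primrec.eq.comp (Primrec.snd.comp (Primrec.fst.comp .fst)) (Primrec.fst.comp .snd))
    have hout : PrimrecRel fun (L : List ((α × α) × Bool)) (q : List ((α × α) × Bool) × α) =>
        ∃ e ∈ L, (e.1.1 = e.1.2 ∧ e.2 = true) ∧
          (e.1.1 = q.2 ∨ ∃ e' ∈ q.1, e'.1.1 = q.2 ∧ e'.1.2 = e.1.1) := by
      refine PrimrecRel.exists_mem_list
        (R := fun (e : (α × α) × Bool) (q : List ((α × α) × Bool) × α) =>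
        (e.1.1 = e.1.2 ∧ e.2 = true) ∧
          (e.1.1 = q.2 ∨ ∃ e' ∈ q.1, e'.1.1 = q.2 ∧ e'.1.2 = e.1.1)) ?_
      have e11 : Primrec fun p : ((α × α) × Bool) × (List ((α × α) × Bool) × α) => p.1.1.1 :=
        Primrec.fst.comp (Primrec.fst.comp .fst)
      have q2 : Primrec fun p : ((α × α) × Bool) × (List ((α × α) × Bool) × α) => p.2.2 :=
        Primrec.snd.comp .snd
      exact ((Primrec.eq.comp e11 (Primrec.snd.comp (Primrec.fst.comp .fst))).and
        (Primrec.eq.comp (Primrec.snd.comp .fst) (.const true))).and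
        ((Primrec.eq.comp e11 q2).or
          (hin.comp (Primrec.fst.comp .snd) (.pair e11 q2)))
    exact hout.comp .fst .id
  obtain ⟨_, hcheck⟩ := hcheck
  refine ComputablePred.computable_iff.2 ⟨_, hcheck.to_comp.comp (.pair
    (hsatE.comp (hedges.to_comp.comp (hsat.comp .fst))) .snd), ?_⟩
  funext p
  have hfinD : {x | ∃ n, Der comb p.1 x n}.Finite := by
    refine ((hfin' p.1).image Prod.fst).subset ?_
    rintro x ⟨n, hn⟩
    exact ⟨(x, decide (0 < n)), clo_flagComb_iff.2 ⟨n, hn, rfl⟩, rfl⟩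
  rw [infinite_der_iff (T := sat p.1) (hsat' _) hfinD]
  simp only [decide_eq_true_eq, eq_iff_iff, hsatE']
  constructor
  · rintro ⟨g, hg, h⟩
    refine ⟨((g, g), true), hg, ⟨rfl, rfl⟩, ?_⟩
    rcases h with h | ⟨b, hb⟩
    · exact .inl h
    · exact .inr ⟨((p.2, g), b), hb, rfl, rfl⟩
  · rintro ⟨⟨⟨g, g'⟩, b⟩, hg, ⟨h1, h2⟩, h⟩
    dsimp only at h1 h2 h
    subst h1 h2
    refine ⟨g, hg, ?_⟩
    rcases h with h | ⟨⟨⟨x, y⟩, b⟩, hb, h1, h2⟩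
    · exact .inl h
    · dsimp only at h1 h2
      subst h1 h2
      exact .inr ⟨b, hb⟩

end Weights

/-! ### Weighted pushdown systems and their derived rules. -/

/-- A rule of a pushdown system: in a state with a given top symbol, halt (`none`), or enter a state
and replace the top symbol by a word. -/
abbrev PushRule (S Z : Type*) := (S × Z) × Option (S × List Z)

/-- The pushdown system with the weighted rules `B` has a run of a given weight that starts with a
given state and pushdown content and halts. -/
inductive Halts {S Z : Type*} (B : List (PushRule S Z × Bool)) : S → List Z → ℕ → Prop
  | halt {s z w b} (h : (((s, z), none), b) ∈ B) : Halts B s (z :: w) b.toNat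
  | step {s z w s' u b n} (h : (((s, z), some (s', u)), b) ∈ B) (hr : Halts B s' (u ++ w) n) :
      Halts B s (z :: w) (b.toNat + n)

theorem Halts.append {S Z : Type*} {B : List (PushRule S Z × Bool)} {s : S} {w : List Z} {n : ℕ}
    (h : Halts B s w n) (t : List Z) : Halts B s (w ++ t) n := by
  induction h with
  | halt h => exact .halt h
  | step h _ ih => exact .step h (by simpa using ih)

section PushdownSystem

variable {S Z : Type*} [DecidableEq S] [DecidableEq Z]

/-- Composition of a run that replaces a top symbol by `z :: v` with a run that removes `z` or
halts. -/
def pushComb (x y : PushRule S Z) : Option (PushRule S Z) :=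
  x.2.bind fun p => p.2.head?.bind fun z =>
    if y.1 = (p.1, z) then
      y.2.elim (some (x.1, none)) fun q =>
        if q.2 = [] then some (x.1, some (q.1, p.2.tail)) else none
    else none

theorem pushComb_eq_some {x y w : PushRule S Z} : pushComb x y = some w ↔
    ∃ s z v, x.2 = some (s, z :: v) ∧ y.1 = (s, z) ∧
      ((y.2 = none ∧ w = (x.1, none)) ∨ ∃ s', y.2 = some (s', []) ∧ w = (x.1, some (s', v))) := by
  obtain ⟨h, _ | ⟨s, _ | ⟨z, v⟩⟩⟩ := x <;> obtain ⟨h', _ | ⟨s', v'⟩⟩ := y <;>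
    simp [pushComb] <;> grind

/-- Composition keeps the left-hand side of its first argument and only shortens its word from the
front. So the word of a derived rule is a suffix of a word in `B`, and its state is the target of a
possibly different rule in `B`. -/
theorem finite_clo_pushComb (B : List (PushRule S Z)) : {x | Clo pushComb B x}.Finite := by
  let V : Set (Option (S × List Z)) := {o | o = none ∨
    ∃ r₁ ∈ B, ∃ r₂ ∈ B, ∃ p₁ ∈ r₁.2, ∃ p₂ ∈ r₂.2, ∃ v ∈ p₂.2.tails, o = some (p₁.1, v)}
  have hV : V.Finite := by
    have : V = {none} ∪ ⋃ r₁ ∈ B, ⋃ r₂ ∈ B, ⋃ p₁ ∈ r₁.2, ⋃ p₂ ∈ r₂.2,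
        (fun v => some (p₁.1, v)) '' {v | v ∈ p₂.2.tails} := by
      ext o
      simp only [V, Set.mem_ofPred_eq, Set.mem_union, Set.mem_iUnion, Set.mem_singleton_iff,
        Set.mem_image, exists_prop, eq_comm]
    rw [this]
    refine (Set.finite_singleton _).union (B.finite_toSet.biUnion fun r₁ _ =>
      B.finite_toSet.biUnion fun r₂ _ => ?_)
    have hopt : ∀ o : Option (S × List Z), {p | p ∈ o}.Finite := fun o =>
      (o.toList.finite_toSet).subset fun p hp => by simpa using hp
    exact (hopt _).biUnion fun p₁ _ => (hopt _).biUnion fun p₂ _ =>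
      (List.finite_toSet _).image _
  refine (((B.map Prod.fst).finite_toSet).prod hV).subset fun x hx => ?_
  induction hx with
  | @base x h =>
    refine ⟨List.mem_map_of_mem h, ?_⟩
    cases hx : x.2 with
    | none => exact .inl rfl
    | some p => exact .inr ⟨x, h, x, h, p, hx, p, hx, p.2, by simp, rfl⟩
  | comb h _ _ ihx ihy =>
    obtain ⟨s, z, v, hx, hy, ⟨_, rfl⟩ | ⟨s', hy', rfl⟩⟩ := pushComb_eq_some.1 h
    · exact ⟨ihx.1, .inl rfl⟩
    · refine ⟨ihx.1, .inr ?_⟩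
      obtain ⟨-, h1⟩ := ihx
      obtain ⟨-, h2⟩ := ihy
      rw [hx] at h1
      rw [hy'] at h2
      simp only [V, Set.mem_ofPred_eq, reduceCtorEq, false_or] at h1 h2
      obtain ⟨_, _, r₂, hr₂, _, _, p₂, hp₂, w, hw, hw'⟩ := h1
      obtain ⟨r₁, hr₁, _, _, p₁, hp₁, _, _, _, _, hp'⟩ := h2
      simp only [Option.some.injEq, Prod.mk.injEq] at hw' hp'
      refine ⟨r₁, hr₁, r₂, hr₂, p₁, hp₁, p₂, hp₂, v, ?_, by rw [hp'.1]⟩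
      rw [List.mem_tails] at hw ⊢
      exact (List.suffix_cons z v).trans (hw'.2 ▸ hw)

/-- Soundness of saturation: a derived rule abbreviates a run that does not touch what lies below
its top symbol, so it works above any `w`, and composing rules concatenates runs and adds weights.
-/
theorem Der.halts {B : List (PushRule S Z × Bool)} {x : PushRule S Z} {n : ℕ}
    (h : Der pushComb B x n) :
    (x.2 = none → ∀ w, Halts B x.1.1 (x.1.2 :: w) n) ∧
    ∀ s' v, x.2 = some (s', v) → ∀ w m, Halts B s' (v ++ w) m →
      Halts B x.1.1 (x.1.2 :: w) (n + m) := by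
  induction h with
  | @base x b h =>
    obtain ⟨⟨s, z⟩, o⟩ := x
    refine ⟨?_, ?_⟩
    · rintro rfl w
      exact .halt h
    · rintro s' v rfl w m hw
      exact .step h hw
  | @comb x y w m n h _ _ ihx ihy =>
    obtain ⟨s, z, v, hx, hy, ⟨hy', rfl⟩ | ⟨s', hy', rfl⟩⟩ := pushComb_eq_some.1 h
    · refine ⟨fun _ w => ihx.2 _ _ hx _ _ ?_, by simp⟩
      simpa [hy] using ihy.1 hy' (v ++ w)
    · refine ⟨by simp, ?_⟩
      rintro t u ht w k hk
      simp only [Option.some.injEq, Prod.mk.injEq] at ht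
      obtain ⟨rfl, rfl⟩ := ht
      rw [add_assoc]
      refine ihx.2 _ _ hx _ _ ?_
      simpa [hy] using ihy.2 _ _ hy' (v ++ w) k hk

/-- A halting run from a pushdown content, cut into the parts in which the successive symbols of
that content are on top or covered. -/
def DerStack (B : List (PushRule S Z × Bool)) : S → List Z → ℕ → Prop
  | _, [], _ => False
  | s, z :: w, n => Der pushComb B ((s, z), none) n ∨
      ∃ s' k m, Der pushComb B ((s, z), some (s', [])) k ∧ DerStack B s' w m ∧ n = k + m

/-- The word `u` is used up from its top: each of its symbols is either removed, which shortens the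
derived rule by one symbol, or never removed because the run halts above it, which gives a derived
halting rule. -/
theorem DerStack.cons_of_append {B : List (PushRule S Z × Bool)} {s : S} {z : Z} {w : List Z}
    {n : ℕ} (u : List Z) {s' : S} {k : ℕ} (h : Der pushComb B ((s, z), some (s', u)) k)
    (hn : DerStack B s' (u ++ w) n) : DerStack B s (z :: w) (k + n) := by
  induction u generalizing s' k n with
  | nil => exact .inr ⟨s', k, n, h, hn, rfl⟩
  | cons y u ih =>
    rcases hn with hn | ⟨t, i, j, hi, hj, rfl⟩
    · exact .inl (.comb (pushComb_eq_some.2 ⟨_, _, _, rfl, rfl, .inl ⟨rfl, rfl⟩⟩) h hn)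
    · rw [← add_assoc]
      exact ih (.comb (pushComb_eq_some.2 ⟨_, _, _, rfl, rfl, .inr ⟨_, rfl, rfl⟩⟩) h hi) hj

theorem Halts.derStack {B : List (PushRule S Z × Bool)} {s : S} {w : List Z} {n : ℕ}
    (h : Halts B s w n) : DerStack B s w n := by
  induction h with
  | halt h => exact .inl (.base h)
  | step h _ ih => exact .cons_of_append _ (.base h) ih

theorem halts_singleton_iff {B : List (PushRule S Z × Bool)} {s : S} {z : Z} {n : ℕ} :
    Halts B s [z] n ↔ Der pushComb B ((s, z), none) n := by
  refine ⟨fun h => ?_, fun h => h.halts.1 rfl []⟩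
  rcases h.derStack with h | ⟨_, _, _, _, h, _⟩
  · exact h
  · exact h.elim

theorem primrec₂_pushComb [Primcodable S] [Primcodable Z] :
    Primrec₂ (pushComb (S := S) (Z := Z)) := by
  let P := PushRule S Z × PushRule S Z
  have hx : Primrec fun p : (P × S × List Z) × Z => p.1.1.1 :=
    Primrec.fst.comp (Primrec.fst.comp .fst)
  have hy : Primrec fun p : (P × S × List Z) × Z => p.1.1.2 :=
    Primrec.snd.comp (Primrec.fst.comp .fst)
  have hp : Primrec fun p : (P × S × List Z) × Z => p.1.2 := Primrec.snd.comp .fst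
  refine Primrec.option_bind (Primrec.snd.comp .fst) (Primrec.option_bind
    (Primrec.list_head?.comp (Primrec.snd.comp .snd)) ?_)
  refine Primrec.ite (Primrec.eq.comp (Primrec.fst.comp hy) (.pair (Primrec.fst.comp hp) .snd))
    ?_ (.const none)
  have : Primrec fun p : (P × S × List Z) × Z =>
      Option.casesOn (motive := fun _ => Option (PushRule S Z)) p.1.1.2.2
      (some (p.1.1.1.1, none))
      fun q => if q.2 = [] then some (p.1.1.1.1, some (q.1, p.1.2.2.tail)) else none := by
    refine Primrec.option_casesOn (Primrec.snd.comp hy)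
      (Primrec.option_some.comp (.pair (Primrec.fst.comp hx) (.const none))) ?_
    refine Primrec.ite (Primrec.eq.comp (Primrec.snd.comp .snd) (.const [])) ?_ (.const none)
    exact Primrec.option_some.comp (.pair (Primrec.fst.comp (hx.comp .fst))
      (Primrec.option_some.comp (.pair (Primrec.fst.comp .snd)
        (Primrec.list_tail.comp (Primrec.snd.comp (hp.comp .fst))))))
  exact this.of_eq fun p => by cases p.1.1.2.2 <;> rfl

/-- It is decidable whether the halting runs of a pushdown system from a given state and top symbol
have unbounded weights. -/
theorem computablePred_infinite_halts [Primcodable S] [Primcodable Z] :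
    ComputablePred fun p : List (PushRule S Z × Bool) × (S × Z) =>
      {n | Halts p.1 p.2.1 [p.2.2] n}.Infinite := by
  obtain ⟨f, hf, hf'⟩ := ComputablePred.computable_iff.1
    (computablePred_infinite_der (primrec₂_pushComb (S := S) (Z := Z)) finite_clo_pushComb)
  refine ComputablePred.computable_iff.2 ⟨fun p => f (p.1, (p.2, none)),
    hf.comp (.pair .fst (.pair .snd (.const none))), ?_⟩
  funext p
  rw [← congrFun hf' (p.1, (p.2, none))]
  simp only [halts_singleton_iff]

end PushdownSystem

/-! ### A common form of the automata, and runs with deletions in order. -/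

/-- Scanning a word in the returning mode: without reading, up to the endmarker, or up to the first
letter that is not translucent, which is deleted. -/
inductive Scans {Q S : Type*} (tr : Q → S → Prop) (q : Q) :
    Option (Option S) → List S → List S → Prop
  | lambda (w) : Scans tr q none w w
  | endmarker {w} (h : ∀ b ∈ w, tr q b) : Scans tr q (some none) w w
  | letter {x a y} (hx : ∀ b ∈ x, tr q b) (ha : ¬ tr q a) :
      Scans tr q (some (some a)) (x ++ a :: y) (x ++ y)

/-- The configuration after a move: `none` accepts, `some (q, u)` enters `q` and replaces the top of
the pushdown by `u`. -/
def Config.next {Q S G : Type*} (o : Option (Q × List G)) (w : List S) (γ : List G) :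
    Config Q S G :=
  o.elim .accept fun p => .run p.1 w (p.2 ++ γ.tail)

/-- The steps of a nondeterministic pushdown automaton with translucent letters. -/
inductive TStep {Q S G : Type*} (tr : Q → S → Prop)
    (δ : Q → Option (Option S) → Option G → Option (Q × List G) → Prop) :
    Config Q S G → Config Q S G → Prop
  | mk {q s w w' γ o} (hs : Scans tr q s w w') (hδ : δ q s γ.head? o) :
      TStep tr δ (.run q w γ) (.next o w' γ)

/-- The letters of the automata described by `Mach`. -/
abbrev InSym := ℕ × ℕ

/-- A finite description of a nondeterministic pushdown automaton with translucent letters: the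
initial state, the letters, the translucency mapping and the moves. A scanned symbol is `none` for a
`λ`-move and `some none` for the endmarker; the outcome `none` is `accept`. -/
abbrev Mach := ℕ × List InSym × List (ℕ × InSym) ×
  List ((ℕ × Option (Option InSym) × Option ℕ) × Option (ℕ × List ℕ))

namespace Mach

/-- The initial state. -/
def init (m : Mach) : ℕ := m.1
/-- The input letters. -/
def letters (m : Mach) : List InSym := m.2.1
/-- The pairs of a state and a letter that is translucent for it. -/
def transl (m : Mach) : List (ℕ × InSym) := m.2.2.1
/-- The moves. -/
def rules (m : Mach) : List ((ℕ × Option (Option InSym) × Option ℕ) × Option (ℕ × List ℕ)) :=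
  m.2.2.2

/-- The steps of the automaton. -/
abbrev Step (m : Mach) : Config ℕ InSym ℕ → Config ℕ InSym ℕ → Prop :=
  TStep (fun q a => (q, a) ∈ m.transl) fun q s z o => ((q, s, z), o) ∈ m.rules

/-- Acceptance of a word. -/
def Accepts (m : Mach) (w : List InSym) : Prop :=
  Relation.ReflTransGen m.Step (.run m.init w []) .accept

/-- Scanning when only the set of letters is known that may still be deleted: whether a letter is
deleted, and the letters that may be deleted afterwards. -/
def scan (m : Mach) (q : ℕ) (s : Option (Option InSym)) (A : List InSym) :
    Option (Bool × List InSym) :=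
  s.elim (some (false, A)) fun t =>
    t.elim (some (false, A.filter fun a => (q, a) ∈ m.transl)) fun a =>
      if a ∈ A ∧ (q, a) ∉ m.transl then some (true, A) else none

/-- Runs in which the letters are deleted in the order in which they occur: from a state, the
letters that may still be deleted, and a pushdown content to another such triple, with the number of
deleted letters. -/
inductive ORun (m : Mach) :
    ℕ → List InSym → List ℕ → ℕ → List InSym → List ℕ → ℕ → Prop
  | refl (q A γ) : ORun m q A γ q A γ 0
  | step {q s A γ q' u l A' q'' A'' γ'' n} (hδ : ((q, s, γ.head?), some (q', u)) ∈ m.rules)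
      (hs : m.scan q s A = some (l, A')) (hr : ORun m q' A' (u ++ γ.tail) q'' A'' γ'' n) :
      ORun m q A γ q'' A'' γ'' (l.toNat + n)

variable {m : Mach}

/-- The set `A` is an upper bound for the letters left. A deletion keeps `A`, since further copies
of the letter may remain; a move on the endmarker proves all remaining letters translucent and may
therefore filter `A`. -/
theorem scan_of_scans {q : ℕ} {s : Option (Option InSym)} {w w' A : List InSym}
    (h : Scans (fun q a => (q, a) ∈ m.transl) q s w w') (hw : w ⊆ A) :
    ∃ l A', m.scan q s A = some (l, A') ∧ w' ⊆ A' ∧ w.length = l.toNat + w'.length := by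
  cases h with
  | lambda => exact ⟨_, _, rfl, hw, by simp⟩
  | endmarker h =>
    refine ⟨_, _, rfl, fun a ha => ?_, by simp⟩
    simpa using ⟨hw ha, h a ha⟩
  | @letter x a y hx ha =>
    refine ⟨true, A, ?_, fun b hb => hw ?_, ?_⟩
    · have : a ∈ A := hw (by simp)
      simp [scan, this, ha]
    · simp only [List.mem_append, List.mem_cons] at hb ⊢
      tauto
    · simp
      omega

/-- An abstract scan is realised on any suitable remainder `x` by putting the deleted letter, if
there is one, at the left end, where it is scanned at once. -/
theorem scans_of_scan {q : ℕ} {s : Option (Option InSym)} {A A' : List InSym} {l : Bool}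
    (h : m.scan q s A = some (l, A')) : List.Sublist A' A ∧
      ∀ x ⊆ A', ∃ v ⊆ A, v.length = l.toNat ∧
        Scans (fun q a => (q, a) ∈ m.transl) q s (v ++ x) x := by
  rcases s with _ | _ | a
  · simp only [scan, Option.elim, Option.some.injEq, Prod.mk.injEq] at h
    obtain ⟨rfl, rfl⟩ := h
    exact ⟨.refl _, fun x _ => ⟨[], by simp, rfl, .lambda _⟩⟩
  · simp only [scan, Option.elim, Option.some.injEq, Prod.mk.injEq] at h
    obtain ⟨rfl, rfl⟩ := h
    refine ⟨List.filter_sublist, fun x hx => ⟨[], by simp, rfl, .endmarker fun b hb => ?_⟩⟩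
    simpa using (List.mem_filter.1 (hx hb)).2
  · simp only [scan, Option.elim, Option.ite_none_right_eq_some, Option.some.injEq,
      Prod.mk.injEq] at h
    obtain ⟨⟨ha, ha'⟩, rfl, rfl⟩ := h
    exact ⟨.refl _, fun x _ => ⟨[a], by simpa using ha, rfl,
      .letter (x := []) (by simp) ha'⟩⟩

theorem step_run {q : ℕ} {s : Option (Option InSym)} {w w' : List InSym} {γ u : List ℕ} {q' : ℕ}
    (hs : Scans (fun q a => (q, a) ∈ m.transl) q s w w')
    (hδ : ((q, s, γ.head?), some (q', u)) ∈ m.rules) :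
    m.Step (.run q w γ) (.run q' w' (u ++ γ.tail)) :=
  TStep.mk (δ := fun q s z o => ((q, s, z), o) ∈ m.rules) hs hδ

theorem step_accept {q : ℕ} {s : Option (Option InSym)} {w w' : List InSym} {γ : List ℕ}
    (hs : Scans (fun q a => (q, a) ∈ m.transl) q s w w')
    (hδ : ((q, s, γ.head?), none) ∈ m.rules) : m.Step (.run q w γ) .accept :=
  TStep.mk (δ := fun q s z o => ((q, s, z), o) ∈ m.rules) hs hδ

theorem ORun.trans {q A γ q' A' γ' n q'' A'' γ'' k} (h : ORun m q A γ q' A' γ' n)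
    (h' : ORun m q' A' γ' q'' A'' γ'' k) : ORun m q A γ q'' A'' γ'' (n + k) := by
  induction h with
  | refl => simpa using h'
  | step hδ hs _ ih => exact add_assoc _ _ k ▸ .step hδ hs (ih h')

theorem ORun.snoc {q A γ q' A' γ' n s q'' u l A''} (h : ORun m q A γ q' A' γ' n)
    (hδ : ((q', s, γ'.head?), some (q'', u)) ∈ m.rules) (hs : m.scan q' s A' = some (l, A'')) :
    ORun m q A γ q'' A'' (u ++ γ'.tail) (n + l.toNat) := by
  simpa using h.trans (.step hδ hs (.refl _ _ _))

theorem ORun.sublist {q A γ q' A' γ' n} (h : ORun m q A γ q' A' γ' n) : List.Sublist A' A := by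
  induction h with
  | refl => exact .refl _
  | step _ hs _ ih => exact ih.trans (scans_of_scan hs).1

theorem exists_oRun {q w γ q' x γ' A}
    (h : Relation.ReflTransGen m.Step (.run q w γ) (.run q' x γ')) (hw : w ⊆ A) :
    ∃ A' n, ORun m q A γ q' A' γ' n ∧ x ⊆ A' ∧ w.length = n + x.length := by
  generalize hC : Config.run q w γ = C at h
  induction h using Relation.ReflTransGen.head_induction_on generalizing q w γ A with
  | refl =>
    cases hC
    exact ⟨A, 0, .refl _ _ _, hw, by simp⟩
  | head h1 h2 ih =>
    subst hC
    cases h1 with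
    | @mk _ s _ w' _ o hs hδ =>
      cases o with
      | none =>
        cases h2.cases_head with
        | inl h => cases h
        | inr h =>
          obtain ⟨_, h, _⟩ := h
          cases h
      | some p =>
        obtain ⟨l, A1, h3, h4, h5⟩ := scan_of_scans hs hw
        obtain ⟨A', n, h6, h7, h8⟩ := ih h4 rfl
        exact ⟨A', _, .step hδ h3 h6, h7, by omega⟩

/-- The word is built from the end of the run backwards, each deleted letter being put in front. All
later letters belong to the set `A'` allowed after the current step, which is what an endmarker move
needs. -/
theorem ORun.exists_word {q A γ q' A' γ' n} (h : ORun m q A γ q' A' γ' n) {x : List InSym}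
    (hx : x ⊆ A') : ∃ v ⊆ A, v.length = n ∧
      Relation.ReflTransGen m.Step (.run q (v ++ x) γ) (.run q' x γ') := by
  induction h with
  | refl => exact ⟨[], by simp, rfl, .refl⟩
  | @step q s A γ q' u l A' q'' A'' γ'' n hδ hs hr ih =>
    obtain ⟨v, hv, rfl, h1⟩ := ih hx
    have hvx : v ++ x ⊆ A' := List.append_subset.2 ⟨hv, List.Subset.trans hx hr.sublist.subset⟩
    obtain ⟨v', hv', h2, h3⟩ := (scans_of_scan hs).2 _ hvx
    refine ⟨v' ++ v, List.append_subset.2 ⟨hv', List.Subset.trans hv (scans_of_scan hs).1.subset⟩,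
      by simp [h2], .head ?_ h1⟩
    rw [List.append_assoc]
    exact step_run h3 hδ

/-- The letters `A` may still be left when, in state `q`, the automaton accepts, and the letters
`A'` may occur in what follows the last deletion. -/
def Ends (m : Mach) (q : ℕ) (A : List InSym) (γ : List ℕ) (A' : List InSym) : Prop :=
  ∃ s l, ((q, s, γ.head?), none) ∈ m.rules ∧ m.scan q s A = some (l, A')

/-- The last clause lets the number of deletions stand for the length of the word when no letter is
allowed at the end. An accepting move on a letter never has `A' = []`, as that letter itself stays
allowed. -/
theorem Accepts.exists_oRun {w : List InSym} (h : m.Accepts w) (hw : w ⊆ m.letters) :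
    ∃ q A γ n x A', ORun m m.init m.letters [] q A γ n ∧ Ends m q A γ A' ∧
      w.length = n + x.length ∧ x ⊆ A ∧ (A' = [] → x = []) := by
  obtain ⟨C, h1, h2⟩ : ∃ C, Relation.ReflTransGen m.Step (.run m.init w []) C ∧
      m.Step C .accept := by
    rcases h.cases_tail with h | h
    · cases h
    · exact h
  generalize hD : Config.accept = D at h2
  cases h2 with
  | @mk q s x x' γ o hs hδ =>
    cases o with
    | some p => cases hD
    | none =>
      obtain ⟨A, n, h3, h4, h5⟩ := Mach.exists_oRun h1 hw
      obtain ⟨l, A', h6, h7, h8⟩ := scan_of_scans hs h4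
      refine ⟨q, A, γ, n, x, A', h3, ⟨s, l, hδ, h6⟩, h5, h4, ?_⟩
      rintro rfl
      cases hs with
      | lambda => simpa using h7
      | endmarker => simpa using h7
      | letter hx ha =>
        simp only [scan, Option.elim, Option.ite_none_right_eq_some, Option.some.injEq,
          Prod.mk.injEq] at h6
        exact absurd h6.1.1 (by simp [h6.2.2])

theorem ORun.accepts {q A γ n A'} (h : ORun m m.init m.letters [] q A γ n)
    (he : Ends m q A γ A') {y : List InSym} (hy : y ⊆ A') :
    ∃ w ⊆ m.letters, m.Accepts w ∧ n + y.length ≤ w.length := by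
  obtain ⟨s, l, hδ, hs⟩ := he
  obtain ⟨v, hv, -, h1⟩ := (scans_of_scan hs).2 y hy
  obtain ⟨v', hv', rfl, h2⟩ := h.exists_word
    (List.append_subset.2 ⟨hv, List.Subset.trans hy (scans_of_scan hs).1.subset⟩)
  refine ⟨v' ++ (v ++ y), ?_, h2.tail (step_accept h1 hδ), by simp⟩
  have := h.sublist.subset
  have := (scans_of_scan hs).1.subset
  grind

end Mach

/-! ### Emptiness and finiteness as questions about pushdown systems. -/

namespace Mach

/-- States of the pushdown systems below: a phase, a state and a set of letters. -/
abbrev SysState := ℕ × ℕ × List InSym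

/-- Pushdown symbols of the systems below: `none` is an auxiliary bottom, and `some none` is the
bottom of the automaton. -/
abbrev SysSym := Option (Option ℕ)

/-- The phase in which a run is simulated in which letters are deleted in order. -/
def runSt (q : ℕ) (A : List InSym) : SysState := (0, q, A)
/-- The phase in which an infinite run without deletions is simulated. -/
def divSt (q : ℕ) : SysState := (1, q, [])
/-- A state with halting runs of all weights. -/
def loopSt : SysState := (2, 0, [])

/-- A pushdown content together with the bottom symbol. -/
def stack (γ : List ℕ) : List SysSym := γ.map (fun g => some (some g)) ++ [some none]

/-- The word that replaces the top symbol `z` in a move that pushes `u`. -/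
def lift (u : List ℕ) (z : Option ℕ) : List SysSym :=
  u.map (fun g => some (some g)) ++ if z = none then [some none] else []

/-- The pushdown content below the top symbol. -/
def below : List ℕ → List SysSym
  | [] => []
  | _ :: γ => stack γ

theorem stack_eq (γ : List ℕ) : stack γ = some γ.head? :: below γ := by
  cases γ <;> simp [stack, below]

theorem stack_append (u γ : List ℕ) : stack (u ++ γ.tail) = lift u γ.head? ++ below γ := by
  cases γ <;> simp [stack, below, lift]

/-- The rules of the simulation of runs, which weigh the deleted letters if `lw` is true. -/
def runRules (lw : Bool) (m : Mach) : List (PushRule SysState SysSym × Bool) :=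
  m.rules.flatMap fun r => m.letters.sublists'.filterMap fun A =>
    (m.scan r.1.1 r.1.2.1 A).bind fun p => r.2.map fun o =>
      (((runSt r.1.1 A, some r.1.2.2), some (runSt o.1 p.2, lift o.2 r.1.2.2)), p.1 && lw)

/-- The rules for accepting moves: they halt if `fin` is true and no further letter may occur, and
loop otherwise. -/
def acceptRules (fin : Bool) (m : Mach) : List (PushRule SysState SysSym × Bool) :=
  m.rules.flatMap fun r => m.letters.sublists'.filterMap fun A =>
    if r.2 = none then
      (m.scan r.1.1 r.1.2.1 A).map fun p =>
        (((runSt r.1.1 A, some r.1.2.2),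
          if fin = true ∧ p.2 = [] then none else some (loopSt, [none])), false)
    else none

/-- The rules for halting with an arbitrary weight. -/
def loopRules : List (PushRule SysState SysSym × Bool) :=
  [(((loopSt, none), some (loopSt, [none])), true), (((loopSt, none), none), false)]

/-- The rules that simulate runs in which nothing is deleted, of which each step has weight one. -/
def divRules (m : Mach) : List (PushRule SysState SysSym × Bool) :=
  m.rules.flatMap fun r =>
    if r.1.2.1 = none ∨ r.1.2.1 = some none then
      (((divSt r.1.1, some r.1.2.2), none), true) ::
        ((r.2.map fun o => (((divSt r.1.1, some r.1.2.2),
          some (divSt o.1, lift o.2 r.1.2.2)), true)).toList ++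
        m.letters.sublists'.map fun A =>
          (((runSt r.1.1 A, some r.1.2.2), some (divSt r.1.1, [some r.1.2.2, none])), false))
    else []

/-- The states that occur in runs. -/
def states (m : Mach) : List ℕ := m.init :: m.rules.filterMap fun r => r.2.map Prod.fst

/-- The top symbols that occur in runs. -/
def tops (m : Mach) : List (Option ℕ) :=
  none :: m.rules.flatMap fun r => ((r.2.map Prod.snd).getD []).map some

/-- What may be scanned other than nothing. -/
def scans (m : Mach) : List (Option (Option InSym)) :=
  some none :: m.letters.map fun a => some (some a)

/-- The rules for configurations without a successor. -/
def stuckRules (m : Mach) : List (PushRule SysState SysSym × Bool) :=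
  m.states.flatMap fun q => m.tops.flatMap fun z => m.scans.flatMap fun s =>
    m.letters.sublists'.filterMap fun A =>
      if m.rules.lookup (q, none, z) = none ∧ m.rules.lookup (q, s, z) = none then
        (m.scan q s A).map fun _ => (((runSt q A, some z), some (loopSt, [none])), false)
      else none

/-- A system with halting runs of unbounded weights if and only if a word is accepted
(`fin = false`), or infinitely many words are accepted (`fin = true`). -/
def acceptSystem (fin : Bool) (m : Mach) : List (PushRule SysState SysSym × Bool) :=
  runRules fin m ++ acceptRules fin m ++ loopRules

/-- A system with halting runs of unbounded weights if and only if the automaton has an infinite run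
or a run that gets stuck. -/
def rejectSystem (m : Mach) : List (PushRule SysState SysSym × Bool) :=
  runRules false m ++ divRules m ++ stuckRules m ++ loopRules

variable {m : Mach}

theorem mem_runRules {lw : Bool} {x : PushRule SysState SysSym × Bool} :
    x ∈ runRules lw m ↔ ∃ q s z q' u A l A', ((q, s, z), some (q', u)) ∈ m.rules ∧
      A.Sublist m.letters ∧ m.scan q s A = some (l, A') ∧
      x = (((runSt q A, some z), some (runSt q' A', lift u z)), l && lw) := by
  simp only [runRules, List.mem_flatMap, List.mem_filterMap, Option.bind_eq_some_iff,
    Option.map_eq_some_iff, List.mem_sublists', Prod.exists]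
  constructor
  · rintro ⟨q, s, z, o, hr, A, hA, l, A', hs, q', u, rfl, rfl⟩
    exact ⟨q, s, z, q', u, A, l, A', hr, hA, hs, rfl⟩
  · rintro ⟨q, s, z, q', u, A, l, A', hr, hA, hs, rfl⟩
    exact ⟨q, s, z, _, hr, A, hA, l, A', hs, q', u, rfl, rfl⟩

theorem mem_acceptRules {fin : Bool} {x : PushRule SysState SysSym × Bool} :
    x ∈ acceptRules fin m ↔ ∃ q s z A l A', ((q, s, z), none) ∈ m.rules ∧
      A.Sublist m.letters ∧ m.scan q s A = some (l, A') ∧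
      x = (((runSt q A, some z),
        if fin = true ∧ A' = [] then none else some (loopSt, [none])), false) := by
  simp only [acceptRules, List.mem_flatMap, List.mem_filterMap, Option.ite_none_right_eq_some,
    Option.map_eq_some_iff, List.mem_sublists', Prod.exists]
  constructor
  · rintro ⟨q, s, z, o, hr, A, hA, rfl, l, A', hs, rfl⟩
    exact ⟨q, s, z, A, l, A', hr, hA, hs, rfl⟩
  · rintro ⟨q, s, z, A, l, A', hr, hA, hs, rfl⟩
    exact ⟨q, s, z, _, hr, A, hA, rfl, l, A', hs, rfl⟩

theorem mem_divRules {x : PushRule SysState SysSym × Bool} :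
    x ∈ divRules m ↔ ∃ q s z o, ((q, s, z), o) ∈ m.rules ∧ (s = none ∨ s = some none) ∧
      (x = (((divSt q, some z), none), true) ∨
      (∃ q' u, o = some (q', u) ∧ x = (((divSt q, some z), some (divSt q', lift u z)), true)) ∨
      ∃ A, A.Sublist m.letters ∧
        x = (((runSt q A, some z), some (divSt q, [some z, none])), false)) := by
  simp only [divRules, List.mem_flatMap, List.mem_ite_nil_right, List.mem_cons, List.mem_append,
    List.mem_map, Option.mem_toList, Option.map_eq_some_iff, List.mem_sublists', Prod.exists,
    eq_comm (b := x)]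

theorem mem_stuckRules {x : PushRule SysState SysSym × Bool} :
    x ∈ stuckRules m ↔ ∃ q ∈ m.states, ∃ z ∈ m.tops, ∃ s ∈ m.scans, ∃ A, A.Sublist m.letters ∧
      (∀ o, ((q, none, z), o) ∉ m.rules) ∧ (∀ o, ((q, s, z), o) ∉ m.rules) ∧
      m.scan q s A ≠ none ∧ x = (((runSt q A, some z), some (loopSt, [none])), false) := by
  have hl : ∀ k, m.rules.lookup k = none ↔ ∀ o, (k, o) ∉ m.rules := by
    intro k
    rw [List.lookup_eq_none_iff]
    constructor
    · intro h o ho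
      simpa using h _ ho
    · rintro h ⟨k', o⟩ hk
      simp only [bne_iff_ne]
      rintro rfl
      exact h o hk
  simp only [stuckRules, List.mem_flatMap, List.mem_filterMap, Option.ite_none_right_eq_some,
    Option.map_eq_some_iff, List.mem_sublists', hl, Option.ne_none_iff_exists', exists_and_right,
    and_assoc, eq_comm (b := x)]

theorem halts_loopSt {B : List (PushRule SysState SysSym × Bool)} (hB : loopRules ⊆ B) (k : ℕ) :
    Halts B loopSt [none] k := by
  induction k with
  | zero => exact .halt (b := false) (hB (by simp [loopRules]))
  | succ k ih =>
    rw [add_comm]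
    exact .step (b := true) (u := [none]) (s' := loopSt) (hB (by simp [loopRules])) ih

/-- `ORun` is simulated rule by rule; with `lw = true` its deletions become weight, with `lw =
false` it is free of charge. -/
theorem ORun.halts {B : List (PushRule SysState SysSym × Bool)} {lw : Bool}
    (hB : runRules lw m ⊆ B) {q A γ q' A' γ' n} (h : ORun m q A γ q' A' γ' n)
    (hA : A.Sublist m.letters) {k : ℕ} (hk : Halts B (runSt q' A') (stack γ') k) :
    Halts B (runSt q A) (stack γ) ((if lw = true then n else 0) + k) := by
  induction h with
  | refl => simpa using hk
  | @step q s A γ q' u l A' q'' A'' γ'' n hδ hs hr ih =>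
    have h1 := ih ((scans_of_scan hs).1.trans hA) hk
    rw [stack_append] at h1
    have h2 := Halts.step (hB (mem_runRules.2 ⟨_, _, _, _, _, _, _, _, hδ, hA, hs, rfl⟩)) h1
    rw [stack_eq]
    convert h2 using 1
    cases lw <;> simp [add_assoc]

/-- Halting runs of the system for acceptance. -/
theorem exists_oRun_of_halts_acceptSystem {fin : Bool} {q A γ n}
    (h : Halts (acceptSystem fin m) (runSt q A) (stack γ) n) :
    ∃ q' A' γ' n' A'', ORun m q A γ q' A' γ' n' ∧ Ends m q' A' γ' A'' ∧
      (fin = true → A'' = [] → n = n') := by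
  generalize hs : runSt q A = s at h
  generalize hw : stack γ = w at h
  induction h generalizing q A γ with
  | @halt s z w b h =>
    subst hs
    rw [stack_eq, List.cons.injEq] at hw
    obtain ⟨rfl, -⟩ := hw
    simp only [acceptSystem, List.mem_append, mem_runRules, mem_acceptRules] at h
    rcases h with (⟨_, _, _, _, _, _, _, _, _, _, _, h⟩ | ⟨_, _, _, _, _, _, h1, _, h2, h⟩) | h
    · simp at h
    · simp only [runSt, Prod.mk.injEq, Option.some.injEq, true_and] at h
      obtain ⟨⟨⟨⟨rfl, rfl⟩, rfl⟩, h⟩, rfl⟩ := h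
      exact ⟨_, _, _, 0, _, .refl _ _ _, ⟨_, _, h1, h2⟩, fun _ _ => rfl⟩
    · simp [loopRules, runSt, loopSt] at h
  | @step s z w s' u b n h hr ih =>
    subst hs
    rw [stack_eq, List.cons.injEq] at hw
    obtain ⟨rfl, rfl⟩ := hw
    simp only [acceptSystem, List.mem_append, mem_runRules, mem_acceptRules] at h
    rcases h with (⟨_, _, _, _, _, _, l, A', h1, _, h2, h⟩ | ⟨_, _, _, _, _, A', h1, _, h2, h⟩) | h
    · simp only [runSt, Prod.mk.injEq, Option.some.injEq, true_and] at h
      obtain ⟨⟨⟨⟨rfl, rfl⟩, rfl⟩, rfl, rfl⟩, rfl⟩ := h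
      obtain ⟨q', A', γ', n', A'', h3, h4, h5⟩ := ih rfl (stack_append _ _)
      refine ⟨q', A', γ', _, A'', .step h1 h2 h3, h4, fun hf hA => ?_⟩
      rw [h5 hf hA, hf, Bool.and_true]
    · simp only [runSt, Prod.mk.injEq, Option.some.injEq, true_and] at h
      obtain ⟨⟨⟨⟨rfl, rfl⟩, rfl⟩, h⟩, rfl⟩ := h
      refine ⟨_, _, _, 0, _, .refl _ _ _, ⟨_, _, h1, h2⟩, fun hf hA => ?_⟩
      simp [hf, hA] at h
    · simp [loopRules, runSt, loopSt] at h

/-- Reaching `loopSt` once suffices: from there the loop supplies every weight. Plain reachability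
thereby becomes a question about infinitely many weights. -/
theorem ORun.infinite_halts {B : List (PushRule SysState SysSym × Bool)} {lw : Bool}
    (hB : runRules lw m ⊆ B) (hB' : loopRules ⊆ B) {q A γ n}
    (h : ORun m m.init m.letters [] q A γ n)
    (hl : (((runSt q A, some γ.head?), some (loopSt, [none])), false) ∈ B) :
    {n | Halts B (runSt m.init m.letters) [some none] n}.Infinite := by
  refine Set.infinite_of_forall_exists_gt fun N => ⟨_, h.halts hB (.refl _) (k := N + 1) ?_,
    by omega⟩
  rw [stack_eq, ← zero_add (N + 1)]
  exact .step (b := false) hl ((halts_loopSt hB' _).append _)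

theorem runRules_subset_acceptSystem {fin : Bool} : runRules fin m ⊆ acceptSystem fin m :=
  fun _ hx => List.mem_append_left _ (List.mem_append_left _ hx)

theorem acceptRules_subset_acceptSystem {fin : Bool} : acceptRules fin m ⊆ acceptSystem fin m :=
  fun _ hx => List.mem_append_left _ (List.mem_append_right _ hx)

theorem loopRules_subset_acceptSystem {fin : Bool} : loopRules ⊆ acceptSystem fin m :=
  fun _ hx => List.mem_append_right _ hx

theorem ORun.halts_acceptSystem {fin : Bool} {q A γ n A'}
    (h : ORun m m.init m.letters [] q A γ n) (he : Ends m q A γ A')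
    (hA : ¬ (fin = true ∧ A' = [])) :
    {n | Halts (acceptSystem fin m) (runSt m.init m.letters) [some none] n}.Infinite := by
  obtain ⟨s, l, h1, h2⟩ := he
  refine h.infinite_halts runRules_subset_acceptSystem loopRules_subset_acceptSystem
    (acceptRules_subset_acceptSystem (mem_acceptRules.2 ⟨_, _, _, _, _, _, h1, h.sublist, h2, ?_⟩))
  rw [if_neg hA]

/-- With `fin = false` every accepting move enters the loop and nothing halts without it, so a
single halting run already witnesses an accepted word. -/
theorem infinite_halts_acceptSystem_false :
    {n | Halts (acceptSystem false m) (runSt m.init m.letters) [some none] n}.Infinite ↔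
      ∃ w ⊆ m.letters, m.Accepts w := by
  constructor
  · intro h
    obtain ⟨n, hn⟩ := h.nonempty
    obtain ⟨q, A, γ, n', A', h1, h2, -⟩ := exists_oRun_of_halts_acceptSystem (γ := []) hn
    obtain ⟨w, hw, h3, -⟩ := h1.accepts h2 (List.nil_subset _)
    exact ⟨w, hw, h3⟩
  · rintro ⟨w, hw, h⟩
    obtain ⟨q, A, γ, n, x, A', h1, h2, -⟩ := h.exists_oRun hw
    exact h1.halts_acceptSystem h2 (by simp)

theorem infinite_halts_acceptSystem_true :
    {n | Halts (acceptSystem true m) (runSt m.init m.letters) [some none] n}.Infinite ↔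
      ∀ N, ∃ w ⊆ m.letters, m.Accepts w ∧ N ≤ w.length := by
  constructor
  · intro h N
    obtain ⟨n, hn, hN⟩ := h.exists_gt N
    obtain ⟨q, A, γ, n', A', h1, h2, h3⟩ := exists_oRun_of_halts_acceptSystem (γ := []) hn
    cases A' with
    | nil =>
      obtain ⟨w, hw, h4, h5⟩ := h1.accepts h2 (List.nil_subset _)
      have := h3 rfl rfl
      exact ⟨w, hw, h4, by omega⟩
    | cons a A' =>
      -- A letter that is still allowed can be repeated in the part of the input that is never
      -- deleted.
      have hy : List.replicate N a ⊆ a :: A' := fun b hb => by simp [List.eq_of_mem_replicate hb]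
      obtain ⟨w, hw, h4, h5⟩ := h1.accepts h2 hy
      rw [List.length_replicate] at h5
      exact ⟨w, hw, h4, by omega⟩
  · intro h
    -- If an accepting move leaves a letter allowed, the loop gives all weights. Otherwise every
    -- accepted word is matched by an ordered run in which all its letters are counted, and long
    -- words give large weights.
    by_cases hex : ∃ q A γ n A', ORun m m.init m.letters [] q A γ n ∧ Ends m q A γ A' ∧ A' ≠ []
    · obtain ⟨q, A, γ, n, A', h1, h2, h3⟩ := hex
      exact h1.halts_acceptSystem h2 (by simp [h3])
    · push Not at hex
      refine Set.infinite_of_forall_exists_gt fun N => ?_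
      obtain ⟨w, hw, h1, h2⟩ := h (N + 1)
      obtain ⟨q, A, γ, n, x, A', h3, h4, h5, -, h6⟩ := h1.exists_oRun hw
      obtain rfl := hex _ _ _ _ _ h3 h4
      obtain rfl := h6 rfl
      rw [List.length_nil] at h5
      obtain ⟨s, l, h7, h8⟩ := h4
      refine ⟨_, h3.halts (lw := true) (k := 0) runRules_subset_acceptSystem (.refl _) ?_, ?_⟩
      · rw [stack_eq]
        exact .halt (b := false) (acceptRules_subset_acceptSystem
          (mem_acceptRules.2 ⟨_, _, _, _, _, _, h7, h3.sublist, h8, by simp⟩))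
      · simp
        omega

end Mach

/-! ### Universality of deterministic automata. -/

/-- Runs of a relation with a given number of steps. -/
inductive StepsN {α : Type*} (r : α → α → Prop) : ℕ → α → α → Prop
  | refl (a) : StepsN r 0 a a
  | head {n a b c} (h : r a b) (hr : StepsN r n b c) : StepsN r (n + 1) a c

theorem exists_stepsN {α : Type*} {r : α → α → Prop} {a b : α} (h : Relation.ReflTransGen r a b) :
    ∃ n, StepsN r n a b := by
  induction h using Relation.ReflTransGen.head_induction_on with
  | refl => exact ⟨0, .refl _⟩
  | head h _ ih => exact ih.imp' (· + 1) fun _ => .head h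

/-- The runs of a deterministic relation are prefixes of the one that ends. -/
theorem StepsN.exists_add {α : Type*} {r : α → α → Prop} (hr : ∀ a b c, r a b → r a c → b = c)
    {n N : ℕ} {a b c : α} (h : StepsN r n a b) (h' : StepsN r N a c) (hc : ∀ d, ¬ r c d) :
    ∃ k, StepsN r k b c ∧ n + k = N := by
  induction h generalizing N with
  | refl => exact ⟨N, h', zero_add _⟩
  | head h _ ih =>
    cases h' with
    | refl => exact absurd h (hc _)
    | head h1 h2 =>
      obtain rfl := hr _ _ _ h h1
      obtain ⟨k, hk, rfl⟩ := ih h2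
      exact ⟨k, hk, by omega⟩

theorem eq_of_append_cons_eq {S : Type*} {p : S → Prop} {x x' y y' : List S} {a a' : S}
    (h : x ++ a :: y = x' ++ a' :: y') (hx : ∀ b ∈ x, p b) (ha : ¬ p a) (hx' : ∀ b ∈ x', p b)
    (ha' : ¬ p a') : x = x' ∧ a = a' ∧ y = y' := by
  induction x generalizing x' with
  | nil =>
    cases x' with
    | nil => simpa using h
    | cons b x' =>
      simp only [List.nil_append, List.cons_append, List.cons.injEq] at h
      exact absurd (hx' b (by simp)) (h.1 ▸ ha)
  | cons b x ih =>
    cases x' with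
    | nil =>
      simp only [List.nil_append, List.cons_append, List.cons.injEq] at h
      exact absurd (hx b (by simp)) (h.1 ▸ ha')
    | cons b' x' =>
      simp only [List.cons_append, List.cons.injEq] at h
      have := ih h.2 (fun c hc => hx c (by simp [hc])) fun c hc => hx' c (by simp [hc])
      simp [this, h.1]

/-- The first letter that is not translucent is determined by the word. Only the choice between a
`λ`-move and a reading move is free, which the last hypothesis rules out. -/
theorem Scans.unique {Q S : Type*} {tr : Q → S → Prop} {q : Q} {s t : Option (Option S)}
    {w w' w'' : List S} (h : Scans tr q s w w') (h' : Scans tr q t w w'')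
    (hst : s = none ↔ t = none) : s = t ∧ w' = w'' := by
  cases h with
  | lambda =>
    obtain rfl := hst.1 rfl
    cases h'
    exact ⟨rfl, rfl⟩
  | endmarker hw =>
    cases h' with
    | lambda => simp at hst
    | endmarker => exact ⟨rfl, rfl⟩
    | letter hx ha => exact absurd (hw _ (by simp)) ha
  | @letter x a y hx ha =>
    generalize hv : x ++ a :: y = v at h'
    cases h' with
    | lambda => simp at hst
    | endmarker hw => exact absurd (hw a (by simp [← hv])) ha
    | letter hx' ha' =>
      obtain ⟨rfl, rfl, rfl⟩ := eq_of_append_cons_eq hv hx ha hx' ha'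
      exact ⟨rfl, rfl⟩

namespace Mach

/-- The moves are single-valued, and where a `λ`-move is defined, no other move is. -/
def Deterministic (m : Mach) : Prop :=
  (∀ k o o', (k, o) ∈ m.rules → (k, o') ∈ m.rules → o = o') ∧
  ∀ q z s o o', ((q, none, z), o) ∈ m.rules → ((q, s, z), o') ∈ m.rules → s = none

variable {m : Mach}

theorem Deterministic.step (hm : m.Deterministic) (C D D' : Config ℕ InSym ℕ) (h : m.Step C D)
    (h' : m.Step C D') : D = D' := by
  cases h with
  | @mk q s w w' γ o hs hδ =>
    generalize hC : Config.run q w γ = C at h'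
    cases h' with
    | @mk q t w w'' γ o' hs' hδ' =>
      cases hC
      obtain ⟨rfl, rfl⟩ := hs.unique hs' ⟨by rintro rfl; exact hm.2 _ _ _ _ _ hδ hδ',
        by rintro rfl; exact hm.2 _ _ _ _ _ hδ' hδ⟩
      rw [hm.1 _ _ _ hδ hδ']

theorem not_step_accept (D : Config ℕ InSym ℕ) : ¬ m.Step .accept D := by
  intro h
  cases h

/-- With some word over the letters `A` left, there is no next step. -/
def Stuck (m : Mach) (q : ℕ) (A : List InSym) (z : Option ℕ) : Prop :=
  (∀ o, ((q, none, z), o) ∉ m.rules) ∧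
    ∃ s ∈ m.scans, (∀ o, ((q, s, z), o) ∉ m.rules) ∧ m.scan q s A ≠ none

/-- No rule halts in the simulation phase, so a halting run leaves it through a stuck configuration
or by switching to the deletion-free phase. All steps so far, the switch included, weigh zero, so
the whole weight arises after the switch. -/
theorem exists_oRun_of_halts_rejectSystem {q A γ n}
    (h : Halts (rejectSystem m) (runSt q A) (stack γ) n) :
    ∃ q' A' γ' n', ORun m q A γ q' A' γ' n' ∧ (Stuck m q' A' γ'.head? ∨
      ∃ r ∈ m.rules, r.1.1 = q' ∧ r.1.2.2 = γ'.head? ∧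
        Halts (rejectSystem m) (divSt q') (some γ'.head? :: none :: below γ') n) := by
  generalize hs : runSt q A = s at h
  generalize hw : stack γ = w at h
  induction h generalizing q A γ with
  | @halt s z w b h =>
    subst hs
    simp only [rejectSystem, List.mem_append, mem_runRules, mem_divRules, mem_stuckRules] at h
    rcases h with ((⟨_, _, _, _, _, _, _, _, _, _, _, h⟩ | ⟨_, _, _, _, _, _, h⟩) |
      ⟨_, _, _, _, _, _, _, _, _, _, _, h⟩) | h
    · simp at h
    · simp [runSt, divSt] at h
    · simp at h
    · simp [loopRules, runSt, loopSt] at h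
  | @step s z w s' u b n h hr ih =>
    subst hs
    rw [stack_eq, List.cons.injEq] at hw
    obtain ⟨rfl, rfl⟩ := hw
    simp only [rejectSystem, List.mem_append, mem_runRules, mem_divRules, mem_stuckRules] at h
    rcases h with ((⟨_, s, _, _, _, _, l, A', h1, _, h2, h⟩ | ⟨_, s, _, o, h1, _, h⟩) |
      ⟨_, _, _, _, s, hs, _, _, h1, h2, h3, h⟩) | h
    · simp only [runSt, Prod.mk.injEq, Option.some.injEq, true_and] at h
      obtain ⟨⟨⟨⟨rfl, rfl⟩, rfl⟩, rfl, rfl⟩, rfl⟩ := h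
      obtain ⟨q', A', γ', n', h3, h4⟩ := ih rfl (stack_append _ _)
      refine ⟨q', A', γ', _, .step h1 h2 h3, ?_⟩
      simpa using h4
    · rcases h with h | ⟨_, _, _, h⟩ | ⟨_, _, h⟩
      · simp at h
      · simp [runSt, divSt] at h
      · simp only [runSt, Prod.mk.injEq, Option.some.injEq, true_and] at h
        obtain ⟨⟨⟨⟨rfl, rfl⟩, rfl⟩, rfl, rfl⟩, rfl⟩ := h
        refine ⟨_, _, _, 0, .refl _ _ _, .inr ⟨_, h1, rfl, rfl, ?_⟩⟩
        simpa using hr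
    · simp only [runSt, Prod.mk.injEq, Option.some.injEq, true_and] at h
      obtain ⟨⟨⟨⟨rfl, rfl⟩, rfl⟩, -⟩, -⟩ := h
      exact ⟨_, _, _, 0, .refl _ _ _, .inl ⟨h1, s, hs, h2, h3⟩⟩
    · simp [loopRules, runSt, loopSt] at h

/-- The separator `none` cannot be on top in a rule of this phase, so the run only sees `t` and can
be repeated above any `rest`. With empty input the endmarker is scanned in every state. Halting
itself weighs one because it stands for a last possible step. -/
theorem exists_stepsN_of_halts_rejectSystem {q t t' γ rest n}
    (h : Halts (rejectSystem m) (divSt q) (t ++ none :: t') n) (hγ : stack γ = t ++ rest) :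
    ∃ D, StepsN m.Step n (.run q [] γ) D := by
  generalize hs : divSt q = s at h
  generalize hw : t ++ none :: t' = w at h
  have scans_nil : ∀ {s q}, s = none ∨ s = some none →
      Scans (fun q a => (q, a) ∈ m.transl) q s [] [] := by
    rintro s q (rfl | rfl)
    · exact .lambda _
    · exact .endmarker (by simp)
  induction h generalizing q t γ with
  | @halt s z w b h =>
    subst hs
    simp only [rejectSystem, List.mem_append, mem_runRules, mem_divRules, mem_stuckRules] at h
    rcases h with ((⟨_, _, _, _, _, _, _, _, _, _, _, h⟩ | ⟨_, s, _, o, h1, h2, h⟩) |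
      ⟨_, _, _, _, _, _, _, _, _, _, _, h⟩) | h
    · simp at h
    · rcases h with h | ⟨_, _, _, h⟩ | ⟨_, _, h⟩
      · simp only [divSt, Prod.mk.injEq, and_true, true_and] at h
        obtain ⟨⟨rfl, rfl⟩, rfl⟩ := h
        cases t with
        | nil => simp at hw
        | cons y t =>
          rw [stack_eq] at hγ
          simp only [List.cons_append, List.cons.injEq] at hγ hw
          obtain ⟨rfl, -⟩ := hw
          rw [Option.some.injEq] at hγ
          obtain ⟨rfl, -⟩ := hγ
          exact ⟨_, .head (TStep.mk (δ := fun q s z o => ((q, s, z), o) ∈ m.rules)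
            (scans_nil h2) h1) (.refl _)⟩
      · simp at h
      · simp at h
    · simp at h
    · simp [loopRules, divSt, loopSt] at h
  | @step s z w s' u b n h hr ih =>
    subst hs
    simp only [rejectSystem, List.mem_append, mem_runRules, mem_divRules, mem_stuckRules] at h
    rcases h with ((⟨_, _, _, _, _, _, _, _, _, _, _, h⟩ | ⟨_, s, _, o, h1, h2, h⟩) |
      ⟨_, _, _, _, _, _, _, _, _, _, _, h⟩) | h
    · simp [runSt, divSt] at h
    · rcases h with h | ⟨_, _, rfl, h⟩ | ⟨_, _, h⟩
      · simp at h
      · simp only [divSt, Prod.mk.injEq, and_true, true_and, Option.some.injEq] at h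
        obtain ⟨⟨⟨rfl, rfl⟩, rfl, rfl⟩, rfl⟩ := h
        cases t with
        | nil => simp at hw
        | cons y t =>
          rw [stack_eq] at hγ
          simp only [List.cons_append, List.cons.injEq] at hγ hw
          obtain ⟨rfl, rfl⟩ := hw
          rw [Option.some.injEq] at hγ
          obtain ⟨rfl, hγ⟩ := hγ
          obtain ⟨D, hD⟩ := ih (γ := _ ++ γ.tail)
            (by rw [stack_append, hγ, List.append_assoc]) rfl (List.append_assoc _ _ _)
          rw [Bool.toNat_true, add_comm]
          exact ⟨D, .head (step_run (scans_nil h2) h1) hD⟩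
      · simp [runSt, divSt] at h
    · simp [runSt, divSt] at h
    · simp [loopRules, divSt, loopSt] at h

/-- For a missing letter rule the word is that letter; for the endmarker it is empty. Scanning is
unique, so no other rule can apply. -/
theorem Stuck.exists_config {q A z} (h : Stuck m q A z) :
    ∃ x ⊆ A, ∀ γ : List ℕ, γ.head? = z → ∀ D, ¬ m.Step (.run q x γ) D := by
  obtain ⟨h1, s, hs, h2, h3⟩ := h
  obtain ⟨⟨l, A'⟩, h3⟩ := Option.ne_none_iff_exists'.1 h3
  obtain ⟨v, hv, -, h4⟩ := (scans_of_scan h3).2 [] (List.nil_subset _)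
  rw [List.append_nil] at h4
  refine ⟨v, hv, ?_⟩
  rintro γ rfl D h
  generalize hC : Config.run q v γ = C at h
  cases h with
  | @mk q t w w' γ o hs' hδ =>
    cases hC
    have ht : t ≠ none := by
      rintro rfl
      exact h1 _ hδ
    have hs : s ≠ none := by
      rintro rfl
      simp [scans] at hs
    obtain ⟨rfl, -⟩ := h4.unique hs' (by simp [ht, hs])
    exact h2 _ hδ

/-- If all words were accepted, no run would get stuck and each deletion-free phase would be bounded
by a constant depending only on state and top symbol, of which finitely many pairs occur. -/
theorem exists_not_accepts_of_infinite (hm : m.Deterministic)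
    (h : {n | Halts (rejectSystem m) (runSt m.init m.letters) [some none] n}.Infinite) :
    ∃ w ⊆ m.letters, ¬ m.Accepts w := by
  by_contra! hall
  have key : ∀ r : (ℕ × Option (Option InSym) × Option ℕ) × Option (ℕ × List ℕ), ∃ N,
      ∀ A γ n' n, ORun m m.init m.letters [] r.1.1 A γ n' → r.1.2.2 = γ.head? →
        Halts (rejectSystem m) (divSt r.1.1) (some γ.head? :: none :: below γ) n → n ≤ N := by
    intro r
    -- One reachable configuration with this state and top symbol serves for all of them. With no
    -- input left it accepts after `k` steps, and by determinism no run from it is longer. The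
    -- deletion-free phases of all other such configurations can be repeated on its pushdown `γ`.
    by_cases hex : ∃ A γ n', ORun m m.init m.letters [] r.1.1 A γ n' ∧ r.1.2.2 = γ.head?
    · obtain ⟨A, γ, n', h1, hz⟩ := hex
      obtain ⟨v, hv, -, h2⟩ := h1.exists_word (List.nil_subset _)
      rw [List.append_nil] at h2
      obtain ⟨i, hi⟩ := exists_stepsN h2
      obtain ⟨j, hj⟩ := exists_stepsN (hall v hv)
      obtain ⟨k, hk, -⟩ := hi.exists_add hm.step hj not_step_accept
      refine ⟨k, fun A' γ' n'' n _ hz' h3 => ?_⟩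
      obtain ⟨D, hD⟩ := exists_stepsN_of_halts_rejectSystem (t := [some γ'.head?]) h3
        (γ := γ) (rest := below γ) (by rw [stack_eq, ← hz, ← hz']; rfl)
      obtain ⟨k', -, h4⟩ := hD.exists_add hm.step hk not_step_accept
      omega
    · push Not at hex
      exact ⟨0, fun A γ n' n h1 hz => absurd hz (hex A γ n' h1)⟩
  choose N hN using key
  refine h (((m.rules.finite_toSet.image N).biUnion fun k _ => Set.finite_Iic k).subset ?_)
  intro n hn
  obtain ⟨q, A, γ, n', h1, h2⟩ := exists_oRun_of_halts_rejectSystem (γ := []) hn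
  rcases h2 with h2 | ⟨r, hr, rfl, hz, h2⟩
  · exfalso
    obtain ⟨x, hx, h3⟩ := h2.exists_config
    obtain ⟨v, hv, -, h4⟩ := h1.exists_word hx
    obtain ⟨i, hi⟩ := exists_stepsN h4
    obtain ⟨j, hj⟩ := exists_stepsN
      (hall (v ++ x) (List.append_subset.2 ⟨hv, List.Subset.trans hx h1.sublist.subset⟩))
    obtain ⟨k, hk, -⟩ := hi.exists_add hm.step hj not_step_accept
    cases hk with
    | head h _ => exact h3 _ rfl _ h
  · simp only [Set.mem_iUnion, Set.mem_Iic]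
    exact ⟨N r, ⟨r, hr, rfl⟩, hN r A γ n' n h1 hz h2⟩

/-- A step without deletion, with the word `x` left, on pushdown contents of the systems. -/
inductive ZStep (m : Mach) (x : List InSym) : ℕ × List SysSym → ℕ × List SysSym → Prop
  | mk {q s z q' u t} (hs : s = none ∨ s = some none)
      (hx : Scans (fun q a => (q, a) ∈ m.transl) q s x x)
      (hδ : ((q, s, z), some (q', u)) ∈ m.rules) : ZStep m x (q, some z :: t) (q', lift u z ++ t)

/-- Either the run stays above `t` throughout and never inspects it, or there is a moment at which
exactly `t` is left. -/
theorem stepsN_zStep_append {x q v t n D} (h : StepsN (ZStep m x) n (q, v ++ t) D) :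
    (∃ v', StepsN (ZStep m x) n (q, v) (D.1, v')) ∨
      ∃ k l q', StepsN (ZStep m x) k (q, v) (q', []) ∧ StepsN (ZStep m x) l (q', t) D ∧
        n = k + l := by
  generalize hC : (q, v ++ t) = C at h
  induction h generalizing q v with
  | refl =>
    subst hC
    exact .inl ⟨v, .refl _⟩
  | @head n a b c h hr ih =>
    subst hC
    cases v with
    | nil => exact .inr ⟨0, n + 1, q, .refl _, .head h hr, by omega⟩
    | cons y v =>
      cases h with
      | @mk _ s z q' u _ hs hx hδ =>
        have h1 : ZStep m x (q, some z :: v) (q', lift u z ++ v) := .mk hs hx hδ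
        rcases ih (q := q') (v := lift u z ++ v) (by simp) with ⟨v', h2⟩ | ⟨k, l, q'', h2, h3, rfl⟩
        · exact .inl ⟨v', .head h1 h2⟩
        · exact .inr ⟨k + 1, l, q'', .head h1 h2, h3, by omega⟩

/-- The remaining word `x` is forgotten, which only permits more moves. The last of the `n + 1`
steps is represented by halting, which explains why at least one step is required. -/
theorem halts_rejectSystem_of_stepsN {x q v n D} (h : StepsN (ZStep m x) (n + 1) (q, v) D)
    (t : List SysSym) : Halts (rejectSystem m) (divSt q) (v ++ t) (n + 1) := by
  have hB : divRules m ⊆ rejectSystem m := fun _ hx => by simp [rejectSystem, hx]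
  induction n generalizing q v with
  | zero =>
    cases h with
    | head h _ =>
      cases h with
      | mk hs hx hδ =>
        exact .halt (b := true) (hB (mem_divRules.2 ⟨_, _, _, _, hδ, hs, .inl rfl⟩))
  | succ n ih =>
    cases h with
    | head h h' =>
      cases h with
      | mk hs hx hδ =>
        rw [add_comm]
        refine .step (b := true) (hB (mem_divRules.2
          ⟨_, _, _, _, hδ, hs, .inr (.inl ⟨_, _, rfl, rfl⟩)⟩)) ?_
        simpa using ih h'

/-- Runs without deletions are bounded if those on a single symbol are. -/
theorem stepsN_zStep_le {x : List InSym} {R : ℕ × List SysSym → Prop}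
    (hR : ∀ C D, R C → ZStep m x C D → R D) {M : ℕ}
    (hM : ∀ q z t n D, R (q, z :: t) → StepsN (ZStep m x) n (q, [z]) D → n ≤ M)
    {t : List SysSym} {q n D} (h : StepsN (ZStep m x) n (q, t) D) (hq : R (q, t)) :
    n ≤ M * t.length := by
  induction t generalizing q n with
  | nil =>
    cases h with
    | refl => simp
    | head h _ => cases h
  | cons z t ih =>
    rw [List.length_cons, mul_add, mul_one]
    rcases stepsN_zStep_append (v := [z]) h with ⟨v', h1⟩ | ⟨k, l, q', h1, h2, rfl⟩
    · have := hM _ _ _ _ _ hq h1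
      omega
    · have h3 := hM _ _ _ _ _ hq h1
      -- The bound `M` is only known under `R`. To use it for the next symbol, the invariant is
      -- carried along the run with the rest of the pushdown put back underneath.
      have h4 : R (q', t) := by
        have : ∀ {k v C}, StepsN (ZStep m x) k (q, v) C →
            ∀ w, R (q, v ++ w) → R (C.1, C.2 ++ w) := by
          intro k v C h
          generalize hC : (q, v) = A at h
          have : ∀ {k A C}, StepsN (ZStep m x) k A C → ∀ w, R (A.1, A.2 ++ w) →
              R (C.1, C.2 ++ w) := by
            intro k A C h w
            induction h with
            | refl => exact id
            | head h _ ih =>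
              refine fun hA => ih (hR _ _ hA ?_)
              cases h with
              | mk hs hx hδ => simpa using ZStep.mk hs hx hδ
          subst hC
          exact this h
        simpa using this h1 t hq
      have := ih h2 h4
      omega

/-- The rules for stuck configurations are listed only for `states` and `tops`; nothing else is
reachable. -/
theorem ORun.mem_states {q A γ n} (h : ORun m m.init m.letters [] q A γ n) :
    q ∈ m.states ∧ γ.head? ∈ m.tops := by
  have : ∀ {q A γ q' A' γ' n}, ORun m q A γ q' A' γ' n → q ∈ m.states →
      (∀ g ∈ γ, some g ∈ m.tops) → q' ∈ m.states ∧ ∀ g ∈ γ', some g ∈ m.tops := by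
    intro q A γ q' A' γ' n h
    induction h with
    | refl => exact fun h1 h2 => ⟨h1, h2⟩
    | @step q s A γ q' u l A' q'' A'' γ'' n hδ hs hr ih =>
      refine fun h1 h2 => ih ?_ fun g hg => ?_
      · exact List.mem_cons_of_mem _ (List.mem_filterMap.2 ⟨_, hδ, rfl⟩)
      · rcases List.mem_append.1 hg with hg | hg
        · exact List.mem_cons_of_mem _ (List.mem_flatMap.2 ⟨_, hδ, by simpa using hg⟩)
        · exact h2 g (List.mem_of_mem_tail hg)
  obtain ⟨h1, h2⟩ := this h (by simp [states]) (by simp)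
  refine ⟨h1, ?_⟩
  cases γ with
  | nil => simp [tops]
  | cons g γ => exact h2 g (by simp)

/-- A scan always finds a letter or the endmarker, so a configuration without moves lacks a rule for
a definite symbol. -/
theorem exists_scans (q : ℕ) (w : List InSym) :
    ∃ s w', s ≠ none ∧ Scans (fun q a => (q, a) ∈ m.transl) q s w w' := by
  induction w with
  | nil => exact ⟨some none, _, by simp, .endmarker (by simp)⟩
  | cons a w ih =>
    by_cases ha : (q, a) ∈ m.transl
    · obtain ⟨s, w', hs, h⟩ := ih
      cases h with
      | lambda => simp at hs
      | endmarker h => exact ⟨_, _, hs, .endmarker (by simpa [ha] using h)⟩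
      | @letter x b y hx hb => exact ⟨_, _, hs, .letter (x := a :: x) (by simpa [ha] using hx) hb⟩
    · exact ⟨some (some a), _, by simp, .letter (x := []) (by simp) ha⟩

/-- A bound on the weights excludes stuck configurations, which lead into the loop, and bounds the
deletion-free runs on a single symbol. So every run can be continued until it accepts and cannot go
on forever. This direction works without determinism. -/
theorem accepts_of_finite
    (h : {n | Halts (rejectSystem m) (runSt m.init m.letters) [some none] n}.Finite)
    {w : List InSym} (hw : w ⊆ m.letters) : m.Accepts w := by
  obtain ⟨M, hM⟩ := h.bddAbove
  have hrun : runRules false m ⊆ rejectSystem m := fun _ hx => by simp [rejectSystem, hx]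
  have hdiv : divRules m ⊆ rejectSystem m := fun _ hx => by simp [rejectSystem, hx]
  have hstuck : stuckRules m ⊆ rejectSystem m := fun _ hx => by simp [rejectSystem, hx]
  have hloop : loopRules ⊆ rejectSystem m := fun _ hx => by simp [rejectSystem, hx]
  let R (x : List InSym) : ℕ × List SysSym → Prop := fun C => ∃ γ A n, C.2 = stack γ ∧
    ORun m m.init m.letters [] C.1 A γ n ∧ x ⊆ A
  have hR : ∀ x C D, R x C → ZStep m x C D → R x D := by
    rintro x C D ⟨γ, A, n, h1, h2, h3⟩ h
    cases h with
    | @mk q s z q' u t hs hx hδ =>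
      rw [stack_eq, List.cons.injEq, Option.some.injEq] at h1
      obtain ⟨rfl, rfl⟩ := h1
      obtain ⟨l, A', h4, h5, -⟩ := scan_of_scans hx h3
      exact ⟨_, A', _, (stack_append _ _).symm, h2.snoc hδ h4, h5⟩
  have hle : ∀ x q z t n D, R x (q, z :: t) → StepsN (ZStep m x) n (q, [z]) D → n ≤ M := by
    rintro x q z t n D ⟨γ, A, k, h1, h2, h3⟩ h
    cases n with
    | zero => exact Nat.zero_le _
    | succ n =>
      have h4 := halts_rejectSystem_of_stepsN h (none :: below γ)
      cases h with
      | head h _ =>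
        cases h with
        | @mk _ s z _ _ _ hs hx hδ =>
          simp only [stack_eq, List.cons.injEq, Option.some.injEq] at h1
          obtain ⟨rfl, -⟩ := h1
          -- Reaching this configuration and switching phase weigh nothing, so the number of
          -- deletion-free steps is the weight of a halting run from the start, and `M` bounds it.
          have h5 : Halts (rejectSystem m) (runSt q A) (stack γ) (0 + (n + 1)) := by
            rw [stack_eq]
            refine .step (b := false) (hdiv (mem_divRules.2
              ⟨_, _, _, _, hδ, hs, .inr (.inr ⟨_, h2.sublist, rfl⟩)⟩)) ?_
            simpa using h4
          simpa using hM (h2.halts hrun (.refl _) h5)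
  -- Lexicographic induction: `L` is the length of the remaining input, `K` bounds the deletion-free
  -- runs from here. A deletion lowers `L` and allows a new `K`, obtained from the height of the
  -- pushdown; any other step lowers `K`.
  have main : ∀ L K q x γ A n, x.length = L → ORun m m.init m.letters [] q A γ n → x ⊆ A →
      (∀ n D, StepsN (ZStep m x) n (q, stack γ) D → n ≤ K) →
      Relation.ReflTransGen m.Step (.run q x γ) .accept := by
    intro L
    induction L using Nat.strong_induction_on with
    | _ L ihL =>
      intro K
      induction K using Nat.strong_induction_on with
      | _ K ihK =>
        intro q x γ A n hL h1 hx hK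
        obtain ⟨s, x', o, hs, hδ⟩ : ∃ s x' o, Scans (fun q a => (q, a) ∈ m.transl) q s x x' ∧
            ((q, s, γ.head?), o) ∈ m.rules := by
          by_contra! hno
          obtain ⟨s, x', hs, hs'⟩ := exists_scans (m := m) q x
          obtain ⟨l, A', h2, -⟩ := scan_of_scans hs' hx
          refine h1.infinite_halts hrun hloop (hstuck (mem_stuckRules.2 ⟨q, h1.mem_states.1,
            γ.head?, h1.mem_states.2, s, ?_, A, h1.sublist, fun o => hno _ _ o (.lambda _),
            fun o => hno _ _ o hs', by simp [h2], rfl⟩)) h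
          cases hs' with
          | lambda => simp at hs
          | endmarker => simp [scans]
          | letter _ _ =>
            exact List.mem_cons_of_mem _
              (List.mem_map_of_mem (h1.sublist.subset (hx (by simp))))
        cases o with
        | none => exact .single (step_accept hs hδ)
        | some p =>
          obtain ⟨q', u⟩ := p
          refine .head (step_run hs hδ) ?_
          obtain ⟨l, A', h2, h3, h4⟩ := scan_of_scans hs hx
          have h5 := h1.snoc hδ h2
          by_cases hs' : s = none ∨ s = some none
          · obtain rfl : x' = x := by
              rcases hs' with rfl | rfl <;> cases hs <;> rfl
            have h6 : ZStep m x' (q, stack γ) (q', stack (u ++ γ.tail)) := by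
              rw [stack_eq, stack_append]
              exact .mk hs' hs hδ
            have h7 : 1 ≤ K := hK _ _ (.head h6 (.refl _))
            refine ihK (K - 1) (by omega) _ _ _ _ _ hL h5 h3 fun n D h8 => ?_
            have := hK _ _ (.head h6 h8)
            omega
          · refine ihL x'.length ?_ _ _ _ _ _ _ rfl h5 h3 fun n D h8 =>
              stepsN_zStep_le (hR x') (hle x') h8 ⟨_, _, _, rfl, h5, h3⟩
            rw [← hL]
            cases hs with
            | lambda => simp at hs'
            | endmarker => simp at hs'
            | letter => simp
  exact main _ _ _ _ _ _ _ rfl (.refl _ _ _) hw fun n D h8 =>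
    stepsN_zStep_le (hR w) (hle w) h8 ⟨_, _, _, rfl, .refl _ _ _, hw⟩

end Mach

/-! ### The constructions are primitive recursive. -/

theorem primrec_sublists' {α : Type*} [Primcodable α] : Primrec (List.sublists' (α := α)) := by
  have h : Primrec fun l : List α => l.foldr (fun a L => L ++ L.map (a :: ·)) [[]] := by
    refine Primrec.list_foldr (h := fun _ (p : α × List (List α)) => p.2 ++ p.2.map (p.1 :: ·))
      .id (.const [[]]) ?_
    refine Primrec.list_append.comp (Primrec.snd.comp .snd)
      (Primrec.list_map (Primrec.snd.comp .snd) ?_)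
    exact Primrec.list_cons.comp (Primrec.fst.comp (Primrec.snd.comp .fst)) .snd
  refine h.of_eq fun l => ?_
  induction l with
  | nil => rfl
  | cons a l ih => rw [List.foldr_cons, ih, List.sublists'_cons]

theorem primrecRel_list_mem {α : Type*} [Primcodable α] :
    PrimrecRel fun (a : α) (l : List α) => a ∈ l := by
  have := PrimrecRel.exists_mem_list (Primrec.eq (α := α))
  exact (this.comp Primrec.snd Primrec.fst).of_eq fun p => by simp

theorem primrec_list_filter {α β : Type*} [Primcodable α] [Primcodable β] {f : α → List β}
    {p : α → β → Prop} [∀ a, DecidablePred (p a)] (hf : Primrec f) (hp : PrimrecRel p) :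
    Primrec fun a => (f a).filter fun b => p a b := by
  have h : Primrec fun a => (f a).filterMap fun b => if p a b then some b else none :=
    Primrec.listFilterMap hf (Primrec.ite hp (Primrec.option_some.comp .snd) (.const none))
  refine h.of_eq fun a => ?_
  rw [← List.filterMap_eq_filter]
  congr 1
  funext b
  simp [Option.guard]

/-- Lawful `BEq` instances agree, so the result does not depend on which one occurs in a table. -/
theorem primrec₂_list_lookup {α β : Type*} [Primcodable α] [Primcodable β] [i : BEq α]
    [LawfulBEq α] : Primrec₂ (List.lookup : α → List (α × β) → Option β) := by
  classical
  obtain rfl : i = instBEqOfDecidableEq := lawful_beq_subsingleton _ _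
  exact Primrec.listLookup

namespace Mach

theorem primrec_scan : Primrec fun p : Mach × (ℕ × Option (Option InSym)) × List InSym =>
    p.1.scan p.2.1.1 p.2.1.2 p.2.2 := by
  have hq : Primrec fun p : Mach × (ℕ × Option (Option InSym)) × List InSym => p.2.1.1 :=
    Primrec.fst.comp (Primrec.fst.comp .snd)
  have hs : Primrec fun p : Mach × (ℕ × Option (Option InSym)) × List InSym => p.2.1.2 :=
    Primrec.snd.comp (Primrec.fst.comp .snd)
  have hA : Primrec fun p : Mach × (ℕ × Option (Option InSym)) × List InSym => p.2.2 :=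
    Primrec.snd.comp .snd
  have ht : Primrec fun p : Mach × (ℕ × Option (Option InSym)) × List InSym => p.1.transl :=
    Primrec.fst.comp (Primrec.snd.comp (Primrec.snd.comp .fst))
  have h1 : Primrec fun p : Mach × (ℕ × Option (Option InSym)) × List InSym =>
      p.2.2.filter fun a => (p.2.1.1, a) ∈ p.1.transl :=
    primrec_list_filter hA (primrecRel_list_mem.comp (.pair (hq.comp .fst) .snd) (ht.comp .fst))
  have h2 : Primrec₂ fun (p : Mach × (ℕ × Option (Option InSym)) × List InSym) (a : InSym) =>
      if a ∈ p.2.2 ∧ (p.2.1.1, a) ∉ p.1.transl then some (true, p.2.2) else none := by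
    refine Primrec.ite ?_ (Primrec.option_some.comp (.pair (.const true) (hA.comp .fst)))
      (.const none)
    exact (primrecRel_list_mem.comp .snd (hA.comp .fst)).and
      (primrecRel_list_mem.comp (.pair (hq.comp .fst) .snd) (ht.comp .fst)).not
  have h3 : Primrec₂ fun (p : Mach × (ℕ × Option (Option InSym)) × List InSym)
      (t : Option InSym) => (Option.casesOn (motive := fun _ => Option (Bool × List InSym)) t
        (some (false, p.2.2.filter fun a => (p.2.1.1, a) ∈ p.1.transl))
        fun a => if a ∈ p.2.2 ∧ (p.2.1.1, a) ∉ p.1.transl then some (true, p.2.2) else none) :=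
    Primrec.option_casesOn .snd (Primrec.option_some.comp (.pair (.const false) (h1.comp .fst)))
      (h2.comp (Primrec.fst.comp .fst) .snd)
  have h4 := Primrec.option_casesOn hs
    (Primrec.option_some.comp (Primrec.pair (.const false) hA)) h3
  refine h4.of_eq fun p => ?_
  obtain ⟨m, ⟨q, s⟩, A⟩ := p
  cases s with
  | none => rfl
  | some t => cases t <;> rfl

theorem primrec_scan_comp {α : Type*} [Primcodable α] {f : α → Mach} {q : α → ℕ}
    {s : α → Option (Option InSym)} {A : α → List InSym} (hf : Primrec f) (hq : Primrec q)
    (hs : Primrec s) (hA : Primrec A) : Primrec fun a => (f a).scan (q a) (s a) (A a) :=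
  primrec_scan.comp (.pair hf (.pair (.pair hq hs) hA))

theorem primrec_lift : Primrec₂ lift := by
  refine Primrec.list_append.comp (Primrec.list_map .fst ?_)
    (Primrec.ite (Primrec.eq.comp .snd (.const none)) (.const _) (.const _))
  exact Primrec.option_some.comp (Primrec.option_some.comp .snd)

theorem primrec_runSt : Primrec₂ runSt := Primrec.pair (.const 0) (Primrec.pair .fst .snd)
theorem primrec_divSt : Primrec divSt := Primrec.pair (.const 1) (.pair .id (.const []))

abbrev Rule := (ℕ × Option (Option InSym) × Option ℕ) × Option (ℕ × List ℕ)

theorem primrec_runRules (lw : Bool) : Primrec (runRules lw) := by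
  refine Primrec.list_flatMap (Primrec.snd.comp (Primrec.snd.comp .snd)) ?_
  refine Primrec.listFilterMap (primrec_sublists'.comp
    (Primrec.fst.comp (Primrec.snd.comp .fst))) ?_
  have hr : Primrec fun p : (Mach × Rule) × List InSym => p.1.2 := Primrec.snd.comp .fst
  refine Primrec.option_bind (primrec_scan_comp (Primrec.fst.comp .fst)
    (Primrec.fst.comp (Primrec.fst.comp hr))
    (Primrec.fst.comp (Primrec.snd.comp (Primrec.fst.comp hr))) .snd) ?_
  have hr' : Primrec fun p : ((Mach × Rule) × List InSym) × Bool × List InSym => p.1.1.2 :=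
    hr.comp .fst
  refine Primrec.option_map (Primrec.snd.comp hr') ?_
  have hr'' : Primrec fun p : (((Mach × Rule) × List InSym) × Bool × List InSym) × ℕ × List ℕ =>
    p.1.1.1.2 := hr'.comp .fst
  refine Primrec.pair (.pair (.pair ?_ ?_) (Primrec.option_some.comp (.pair ?_ ?_))) ?_
  · exact primrec_runSt.comp (Primrec.fst.comp (Primrec.fst.comp hr''))
      (Primrec.snd.comp (Primrec.fst.comp .fst))
  · exact Primrec.option_some.comp (Primrec.snd.comp (Primrec.snd.comp (Primrec.fst.comp hr'')))
  · exact primrec_runSt.comp (Primrec.fst.comp .snd) (Primrec.snd.comp (Primrec.snd.comp .fst))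
  · exact primrec_lift.comp (Primrec.snd.comp .snd)
      (Primrec.snd.comp (Primrec.snd.comp (Primrec.fst.comp hr'')))
  · exact Primrec.and.comp (Primrec.fst.comp (Primrec.snd.comp .fst)) (.const lw)

theorem primrec_acceptRules (fin : Bool) : Primrec (acceptRules fin) := by
  refine Primrec.list_flatMap (Primrec.snd.comp (Primrec.snd.comp .snd)) ?_
  refine Primrec.listFilterMap (primrec_sublists'.comp
    (Primrec.fst.comp (Primrec.snd.comp .fst))) ?_
  have hr : Primrec fun p : (Mach × Rule) × List InSym => p.1.2 := Primrec.snd.comp .fst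
  refine Primrec.ite (Primrec.eq.comp (Primrec.snd.comp hr) (.const none)) ?_ (.const none)
  refine Primrec.option_map (primrec_scan_comp (Primrec.fst.comp .fst)
    (Primrec.fst.comp (Primrec.fst.comp hr))
    (Primrec.fst.comp (Primrec.snd.comp (Primrec.fst.comp hr))) .snd) ?_
  have hr' : Primrec fun p : ((Mach × Rule) × List InSym) × Bool × List InSym => p.1.1.2 :=
    hr.comp .fst
  refine Primrec.pair (.pair (.pair ?_ ?_) ?_) (.const false)
  · exact primrec_runSt.comp (Primrec.fst.comp (Primrec.fst.comp hr')) (Primrec.snd.comp .fst)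
  · exact Primrec.option_some.comp (Primrec.snd.comp (Primrec.snd.comp (Primrec.fst.comp hr')))
  · refine Primrec.ite (PrimrecPred.and (Primrec.eq.comp (.const fin) (.const true))
      (Primrec.eq.comp (Primrec.snd.comp .snd) (.const []))) (.const _) (.const _)

theorem primrec_divRules : Primrec divRules := by
  refine Primrec.list_flatMap (Primrec.snd.comp (Primrec.snd.comp .snd)) ?_
  have hq : Primrec fun p : Mach × Rule => p.2.1.1 := Primrec.fst.comp (Primrec.fst.comp .snd)
  have hs : Primrec fun p : Mach × Rule => p.2.1.2.1 :=
    Primrec.fst.comp (Primrec.snd.comp (Primrec.fst.comp .snd))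
  have hz : Primrec fun p : Mach × Rule => p.2.1.2.2 :=
    Primrec.snd.comp (Primrec.snd.comp (Primrec.fst.comp .snd))
  refine Primrec.ite ((Primrec.eq.comp hs (.const _)).or (Primrec.eq.comp hs (.const _))) ?_
    (.const [])
  have hhead : Primrec fun p : Mach × Rule =>
      ((divSt p.2.1.1, some p.2.1.2.2) : SysState × SysSym) :=
    .pair (primrec_divSt.comp hq) (Primrec.option_some.comp hz)
  refine Primrec.list_cons.comp (.pair (.pair hhead (.const none)) (.const true))
    (Primrec.list_append.comp (Primrec.optionToList.comp (Primrec.option_map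
      (Primrec.snd.comp .snd) ?_)) (Primrec.list_map (primrec_sublists'.comp
        (Primrec.fst.comp (Primrec.snd.comp .fst))) ?_))
  · refine Primrec.pair (.pair (hhead.comp .fst) (Primrec.option_some.comp (.pair ?_ ?_)))
      (.const true)
    · exact primrec_divSt.comp (Primrec.fst.comp .snd)
    · exact primrec_lift.comp (Primrec.snd.comp .snd) (hz.comp .fst)
  · refine Primrec.pair (.pair (.pair (primrec_runSt.comp (hq.comp .fst) .snd)
      (Primrec.option_some.comp (hz.comp .fst))) (Primrec.option_some.comp
        (.pair (primrec_divSt.comp (hq.comp .fst)) ?_))) (.const false)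
    exact Primrec.list_cons.comp (Primrec.option_some.comp (hz.comp .fst)) (.const _)

theorem primrec_states : Primrec states :=
  Primrec.list_cons.comp .fst (Primrec.listFilterMap (Primrec.snd.comp (Primrec.snd.comp .snd))
    (Primrec.option_map (Primrec.snd.comp .snd) (Primrec.fst.comp .snd)))

theorem primrec_tops : Primrec tops := by
  refine Primrec.list_cons.comp (.const none) (Primrec.list_flatMap
    (Primrec.snd.comp (Primrec.snd.comp .snd)) (Primrec.list_map ?_
      (Primrec.option_some.comp .snd)))
  exact Primrec.option_getD.comp (Primrec.option_map (Primrec.snd.comp .snd)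
    (Primrec.snd.comp .snd)) (.const [])

theorem primrec_scans : Primrec scans :=
  Primrec.list_cons.comp (.const _) (Primrec.list_map (Primrec.fst.comp .snd)
    (Primrec.option_some.comp (Primrec.option_some.comp .snd)))

theorem primrec_stuckRules : Primrec stuckRules := by
  refine Primrec.list_flatMap primrec_states (Primrec.list_flatMap (primrec_tops.comp .fst)
    (Primrec.list_flatMap (primrec_scans.comp (Primrec.fst.comp .fst)) ?_))
  refine Primrec.listFilterMap (primrec_sublists'.comp (Primrec.fst.comp (Primrec.snd.comp
    (Primrec.fst.comp (Primrec.fst.comp .fst))))) ?_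
  have hm : Primrec fun p : (((Mach × ℕ) × Option ℕ) × Option (Option InSym)) × List InSym =>
    p.1.1.1.1 := Primrec.fst.comp (Primrec.fst.comp (Primrec.fst.comp .fst))
  have hq : Primrec fun p : (((Mach × ℕ) × Option ℕ) × Option (Option InSym)) × List InSym =>
    p.1.1.1.2 := Primrec.snd.comp (Primrec.fst.comp (Primrec.fst.comp .fst))
  have hz : Primrec fun p : (((Mach × ℕ) × Option ℕ) × Option (Option InSym)) × List InSym =>
    p.1.1.2 := Primrec.snd.comp (Primrec.fst.comp .fst)
  have hs : Primrec fun p : (((Mach × ℕ) × Option ℕ) × Option (Option InSym)) × List InSym =>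
    p.1.2 := Primrec.snd.comp .fst
  have hrules : Primrec fun p : (((Mach × ℕ) × Option ℕ) × Option (Option InSym)) × List InSym =>
    p.1.1.1.1.rules := Primrec.snd.comp (Primrec.snd.comp (Primrec.snd.comp hm))
  refine Primrec.ite (PrimrecPred.and ?_ ?_) (Primrec.option_map
    (primrec_scan_comp hm hq hs .snd) ?_) (.const none)
  · exact Primrec.eq.comp (primrec₂_list_lookup.comp (.pair hq (.pair (.const none) hz)) hrules)
      (.const none)
  · exact Primrec.eq.comp (primrec₂_list_lookup.comp (.pair hq (.pair hs hz)) hrules) (.const none)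
  · exact Primrec.pair (.pair (.pair (primrec_runSt.comp (hq.comp .fst) (Primrec.snd.comp .fst))
      (Primrec.option_some.comp (hz.comp .fst))) (.const _)) (.const _)

theorem primrec_acceptSystem (fin : Bool) : Primrec (acceptSystem fin) :=
  Primrec.list_append.comp (Primrec.list_append.comp (primrec_runRules fin)
    (primrec_acceptRules fin)) (.const _)

theorem primrec_rejectSystem : Primrec rejectSystem :=
  Primrec.list_append.comp (Primrec.list_append.comp (Primrec.list_append.comp
    (primrec_runRules false) primrec_divRules) primrec_stuckRules) (.const _)

theorem computablePred_infinite_halts_system {B : Mach → List (PushRule SysState SysSym × Bool)}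
    (hB : Primrec B) : ComputablePred fun m : Mach =>
      {n | Halts (B m) (runSt m.init m.letters) [some none] n}.Infinite := by
  obtain ⟨f, hf, hf'⟩ := ComputablePred.computable_iff.1
    (computablePred_infinite_halts (S := SysState) (Z := SysSym))
  refine ComputablePred.computable_iff.2 ⟨fun m => f (B m, (runSt m.init m.letters, some none)),
    hf.comp (Primrec.to_comp (.pair hB (.pair (primrec_runSt.comp .fst
      (Primrec.fst.comp .snd)) (.const _)))), ?_⟩
  funext m
  rw [← congrFun hf' (B m, (runSt m.init m.letters, some none))]

/-- It is decidable whether some word is accepted. -/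
theorem computablePred_exists_accepts :
    ComputablePred fun m : Mach => ∃ w ⊆ m.letters, m.Accepts w :=
  (computablePred_infinite_halts_system (primrec_acceptSystem false)).of_eq fun _ =>
    infinite_halts_acceptSystem_false

/-- It is decidable whether words of unbounded length are accepted. -/
theorem computablePred_forall_exists_accepts :
    ComputablePred fun m : Mach => ∀ N, ∃ w ⊆ m.letters, m.Accepts w ∧ N ≤ w.length :=
  (computablePred_infinite_halts_system (primrec_acceptSystem true)).of_eq fun _ =>
    infinite_halts_acceptSystem_true

/-- For deterministic automata it is decidable whether all words are accepted. -/
theorem exists_computablePred_forall_accepts : ∃ p : Mach → Prop, ComputablePred p ∧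
    ∀ m, m.Deterministic → (p m ↔ ∀ w ⊆ m.letters, m.Accepts w) := by
  refine ⟨_, (computablePred_infinite_halts_system primrec_rejectSystem).not, fun m hm => ?_⟩
  constructor
  · intro h w hw
    exact accepts_of_finite (Set.not_infinite.1 h) hw
  · intro h hinf
    obtain ⟨w, hw, h'⟩ := exists_not_accepts_of_infinite hm hinf
    exact h' (h w hw)

end Mach

/-! ### From abstract automata to their numerical descriptions. -/

section Transfer

variable {Q S G : Type*}

/-- The set of words that an automaton with translucent letters accepts. -/
def TAccepts (init : Q) (tr : Q → S → Prop)
    (δ : Q → Option (Option S) → Option G → Option (Q × List G) → Prop) (w : List S) : Prop :=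
  Relation.ReflTransGen (TStep tr δ) (.run init w []) .accept

/-- The image of a configuration under maps of states, letters and pushdown symbols. -/
def Config.map (eQ : Q → ℕ) (eS : S → InSym) (eG : G → ℕ) :
    Config Q S G → Config ℕ InSym ℕ
  | .run q w γ => .run (eQ q) (w.map eS) (γ.map eG)
  | .accept => .accept

/-- The description `m` is the image of an automaton under injective maps of states, letters and
pushdown symbols. -/
structure Mach.Describes (m : Mach) (init : Q) (tr : Q → S → Prop)
    (δ : Q → Option (Option S) → Option G → Option (Q × List G) → Prop)
    (eQ : Q → ℕ) (eS : S → InSym) (eG : G → ℕ) : Prop where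
  injQ : Function.Injective eQ
  injS : Function.Injective eS
  injG : Function.Injective eG
  init_eq : m.init = eQ init
  mem_letters : ∀ a, a ∈ m.letters ↔ ∃ s, eS s = a
  mem_transl : ∀ q a, (eQ q, eS a) ∈ m.transl ↔ tr q a
  mem_rules : ∀ k o, (k, o) ∈ m.rules ↔ ∃ q s z o', δ q s z o' ∧
    k = (eQ q, s.map (Option.map eS), z.map eG) ∧ o = o'.map (Prod.map eQ (List.map eG))

namespace Mach.Describes

variable {m : Mach} {init : Q} {tr : Q → S → Prop}
  {δ : Q → Option (Option S) → Option G → Option (Q × List G) → Prop}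
  {eQ : Q → ℕ} {eS : S → InSym} {eG : G → ℕ}

theorem mem_rules_iff (h : m.Describes init tr δ eQ eS eG) {q s z o} :
    ((eQ q, s.map (Option.map eS), z.map eG), o) ∈ m.rules ↔
      ∃ o', δ q s z o' ∧ o = o'.map (Prod.map eQ (List.map eG)) := by
  rw [h.mem_rules]
  constructor
  · rintro ⟨q', s', z', o', h1, h2, rfl⟩
    simp only [Prod.mk.injEq] at h2
    obtain rfl := h.injQ h2.1
    obtain rfl := Option.map_injective (Option.map_injective h.injS) h2.2.1
    obtain rfl := Option.map_injective h.injG h2.2.2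
    exact ⟨o', h1, rfl⟩
  · rintro ⟨o', h1, rfl⟩
    exact ⟨q, s, z, o', h1, rfl, rfl⟩

theorem scans_map (h : m.Describes init tr δ eQ eS eG) {q s w w'} (hs : Scans tr q s w w') :
    Scans (fun q a => (q, a) ∈ m.transl) (eQ q) (s.map (Option.map eS)) (w.map eS)
      (w'.map eS) := by
  cases hs with
  | lambda => exact .lambda _
  | endmarker hw => exact .endmarker (by simpa [h.mem_transl] using hw)
  | letter hx ha =>
    rw [List.map_append, List.map_cons, List.map_append]
    exact .letter (by simpa [h.mem_transl] using hx) (by simpa [h.mem_transl] using ha)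

theorem exists_scans_of_map (h : m.Describes init tr δ eQ eS eG) {q t w v}
    (hs : Scans (fun q a => (q, a) ∈ m.transl) (eQ q) t (w.map eS) v) :
    ∃ s w', t = s.map (Option.map eS) ∧ v = w'.map eS ∧ Scans tr q s w w' := by
  generalize hu : w.map eS = u at hs
  cases hs with
  | lambda => exact ⟨none, w, rfl, hu.symm, .lambda _⟩
  | endmarker hw =>
    subst hu
    exact ⟨some none, w, rfl, rfl, .endmarker (by simpa [h.mem_transl] using hw)⟩
  | letter hx ha =>
    obtain ⟨x, y, rfl, rfl, hy⟩ := List.map_eq_append_iff.1 hu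
    obtain ⟨a, y, rfl, rfl, rfl⟩ := List.map_eq_cons_iff.1 hy
    exact ⟨some (some a), x ++ y, rfl, by simp, .letter (by simpa [h.mem_transl] using hx)
      (by simpa [h.mem_transl] using ha)⟩

theorem map_next (o : Option (Q × List G)) (w : List S) (γ : List G) :
    (Config.next o w γ).map eQ eS eG =
      .next (o.map (Prod.map eQ (List.map eG))) (w.map eS) (γ.map eG) := by
  cases o <;> simp [Config.next, Config.map]

theorem step_map (h : m.Describes init tr δ eQ eS eG) {C D} (hs : TStep tr δ C D) :
    m.Step (C.map eQ eS eG) (D.map eQ eS eG) := by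
  cases hs with
  | mk hs hδ =>
    rw [map_next]
    refine TStep.mk (δ := fun q s z o => ((q, s, z), o) ∈ m.rules) (h.scans_map hs) ?_
    rw [List.head?_map, h.mem_rules_iff]
    exact ⟨_, hδ, rfl⟩

/-- The image of the configurations is closed under steps, so a run of `m` that starts in the image
can be pulled back. -/
theorem exists_step_of_map (h : m.Describes init tr δ eQ eS eG) {C D'}
    (hs : m.Step (C.map eQ eS eG) D') : ∃ D, D' = D.map eQ eS eG ∧ TStep tr δ C D := by
  cases C with
  | accept => exact absurd hs (not_step_accept _)
  | run q w γ =>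
    generalize hC : Config.map eQ eS eG (.run q w γ) = C at hs
    cases hs with
    | mk hs hδ =>
      simp only [Config.map, Config.run.injEq] at hC
      obtain ⟨rfl, rfl, rfl⟩ := hC
      obtain ⟨s, w', rfl, rfl, hs'⟩ := h.exists_scans_of_map hs
      rw [List.head?_map, h.mem_rules_iff] at hδ
      obtain ⟨o, hδ, rfl⟩ := hδ
      exact ⟨_, (map_next _ _ _).symm, .mk hs' hδ⟩

theorem accepts_map_iff (h : m.Describes init tr δ eQ eS eG) {w : List S} :
    m.Accepts (w.map eS) ↔ TAccepts init tr δ w := by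
  constructor
  · intro ha
    have : ∀ C D, Relation.ReflTransGen m.Step (Config.map eQ eS eG C) D →
        ∃ D', D = D'.map eQ eS eG ∧ Relation.ReflTransGen (TStep tr δ) C D' := by
      intro C D hr
      induction hr with
      | refl => exact ⟨C, rfl, .refl⟩
      | tail _ h2 ih =>
        obtain ⟨D', rfl, h3⟩ := ih
        obtain ⟨D'', rfl, h4⟩ := h.exists_step_of_map h2
        exact ⟨D'', rfl, h3.tail h4⟩
    obtain ⟨D, hD, hr⟩ := this (.run init w []) .accept
      (by simpa [Config.map, ← h.init_eq, Accepts] using ha)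
    cases D with
    | accept => exact hr
    | run => simp [Config.map] at hD
  · intro ha
    have := Relation.ReflTransGen.lift (p := m.Step) (Config.map eQ eS eG)
      (fun _ _ => h.step_map) _ _ ha
    simpa [Config.map, ← h.init_eq, Accepts, Function.onFun] using this

theorem map_subset_letters (h : m.Describes init tr δ eQ eS eG) (w : List S) :
    w.map eS ⊆ m.letters := by
  intro a ha
  obtain ⟨s, -, rfl⟩ := List.mem_map.1 ha
  exact (h.mem_letters _).2 ⟨s, rfl⟩

theorem exists_map_eq (h : m.Describes init tr δ eQ eS eG) {w : List InSym}
    (hw : w ⊆ m.letters) : ∃ v : List S, v.map eS = w := by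
  have : w ∈ Set.range (List.map eS) := by
    rw [Set.range_list_map]
    exact fun a ha => (h.mem_letters a).1 (hw ha)
  exact this

theorem exists_accepts_iff (h : m.Describes init tr δ eQ eS eG) :
    (∃ w ⊆ m.letters, m.Accepts w) ↔ ∃ w, TAccepts init tr δ w := by
  constructor
  · rintro ⟨w, hw, ha⟩
    obtain ⟨v, rfl⟩ := h.exists_map_eq hw
    exact ⟨v, h.accepts_map_iff.1 ha⟩
  · rintro ⟨w, hw⟩
    exact ⟨_, h.map_subset_letters w, h.accepts_map_iff.2 hw⟩

theorem forall_accepts_iff (h : m.Describes init tr δ eQ eS eG) :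
    (∀ w ⊆ m.letters, m.Accepts w) ↔ ∀ w, TAccepts init tr δ w := by
  constructor
  · exact fun ha w => h.accepts_map_iff.1 (ha _ (h.map_subset_letters w))
  · intro ha w hw
    obtain ⟨v, rfl⟩ := h.exists_map_eq hw
    exact h.accepts_map_iff.2 (ha v)

/-- Over a finite alphabet there are finitely many words below each length, so infinite means
unbounded length. Length is all that survives the rearrangement of words. -/
theorem forall_exists_accepts_iff [Finite S] (h : m.Describes init tr δ eQ eS eG) :
    (∀ N, ∃ w ⊆ m.letters, m.Accepts w ∧ N ≤ w.length) ↔ {w | TAccepts init tr δ w}.Infinite := by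
  constructor
  · intro ha hfin
    obtain ⟨N, hN⟩ := (hfin.image List.length).bddAbove
    obtain ⟨w, hw, h1, h2⟩ := ha (N + 1)
    obtain ⟨v, rfl⟩ := h.exists_map_eq hw
    have := hN ⟨v, h.accepts_map_iff.1 h1, rfl⟩
    rw [List.length_map] at h2
    omega
  · intro hinf N
    by_contra! hno
    refine hinf ((List.finite_length_lt S N).subset fun w hw => ?_)
    simpa using hno _ (h.map_subset_letters w) (h.accepts_map_iff.2 hw)

/-- As the encodings are injective, two rules of `m` can only compete if they come from the same
state and top symbol. -/
theorem deterministic (h : m.Describes init tr δ eQ eS eG)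
    (h1 : ∀ q s z o o', δ q s z o → δ q s z o' → o = o')
    (h2 : ∀ q s z o o', δ q none z o → δ q s z o' → s = none) : m.Deterministic := by
  constructor
  · intro k o o' hk hk'
    obtain ⟨q, s, z, o, ho, rfl, rfl⟩ := (h.mem_rules _ _).1 hk
    obtain ⟨o', ho', rfl⟩ := h.mem_rules_iff.1 hk'
    rw [h1 _ _ _ _ _ ho ho']
  · intro q z s o o' hk hk'
    obtain ⟨q, t, z, o, ho, hq, rfl⟩ := (h.mem_rules _ _).1 hk
    obtain ⟨q', s, z', o', ho', hq', rfl⟩ := (h.mem_rules _ _).1 hk'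
    simp only [Prod.mk.injEq] at hq hq'
    obtain ⟨rfl, ht, rfl⟩ := hq
    obtain ⟨hq, rfl, hz⟩ := hq'
    obtain rfl := h.injQ hq
    obtain rfl := Option.map_injective h.injG hz
    obtain rfl : t = none := by simpa using ht.symm
    rw [h2 _ _ _ _ _ ho ho']
    rfl

end Mach.Describes

/-- If automata are computably described, then emptiness and finiteness of their languages are
decidable, and so is universality in the deterministic case. -/
theorem computablePred_of_describes {C : Type*} [Primcodable C] {Q S G : C → Type*}
    [∀ c, Finite (S c)] {f : C → Mach} (hf : Computable f) {init : ∀ c, Q c}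
    {tr : ∀ c, Q c → S c → Prop}
    {δ : ∀ c, Q c → Option (Option (S c)) → Option (G c) → Option (Q c × List (G c)) → Prop}
    {eQ : ∀ c, Q c → ℕ} {eS : ∀ c, S c → InSym} {eG : ∀ c, G c → ℕ}
    (h : ∀ c, (f c).Describes (init c) (tr c) (δ c) (eQ c) (eS c) (eG c)) :
    (ComputablePred fun c => {w | TAccepts (init c) (tr c) (δ c) w} = ∅) ∧
    (ComputablePred fun c => {w | TAccepts (init c) (tr c) (δ c) w}.Finite) ∧
    ∃ p : C → Prop, ComputablePred p ∧ ∀ c, (f c).Deterministic →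
      (p c ↔ {w | TAccepts (init c) (tr c) (δ c) w} = Set.univ) := by
  have hcomp : ∀ {p : Mach → Prop}, ComputablePred p → ComputablePred fun c => p (f c) := by
    intro p hp
    obtain ⟨g, hg, rfl⟩ := ComputablePred.computable_iff.1 hp
    exact ComputablePred.computable_iff.2 ⟨fun c => g (f c), hg.comp hf, rfl⟩
  refine ⟨?_, ?_, ?_⟩
  · refine (hcomp Mach.computablePred_exists_accepts.not).of_eq fun c => ?_
    rw [(h c).exists_accepts_iff, Set.eq_empty_iff_forall_notMem]
    simp
  · refine (hcomp Mach.computablePred_forall_exists_accepts.not).of_eq fun c => ?_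
    rw [(h c).forall_exists_accepts_iff, Set.not_infinite]
  · obtain ⟨p, hp, hp'⟩ := Mach.exists_computablePred_forall_accepts
    refine ⟨_, hcomp hp, fun c hc => ?_⟩
    rw [hp' _ hc, (h c).forall_accepts_iff, Set.eq_univ_iff_forall]
    rfl

end Transfer

/-! ### Both models as automata that replace the top of the pushdown. -/

theorem List.toList_head?_append_tail {α : Type*} (l : List α) : l.head?.toList ++ l.tail = l := by
  cases l <;> rfl

/-- The choices of a value: `none` for `accept`, and the images of the elements of a set. -/
def Outcome.Yields {α β : Type*} (f : α → β) : Outcome α → Option β → Prop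
  | .accept, o => o = none
  | .goto T, o => ∃ p ∈ T, o = some (f p)

theorem Outcome.AtMostOne.yields_unique {α β : Type*} {f : α → β} {v : Outcome α}
    (hv : v.AtMostOne) {o o' : Option β} (h : v.Yields f o) (h' : v.Yields f o') : o = o' := by
  cases v with
  | accept => exact h.trans h'.symm
  | goto T =>
    obtain ⟨p, hp, rfl⟩ := h
    obtain ⟨p', hp', rfl⟩ := h'
    rw [hv hp hp']

namespace NIDPDAwtl

variable {Q D R N G : Type*}

/-- The moves of an input-driven automaton, as moves that replace the top of the pushdown. -/
def IsMove (M : NIDPDAwtl Q D R N G) (q : Q) :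
    Option (Option (Letter D R N)) → Option G → Option (Q × List G) → Prop
  | none, _, _ => False
  | some none, z, o => ∃ v, M.δN q none z = some v ∧ v.Yields (fun q' => (q', z.toList)) o
  | some (some (.push a)), z, o =>
    ∃ v, M.δD q a z = some v ∧ v.Yields (fun p => (p.1, p.2 :: z.toList)) o
  | some (some (.pop a)), z, o => ∃ v, M.δR q a z = some v ∧ v.Yields (fun q' => (q', [])) o
  | some (some (.neutral a)), z, o =>
    ∃ v, M.δN q (some a) z = some v ∧ v.Yields (fun q' => (q', z.toList)) o

/-- Every `TStep` removes the top symbol, so push, neutral and endmarker moves put it back as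
`z.toList`. At the bottom this list is empty, and so is the tail, which leaves the implicit bottom
in place. -/
theorem step_iff (M : NIDPDAwtl Q D R N G) (C C' : Config Q (Letter D R N) G) :
    M.Step C C' ↔ TStep (fun q a => a ∈ M.transl q) M.IsMove C C' := by
  constructor
  · intro h
    have mk : ∀ {q s w w' γ o}, Scans (fun q a => a ∈ M.transl q) q s w w' →
        M.IsMove q s γ.head? o →
        TStep (fun q a => a ∈ M.transl q) M.IsMove (.run q w γ) (.next o w' γ) :=
      fun h1 h2 => .mk h1 h2
    cases h with
    | push hx ha hδ hT =>
      simpa [Config.next, List.toList_head?_append_tail] using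
        mk (.letter hx ha) ⟨_, hδ, _, hT, rfl⟩
    | pop hx ha hδ hT => exact mk (.letter hx ha) ⟨_, hδ, _, hT, rfl⟩
    | neutral hx ha hδ hT =>
      simpa [Config.next, List.toList_head?_append_tail] using
        mk (.letter hx ha) ⟨_, hδ, _, hT, rfl⟩
    | endmarker hx hδ hT =>
      simpa [Config.next, List.toList_head?_append_tail] using
        mk (.endmarker hx) ⟨_, hδ, _, hT, rfl⟩
    | pushAccept hx ha hδ => exact mk (.letter hx ha) ⟨_, hδ, rfl⟩
    | popAccept hx ha hδ => exact mk (.letter hx ha) ⟨_, hδ, rfl⟩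
    | neutralAccept hx ha hδ => exact mk (.letter hx ha) ⟨_, hδ, rfl⟩
    | endmarkerAccept hx hδ => exact mk (.endmarker hx) ⟨_, hδ, rfl⟩
  · intro h
    cases h with
    | mk hs hδ =>
      cases hs with
      | lambda => exact hδ.elim
      | endmarker hx =>
        obtain ⟨_ | T, hv, h⟩ := hδ
        · cases h
          exact .endmarkerAccept hx hv
        · obtain ⟨q', hT, rfl⟩ := h
          simpa [Config.next, List.toList_head?_append_tail] using Step.endmarker hx hv hT
      | @letter x a y hx ha =>
        cases a with
        | push a =>
          obtain ⟨_ | T, hv, h⟩ := hδ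
          · cases h
            exact .pushAccept hx ha hv
          · obtain ⟨q', hT, rfl⟩ := h
            simpa [Config.next, List.toList_head?_append_tail] using Step.push hx ha hv hT
        | pop a =>
          obtain ⟨_ | T, hv, h⟩ := hδ
          · cases h
            exact .popAccept hx ha hv
          · obtain ⟨q', hT, rfl⟩ := h
            exact .pop hx ha hv hT
        | neutral a =>
          obtain ⟨_ | T, hv, h⟩ := hδ
          · cases h
            exact .neutralAccept hx ha hv
          · obtain ⟨q', hT, rfl⟩ := h
            simpa [Config.next, List.toList_head?_append_tail] using Step.neutral hx ha hv hT

theorem language_eq (M : NIDPDAwtl Q D R N G) :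
    M.language = {w | TAccepts M.init (fun q a => a ∈ M.transl q) M.IsMove w} := by
  have : M.Step = TStep (fun q a => a ∈ M.transl q) M.IsMove := by
    funext C C'
    exact propext (M.step_iff C C')
  simp only [language, TAccepts, this]
  rfl

theorem IsDeterministic.isMove_unique {M : NIDPDAwtl Q D R N G} (hM : M.IsDeterministic)
    {q s z o o'} (h : M.IsMove q s z o) (h' : M.IsMove q s z o') : o = o' := by
  obtain ⟨hD, hR, hN⟩ := hM
  match s, h, h' with
  | none, h, _ => exact h.elim
  | some none, ⟨v, hv, h⟩, ⟨v', hv', h'⟩ =>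
    cases hv.symm.trans hv'
    exact (hN _ _ _ _ hv).yields_unique h h'
  | some (some (.push a)), ⟨v, hv, h⟩, ⟨v', hv', h'⟩ =>
    cases hv.symm.trans hv'
    exact (hD _ _ _ _ hv).yields_unique h h'
  | some (some (.pop a)), ⟨v, hv, h⟩, ⟨v', hv', h'⟩ =>
    cases hv.symm.trans hv'
    exact (hR _ _ _ _ hv).yields_unique h h'
  | some (some (.neutral a)), ⟨v, hv, h⟩, ⟨v', hv', h'⟩ =>
    cases hv.symm.trans hv'
    exact (hN _ _ _ _ hv).yields_unique h h'

end NIDPDAwtl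

namespace PDAwtl

variable {Q S G : Type*}

/-- What is scanned, as an element of `Option (Option S)`. -/
def _root_.Scan.toOption : Scan S → Option (Option S)
  | .letter a => some (some a)
  | .endmarker => some none
  | .lambda => none

theorem _root_.Scan.toOption_injective : Function.Injective (Scan.toOption (S := S)) := by
  rintro (a | _ | _) (b | _ | _) h <;> simp_all [Scan.toOption]

/-- A value of a transition function, with `none` for `accept`. -/
def _root_.Move.toOption : Move Q G → Option (Q × List G)
  | .accept => none
  | .goto q u => some (q, u)

/-- The moves of an automaton that is not input-driven. -/
inductive IsMove (M : PDAwtl Q S G) :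
    Q → Option (Option S) → Option G → Option (Q × List G) → Prop
  | goto {q s z q' u} (h : M.δ q s z = some (.goto q' u)) : IsMove M q s.toOption z (some (q', u))
  | accept {q s z} (h : M.δ q s z = some .accept) : IsMove M q s.toOption z none

theorem step_iff (M : PDAwtl Q S G) (C C' : Config Q S G) :
    M.Step C C' ↔ TStep (fun q a => a ∈ M.transl q) M.IsMove C C' := by
  constructor
  · intro h
    have mk : ∀ s {q w w' γ o}, Scans (fun q a => a ∈ M.transl q) q (Scan.toOption s) w w' →
        M.IsMove q s.toOption γ.head? o →
        TStep (fun q a => a ∈ M.transl q) M.IsMove (.run q w γ) (.next o w' γ) :=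
      fun _ _ _ _ _ _ h1 h2 => .mk h1 h2
    cases h with
    | letter hx ha hδ => exact mk (.letter _) (.letter hx ha) (.goto hδ)
    | endmarker hx hδ => exact mk .endmarker (.endmarker hx) (.goto hδ)
    | lambda hδ => exact mk .lambda (.lambda _) (.goto hδ)
    | letterAccept hx ha hδ => exact mk (.letter _) (.letter hx ha) (.accept hδ)
    | endmarkerAccept hx hδ => exact mk .endmarker (.endmarker hx) (.accept hδ)
    | lambdaAccept hδ => exact mk .lambda (.lambda _) (.accept hδ)
  · intro h
    cases h with
    | mk hs hδ =>
      cases hδ with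
      | @goto s _ q' u h =>
        cases s with
        | letter a => cases hs with | letter hx ha => exact Step.letter hx ha h
        | endmarker => cases hs with | endmarker hx => exact Step.endmarker hx h
        | lambda => cases hs with | lambda => exact Step.lambda h
      | @accept s _ h =>
        cases s with
        | letter a => cases hs with | letter hx ha => exact Step.letterAccept hx ha h
        | endmarker => cases hs with | endmarker hx => exact Step.endmarkerAccept hx h
        | lambda => cases hs with | lambda => exact Step.lambdaAccept h

theorem language_eq (M : PDAwtl Q S G) :
    M.language = {w | TAccepts M.init (fun q a => a ∈ M.transl q) M.IsMove w} := by
  have : M.Step = TStep (fun q a => a ∈ M.transl q) M.IsMove := by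
    funext C C'
    exact propext (M.step_iff C C')
  simp only [language, TAccepts, this]
  rfl

theorem isMove_iff {M : PDAwtl Q S G} {q s z o} : M.IsMove q s z o ↔
    ∃ t : Scan S, s = t.toOption ∧ ∃ v, M.δ q t z = some v ∧
      o = v.toOption := by
  constructor
  · rintro (h | h)
    · exact ⟨_, rfl, _, h, rfl⟩
    · exact ⟨_, rfl, _, h, rfl⟩
  · rintro ⟨t, rfl, _ | ⟨q', u⟩, h, rfl⟩
    · exact .accept h
    · exact .goto h

theorem IsMove.unique {M : PDAwtl Q S G} {q s z o o'} (h : M.IsMove q s z o)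
    (h' : M.IsMove q s z o') : o = o' := by
  obtain ⟨t, rfl, v, hv, rfl⟩ := isMove_iff.1 h
  obtain ⟨t', ht, v', hv', rfl⟩ := isMove_iff.1 h'
  obtain rfl := Scan.toOption_injective ht
  cases hv.symm.trans hv'
  rfl

theorem IsDeterministic.eq_none {M : PDAwtl Q S G} (hM : M.IsDeterministic) {q s z o o'}
    (h : M.IsMove q none z o) (h' : M.IsMove q s z o') : s = none := by
  obtain ⟨t, ht, v, hv, rfl⟩ := isMove_iff.1 h
  obtain rfl : t = .lambda := Scan.toOption_injective ht.symm
  obtain ⟨t', rfl, v', hv', rfl⟩ := isMove_iff.1 h'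
  obtain ⟨h1, h2⟩ := hM q z (by simp [hv])
  cases t' with
  | letter a => simp [h1] at hv'
  | endmarker => simp [h2] at hv'
  | lambda => rfl

end PDAwtl

/-! ### Moves listed from finite tables. -/

section Tables

/-- The arguments of transition functions given by tables. -/
def tableKeys {Y : Type*} (K : ℕ) (xs : List Y) (g : ℕ) : List (ℕ × Y × Option ℕ) :=
  (List.range (K + 1)).flatMap fun q => xs.flatMap fun x =>
    (none :: (List.range g).map some).map fun z => (q, x, z)

/-- The moves described by a table, where `f` lists the choices of an entry. -/
def tableMoves {κ V W : Type*} [BEq κ] (keys : List κ) (table : List (κ × V))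
    (f : κ → V → List W) : List (κ × W) :=
  keys.flatMap fun k => ((table.lookup k).map fun v => (f k v).map fun w => (k, w)).getD []

/-- The choices of an entry for which `none` stands for `accept`. -/
def entryChoices {β W : Type*} (F : β → Option W) (v : Option (List β)) : List (Option W) :=
  v.elim [none] fun l => (l.filterMap F).map some

theorem mem_tableMoves {κ V W : Type*} [BEq κ] {keys : List κ} {table : List (κ × V)}
    {f : κ → V → List W} {k : κ} {w : W} :
    (k, w) ∈ tableMoves keys table f ↔ k ∈ keys ∧ ∃ v, table.lookup k = some v ∧ w ∈ f k v := by
  simp only [tableMoves, List.mem_flatMap]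
  constructor
  · rintro ⟨k', hk, h⟩
    cases hv : table.lookup k' with
    | none => simp [hv] at h
    | some v =>
      simp only [hv, Option.map_some, Option.getD_some, List.mem_map, Prod.mk.injEq] at h
      obtain ⟨w', hw, rfl, rfl⟩ := h
      exact ⟨hk, v, hv, hw⟩
  · rintro ⟨hk, v, hv, hw⟩
    exact ⟨k, hk, by simpa [hv] using hw⟩

/-- The keys are the codes of actual arguments only. Looking each of them up ignores table entries
for numbers out of range and shadowed duplicates, exactly as the described automaton does. -/
theorem mem_tableKeys {X Y : Type*} {K g : ℕ} {xs : List Y} {e : X → Y}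
    (hxs : ∀ y, y ∈ xs ↔ ∃ x, e x = y) {k : ℕ × Y × Option ℕ} : k ∈ tableKeys K xs g ↔
      ∃ (q : Fin (K + 1)) (x : X) (z : Option (Fin g)), k = (q.val, e x, z.map Fin.val) := by
  simp only [tableKeys, List.mem_flatMap, List.mem_map, List.mem_range, hxs, List.mem_cons]
  constructor
  · rintro ⟨q, hq, _, ⟨x, rfl⟩, z, rfl | ⟨i, hi, rfl⟩, rfl⟩
    · exact ⟨⟨q, hq⟩, x, none, rfl⟩
    · exact ⟨⟨q, hq⟩, x, some ⟨i, hi⟩, rfl⟩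
  · rintro ⟨q, x, z, rfl⟩
    refine ⟨q, q.2, _, ⟨x, rfl⟩, _, ?_, rfl⟩
    cases z with
    | none => exact .inl rfl
    | some i => exact .inr ⟨i, i.2, rfl⟩

theorem mem_entryChoices {α β W W' : Type*} {f : α → β} {h : α → W'} {enc : W' → W}
    {F : β → Option W} (hF : ∀ b w, F b = some w ↔ ∃ p, f p = b ∧ w = enc (h p))
    {v : Option (List β)} {o : Option W} : o ∈ entryChoices F v ↔
      ∃ o', (IDCode.outcome f v).Yields h o' ∧ o = o'.map enc := by
  cases v with
  | none => simp [entryChoices, IDCode.outcome, Outcome.Yields]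
  | some l =>
    simp only [entryChoices, Option.elim, List.mem_map, List.mem_filterMap, hF, IDCode.outcome,
      Outcome.Yields, Set.mem_ofPred_eq]
    constructor
    · rintro ⟨_, ⟨_, hb, p, rfl, rfl⟩, rfl⟩
      exact ⟨_, ⟨p, hb, rfl⟩, rfl⟩
    · rintro ⟨_, ⟨p, hb, rfl⟩, rfl⟩
      exact ⟨_, ⟨_, hb, p, rfl, rfl⟩, rfl⟩

variable {C : Type*} [Primcodable C]

theorem primrec_tableKeys {Y : Type*} [Primcodable Y] {K g : C → ℕ} {xs : C → List Y}
    (hK : Primrec K) (hxs : Primrec xs) (hg : Primrec g) :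
    Primrec fun c => tableKeys (K c) (xs c) (g c) := by
  refine Primrec.list_flatMap (Primrec.list_range.comp (Primrec.succ.comp hK))
    (Primrec.list_flatMap (hxs.comp .fst) (Primrec.list_map (Primrec.list_cons.comp (.const none)
      (Primrec.list_map (Primrec.list_range.comp (hg.comp (Primrec.fst.comp .fst)))
        (Primrec.option_some.comp .snd))) ?_))
  exact Primrec.pair (Primrec.snd.comp (Primrec.fst.comp .fst))
    (.pair (Primrec.snd.comp .fst) .snd)

theorem primrec_tableMoves {κ V W : Type*} [Primcodable κ] [Primcodable V] [Primcodable W]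
    [BEq κ] [LawfulBEq κ] {keys : C → List κ} {table : C → List (κ × V)}
    {f : C → κ → V → List W} (hkeys : Primrec keys) (htable : Primrec table)
    (hf : Primrec fun p : (C × κ) × V => f p.1.1 p.1.2 p.2) :
    Primrec fun c => tableMoves (keys c) (table c) (f c) := by
  refine Primrec.list_flatMap hkeys (Primrec.option_getD.comp (Primrec.option_map
    (primrec₂_list_lookup.comp .snd (htable.comp .fst)) (Primrec.list_map hf ?_)) (.const []))
  exact Primrec.pair (Primrec.snd.comp (Primrec.fst.comp .fst)) .snd

theorem primrec_entryChoices {β W : Type*} [Primcodable β] [Primcodable W]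
    {F : C → β → Option W} {v : C → Option (List β)} (hF : Primrec₂ F) (hv : Primrec v) :
    Primrec fun c => entryChoices (F c) (v c) := by
  have h := Primrec.option_casesOn hv (.const [none]) (Primrec.list_map
    (f := fun p : C × List β => p.2.filterMap (F p.1))
    (g := fun _ w => some w)
    (Primrec.listFilterMap .snd (hF.comp (Primrec.fst.comp .fst) .snd))
    (Primrec.option_some.comp .snd)).to₂
  refine h.of_eq fun c => ?_
  cases hv : v c <;> simp [entryChoices]

end Tables

/-! ### Translation of input-driven automata. -/

namespace IDCode

/-- The code of a letter. -/
def letterCode {d r n : ℕ} : Letter (Fin d) (Fin r) (Fin n) → InSym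
  | .push a => (0, a.val)
  | .pop a => (1, a.val)
  | .neutral a => (2, a.val)

/-- The moves of an input-driven automaton on push letters. -/
def movesD (c : IDCode) : List ((ℕ × ℕ × Option ℕ) × Option (ℕ × List ℕ)) :=
  tableMoves (tableKeys c.numStates (List.range c.numD) c.numG) c.tableD fun k =>
    entryChoices fun p =>
      if p.1 < c.numStates + 1 ∧ p.2 < c.numG then some (p.1, p.2 :: k.2.2.toList) else none

/-- The moves of an input-driven automaton on pop letters. -/
def movesR (c : IDCode) : List ((ℕ × ℕ × Option ℕ) × Option (ℕ × List ℕ)) :=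
  tableMoves (tableKeys c.numStates (List.range c.numR) c.numG) c.tableR fun _ =>
    entryChoices fun q => if q < c.numStates + 1 then some (q, []) else none

/-- The moves of an input-driven automaton on neutral letters and the endmarker. -/
def movesN (c : IDCode) : List ((ℕ × Option ℕ × Option ℕ) × Option (ℕ × List ℕ)) :=
  tableMoves (tableKeys c.numStates (none :: (List.range c.numN).map some) c.numG) c.tableN
    fun k => entryChoices fun q =>
      if q < c.numStates + 1 then some (q, k.2.2.toList) else none

/-- The description of an input-driven automaton as an automaton with general moves. -/
def toMach (c : IDCode) : Mach :=
  (c.init % (c.numStates + 1),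
    ((List.range c.numD).map fun a => (0, a)) ++ (((List.range c.numR).map fun a => (1, a)) ++
      (List.range c.numN).map fun a => (2, a)),
    (c.translD.map fun p => (p.1, (0, p.2))) ++ ((c.translR.map fun p => (p.1, (1, p.2))) ++
      c.translN.map fun p => (p.1, (2, p.2))),
    (c.movesD.map fun e => ((e.1.1, some (some (0, e.1.2.1)), e.1.2.2), e.2)) ++
      ((c.movesR.map fun e => ((e.1.1, some (some (1, e.1.2.1)), e.1.2.2), e.2)) ++
        c.movesN.map fun e => ((e.1.1, some (e.1.2.1.map fun a => (2, a)), e.1.2.2), e.2)))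

theorem mem_range_iff {n : ℕ} (y : ℕ) : y ∈ List.range n ↔ ∃ x : Fin n, x.val = y := by
  simp [Fin.exists_iff]

theorem map_toList {α β : Type*} (f : α → β) (z : Option α) :
    (z.map f).toList = z.toList.map f := by
  cases z <;> rfl

/-- `IDCode.outcome` collects only actual states and pushdown symbols, so numbers out of range
describe no choice; the guards in `movesD` discard the same numbers. -/
theorem mem_movesD {c : IDCode} {k o} : (k, o) ∈ c.movesD ↔ ∃ q a z o',
    c.automaton.IsMove q (some (some (.push a))) z o' ∧ k = (q.val, a.val, z.map Fin.val) ∧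
      o = o'.map (Prod.map Fin.val (List.map Fin.val)) := by
  simp only [movesD, mem_tableMoves, mem_tableKeys mem_range_iff]
  have key : ∀ (z : Option (Fin c.numG)) v o, _ := fun z v o =>
    mem_entryChoices (f := fun p : Fin (c.numStates + 1) × Fin c.numG => (p.1.val, p.2.val))
      (h := fun p => (p.1, p.2 :: z.toList)) (enc := Prod.map Fin.val (List.map Fin.val))
      (F := fun p => if p.1 < c.numStates + 1 ∧ p.2 < c.numG then
        some (p.1, p.2 :: (z.map Fin.val).toList) else none) (v := v) (o := o) (by
      rintro ⟨b1, b2⟩ w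
      simp only [Option.ite_none_right_eq_some, Option.some.injEq, map_toList]
      constructor
      · rintro ⟨⟨h1, h2⟩, rfl⟩
        exact ⟨(⟨b1, h1⟩, ⟨b2, h2⟩), rfl, rfl⟩
      · rintro ⟨p, hp, rfl⟩
        cases hp
        exact ⟨⟨p.1.2, p.2.2⟩, rfl⟩)
  constructor
  · rintro ⟨⟨q, a, z, rfl⟩, v, hv, ho⟩
    obtain ⟨o', h1, rfl⟩ := (key z v o).1 ho
    exact ⟨q, a, z, o', ⟨_, by simp [automaton, hv], h1⟩, rfl, rfl⟩
  · rintro ⟨q, a, z, o', ⟨v, hv, h1⟩, rfl, rfl⟩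
    simp only [automaton, Option.map_eq_some_iff] at hv
    obtain ⟨v, hv, rfl⟩ := hv
    exact ⟨⟨q, a, z, rfl⟩, v, hv, (key z v _).2 ⟨o', h1, rfl⟩⟩

theorem mem_movesR {c : IDCode} {k o} : (k, o) ∈ c.movesR ↔ ∃ q a z o',
    c.automaton.IsMove q (some (some (.pop a))) z o' ∧ k = (q.val, a.val, z.map Fin.val) ∧
      o = o'.map (Prod.map Fin.val (List.map Fin.val)) := by
  simp only [movesR, mem_tableMoves, mem_tableKeys mem_range_iff]
  have key : ∀ v o, _ := fun v o =>
    mem_entryChoices (f := (Fin.val : Fin (c.numStates + 1) → ℕ))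
      (h := fun q => (q, ([] : List (Fin c.numG)))) (enc := Prod.map Fin.val (List.map Fin.val))
      (F := fun q => if q < c.numStates + 1 then some (q, []) else none) (v := v) (o := o) (by
      intro b w
      simp only [Option.ite_none_right_eq_some, Option.some.injEq]
      constructor
      · rintro ⟨h1, rfl⟩
        exact ⟨⟨b, h1⟩, rfl, rfl⟩
      · rintro ⟨p, rfl, rfl⟩
        exact ⟨p.2, rfl⟩)
  constructor
  · rintro ⟨⟨q, a, z, rfl⟩, v, hv, ho⟩
    obtain ⟨o', h1, rfl⟩ := (key v o).1 ho
    exact ⟨q, a, z, o', ⟨_, by simp [automaton, hv], h1⟩, rfl, rfl⟩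
  · rintro ⟨q, a, z, o', ⟨v, hv, h1⟩, rfl, rfl⟩
    simp only [automaton, Option.map_eq_some_iff] at hv
    obtain ⟨v, hv, rfl⟩ := hv
    exact ⟨⟨q, a, z, rfl⟩, v, hv, (key v _).2 ⟨o', h1, rfl⟩⟩

theorem isMove_neutral_iff {Q D R N G : Type*} {M : NIDPDAwtl Q D R N G} {q a z o} :
    M.IsMove q (some (a.map .neutral)) z o ↔
      ∃ v, M.δN q a z = some v ∧ v.Yields (fun q' => (q', z.toList)) o := by
  cases a <;> rfl

theorem mem_movesN {c : IDCode} {k o} : (k, o) ∈ c.movesN ↔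
    ∃ q, ∃ a : Option (Fin c.numN), ∃ z o',
    c.automaton.IsMove q (some (a.map Letter.neutral)) z o' ∧
      k = (q.val, a.map Fin.val, z.map Fin.val) ∧
        o = o'.map (Prod.map Fin.val (List.map Fin.val)) := by
  have hxs : ∀ y, y ∈ (none :: (List.range c.numN).map some) ↔
      ∃ x : Option (Fin c.numN), x.map Fin.val = y := by
    rintro (_ | y)
    · simp
    · simp [Fin.exists_iff]
  simp only [movesN, mem_tableMoves, mem_tableKeys hxs, isMove_neutral_iff]
  have key : ∀ (z : Option (Fin c.numG)) v o, _ := fun z v o =>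
    mem_entryChoices (f := (Fin.val : Fin (c.numStates + 1) → ℕ))
      (h := fun q => (q, z.toList)) (enc := Prod.map Fin.val (List.map Fin.val))
      (F := fun q => if q < c.numStates + 1 then some (q, (z.map Fin.val).toList) else none)
      (v := v) (o := o) (by
      intro b w
      simp only [Option.ite_none_right_eq_some, Option.some.injEq, map_toList]
      constructor
      · rintro ⟨h1, rfl⟩
        exact ⟨⟨b, h1⟩, rfl, rfl⟩
      · rintro ⟨p, rfl, rfl⟩
        exact ⟨p.2, rfl⟩)
  constructor
  · rintro ⟨⟨q, a, z, rfl⟩, v, hv, ho⟩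
    obtain ⟨o', h1, rfl⟩ := (key z v o).1 ho
    exact ⟨q, a, z, o', ⟨_, by simp [automaton, hv], h1⟩, rfl, rfl⟩
  · rintro ⟨q, a, z, o', ⟨v, hv, h1⟩, rfl, rfl⟩
    simp only [automaton, Option.map_eq_some_iff] at hv
    obtain ⟨v, hv, rfl⟩ := hv
    exact ⟨⟨q, a, z, rfl⟩, v, hv, (key z v _).2 ⟨o', h1, rfl⟩⟩

theorem describes (c : IDCode) : c.toMach.Describes c.automaton.init
    (fun q a => a ∈ c.automaton.transl q) c.automaton.IsMove Fin.val letterCode Fin.val where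
  injQ := Fin.val_injective
  injS := by
    rintro (a | a | a) (b | b | b) h <;> simp_all [letterCode, Fin.val_inj]
  injG := Fin.val_injective
  init_eq := rfl
  mem_letters := by
    intro a
    simp only [toMach, Mach.letters, List.mem_append, List.mem_map, mem_range_iff]
    constructor
    · rintro (⟨_, ⟨x, rfl⟩, rfl⟩ | ⟨_, ⟨x, rfl⟩, rfl⟩ | ⟨_, ⟨x, rfl⟩, rfl⟩)
      exacts [⟨.push x, rfl⟩, ⟨.pop x, rfl⟩, ⟨.neutral x, rfl⟩]
    · rintro ⟨x | x | x, rfl⟩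
      exacts [.inl ⟨_, ⟨x, rfl⟩, rfl⟩, .inr (.inl ⟨_, ⟨x, rfl⟩, rfl⟩),
        .inr (.inr ⟨_, ⟨x, rfl⟩, rfl⟩)]
  mem_transl := by
    rintro q (a | a | a) <;> simp [toMach, Mach.transl, letterCode, automaton]
  mem_rules := by
    intro k o
    simp only [toMach, Mach.rules, List.mem_append, List.mem_map]
    constructor
    · rintro (⟨⟨e, o⟩, h, he⟩ | ⟨⟨e, o⟩, h, he⟩ | ⟨⟨e, o⟩, h, he⟩)
      · obtain ⟨rfl, rfl⟩ := Prod.mk.inj he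
        obtain ⟨q, a, z, o', h', rfl, rfl⟩ := mem_movesD.1 h
        exact ⟨q, some (some (.push a)), z, o', h', rfl, rfl⟩
      · obtain ⟨rfl, rfl⟩ := Prod.mk.inj he
        obtain ⟨q, a, z, o', h', rfl, rfl⟩ := mem_movesR.1 h
        exact ⟨q, some (some (.pop a)), z, o', h', rfl, rfl⟩
      · obtain ⟨rfl, rfl⟩ := Prod.mk.inj he
        obtain ⟨q, a, z, o', h', rfl, rfl⟩ := mem_movesN.1 h
        exact ⟨q, some (a.map .neutral), z, o', h', by cases a <;> rfl, rfl⟩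
    · rintro ⟨q, s, z, o', h, rfl, rfl⟩
      match s, h with
      | none, h => exact h.elim
      | some none, h =>
        exact .inr (.inr ⟨((q.val, none, z.map Fin.val), _),
          mem_movesN.2 ⟨q, none, z, o', h, rfl, rfl⟩, rfl⟩)
      | some (some (.push a)), h =>
        exact .inl ⟨((q.val, a.val, z.map Fin.val), _),
          mem_movesD.2 ⟨q, a, z, o', h, rfl, rfl⟩, rfl⟩
      | some (some (.pop a)), h =>
        exact .inr (.inl ⟨((q.val, a.val, z.map Fin.val), _),
          mem_movesR.2 ⟨q, a, z, o', h, rfl, rfl⟩, rfl⟩)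
      | some (some (.neutral a)), h =>
        exact .inr (.inr ⟨((q.val, some a.val, z.map Fin.val), _),
          mem_movesN.2 ⟨q, some a, z, o', h, rfl, rfl⟩, rfl⟩)

theorem primrec_equivProd : Primrec equivProd :=
  @Primrec.of_equiv _ _ _ equivProd

theorem primrec_toMach : Primrec toMach := by
  have h0 := primrec_equivProd
  have hK : Primrec numStates :=
    (Primrec.fst.comp h0 : Primrec fun c => (equivProd c).1)
  have h1 : Primrec fun c => (equivProd c).2 := Primrec.snd.comp h0
  have hD : Primrec numD :=
    (Primrec.fst.comp h1 : Primrec fun c => (equivProd c).2.1)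
  have h2 : Primrec fun c => (equivProd c).2.2 := Primrec.snd.comp h1
  have hR : Primrec numR :=
    (Primrec.fst.comp h2 : Primrec fun c => (equivProd c).2.2.1)
  have h3 : Primrec fun c => (equivProd c).2.2.2 := Primrec.snd.comp h2
  have hN : Primrec numN :=
    (Primrec.fst.comp h3 : Primrec fun c => (equivProd c).2.2.2.1)
  have h4 : Primrec fun c => (equivProd c).2.2.2.2 := Primrec.snd.comp h3
  have hG : Primrec numG :=
    (Primrec.fst.comp h4 : Primrec fun c => (equivProd c).2.2.2.2.1)
  have h5 : Primrec fun c => (equivProd c).2.2.2.2.2 := Primrec.snd.comp h4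
  have hI : Primrec IDCode.init :=
    (Primrec.fst.comp h5 : Primrec fun c => (equivProd c).2.2.2.2.2.1)
  have h6 : Primrec fun c => (equivProd c).2.2.2.2.2.2 := Primrec.snd.comp h5
  have hτD : Primrec translD :=
    (Primrec.fst.comp h6 : Primrec fun c => (equivProd c).2.2.2.2.2.2.1)
  have h7 : Primrec fun c => (equivProd c).2.2.2.2.2.2.2 := Primrec.snd.comp h6
  have hτR : Primrec translR :=
    (Primrec.fst.comp h7 : Primrec fun c => (equivProd c).2.2.2.2.2.2.2.1)
  have h8 : Primrec fun c => (equivProd c).2.2.2.2.2.2.2.2 := Primrec.snd.comp h7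
  have hτN : Primrec translN :=
    (Primrec.fst.comp h8 : Primrec fun c => (equivProd c).2.2.2.2.2.2.2.2.1)
  have h9 : Primrec fun c => (equivProd c).2.2.2.2.2.2.2.2.2 := Primrec.snd.comp h8
  have hTD : Primrec tableD :=
    (Primrec.fst.comp h9 : Primrec fun c => (equivProd c).2.2.2.2.2.2.2.2.2.1)
  have h10 : Primrec fun c => (equivProd c).2.2.2.2.2.2.2.2.2.2 := Primrec.snd.comp h9
  have hTR : Primrec tableR :=
    (Primrec.fst.comp h10 : Primrec fun c => (equivProd c).2.2.2.2.2.2.2.2.2.2.1)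
  have h11 : Primrec fun c => (equivProd c).2.2.2.2.2.2.2.2.2.2.2 := Primrec.snd.comp h10
  have hTN : Primrec tableN := h11
  have hMD : Primrec movesD := by
    refine primrec_tableMoves (primrec_tableKeys hK (Primrec.list_range.comp hD) hG) hTD
      (primrec_entryChoices (Primrec.ite ?_ (Primrec.option_some.comp ?_) (.const none)) .snd)
    · have hc : Primrec fun p : ((IDCode × ℕ × ℕ × Option ℕ) × Option (List (ℕ × ℕ))) × ℕ × ℕ =>
        p.1.1.1 := Primrec.fst.comp (Primrec.fst.comp .fst)
      exact (Primrec.nat_lt.comp (Primrec.fst.comp .snd) (Primrec.succ.comp (hK.comp hc))).and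
        (Primrec.nat_lt.comp (Primrec.snd.comp .snd) (hG.comp hc))
    · exact Primrec.pair (Primrec.fst.comp .snd) (Primrec.list_cons.comp (Primrec.snd.comp .snd)
        (Primrec.optionToList.comp (Primrec.snd.comp (Primrec.snd.comp
          (Primrec.snd.comp (Primrec.fst.comp .fst))))))
  have hMR : Primrec movesR := by
    refine primrec_tableMoves (primrec_tableKeys hK (Primrec.list_range.comp hR) hG) hTR
      (primrec_entryChoices (Primrec.ite ?_ (Primrec.option_some.comp ?_) (.const none)) .snd)
    · exact Primrec.nat_lt.comp .snd
        (Primrec.succ.comp (hK.comp (Primrec.fst.comp (Primrec.fst.comp .fst))))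
    · exact Primrec.pair .snd (.const [])
  have hMN : Primrec movesN := by
    refine primrec_tableMoves (primrec_tableKeys hK (Primrec.list_cons.comp (.const none)
      (Primrec.list_map (Primrec.list_range.comp hN) (Primrec.option_some.comp .snd))) hG) hTN
      (primrec_entryChoices (Primrec.ite ?_ (Primrec.option_some.comp ?_) (.const none)) .snd)
    · exact Primrec.nat_lt.comp .snd
        (Primrec.succ.comp (hK.comp (Primrec.fst.comp (Primrec.fst.comp .fst))))
    · exact Primrec.pair .snd (Primrec.optionToList.comp (Primrec.snd.comp (Primrec.snd.comp
        (Primrec.snd.comp (Primrec.fst.comp .fst)))))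
  have hletters : ∀ {f : IDCode → ℕ} (i : ℕ), Primrec f →
      Primrec fun c => (List.range (f c)).map fun a => (i, a) := fun i hf =>
    Primrec.list_map (Primrec.list_range.comp hf) (Primrec.pair (.const i) .snd)
  have htransl : ∀ {f : IDCode → List (ℕ × ℕ)} (i : ℕ), Primrec f →
      Primrec fun c => (f c).map fun p => (p.1, (i, p.2)) := fun i hf =>
    Primrec.list_map hf (Primrec.pair (Primrec.fst.comp .snd)
      (.pair (.const i) (Primrec.snd.comp .snd)))
  have hrules : ∀ {f : IDCode → List ((ℕ × ℕ × Option ℕ) × Option (ℕ × List ℕ))} (i : ℕ),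
      Primrec f → Primrec fun c => (f c).map fun e =>
        ((e.1.1, some (some (i, e.1.2.1)), e.1.2.2), e.2) := fun i hf =>
    Primrec.list_map hf (Primrec.pair (.pair (Primrec.fst.comp (Primrec.fst.comp .snd))
      (.pair (Primrec.option_some.comp (Primrec.option_some.comp (.pair (.const i)
        (Primrec.fst.comp (Primrec.snd.comp (Primrec.fst.comp .snd))))))
        (Primrec.snd.comp (Primrec.snd.comp (Primrec.fst.comp .snd))))) (Primrec.snd.comp .snd))
  refine Primrec.pair (Primrec.nat_mod.comp hI (Primrec.succ.comp hK)) (.pair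
    (Primrec.list_append.comp (hletters 0 hD)
      (Primrec.list_append.comp (hletters 1 hR) (hletters 2 hN))) (.pair
    (Primrec.list_append.comp (htransl 0 hτD)
      (Primrec.list_append.comp (htransl 1 hτR) (htransl 2 hτN)))
    (Primrec.list_append.comp (hrules 0 hMD) (Primrec.list_append.comp (hrules 1 hMR)
      (Primrec.list_map hMN ?_)))))
  exact Primrec.pair (.pair (Primrec.fst.comp (Primrec.fst.comp .snd))
    (.pair (Primrec.option_some.comp (Primrec.option_map
      (Primrec.fst.comp (Primrec.snd.comp (Primrec.fst.comp .snd)))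
      (Primrec.pair (.const 2) .snd)))
      (Primrec.snd.comp (Primrec.snd.comp (Primrec.fst.comp .snd))))) (Primrec.snd.comp .snd)

end IDCode

/-! ### Translation of automata that are not input-driven. -/

namespace PDCode

/-- The new state and the word put on the pushdown, for a table entry. -/
def entryMove (c : PDCode) (v : Option (ℕ × List ℕ)) : Option (ℕ × List ℕ) :=
  v.map fun p => (p.1 % (c.numStates + 1), p.2.filter fun i => decide (i < c.numG))

/-- The moves of an automaton that is not input-driven. -/
def moves (c : PDCode) :
    List ((ℕ × Option (Option ℕ) × Option ℕ) × Option (ℕ × List ℕ)) :=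
  tableMoves (tableKeys c.numStates
    (none :: some none :: (List.range c.numS).map fun a => some (some a)) c.numG)
    c.table fun _ v => [c.entryMove v]

/-- The description of an automaton as an automaton with general moves. -/
def toMach (c : PDCode) : Mach :=
  (c.init % (c.numStates + 1), (List.range c.numS).map fun a => (0, a),
    c.transl.map fun p => (p.1, (0, p.2)),
    c.moves.map fun e =>
      ((e.1.1, e.1.2.1.map (Option.map fun a => (0, a)), e.1.2.2), e.2))

/-- Here states out of range are not discarded: `Fin.ofNat` reduces them modulo the number of
states, while symbols out of range are skipped. The remainder and the filter imitate this on bare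
numbers. -/
theorem entryMove_eq (c : PDCode) (v : Option (ℕ × List ℕ)) :
    c.entryMove v = Option.map (Prod.map Fin.val (List.map Fin.val))
      (move c.numStates c.numG v).toOption := by
  cases v with
  | none => rfl
  | some p =>
    obtain ⟨q, u⟩ := p
    simp only [entryMove, move, Option.map_some, Move.toOption, Prod.map_apply, Fin.val_ofNat,
      Option.some.injEq, Prod.mk.injEq, true_and]
    induction u with
    | nil => rfl
    | cons i u ih =>
      by_cases hi : i < c.numG <;> simp [hi, ih]

theorem mem_moves {c : PDCode} {k o} : (k, o) ∈ c.moves ↔ ∃ q t z o',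
    c.automaton.IsMove q (Scan.toOption t) z o' ∧ k = (q.val, scanCode t, z.map Fin.val) ∧
      o = o'.map (Prod.map Fin.val (List.map Fin.val)) := by
  have hxs : ∀ y, y ∈ (none :: some none :: (List.range c.numS).map fun a => some (some a)) ↔
      ∃ t : Scan (Fin c.numS), scanCode t = y := by
    intro y
    simp only [List.mem_cons, List.mem_map, IDCode.mem_range_iff]
    constructor
    · rintro (rfl | rfl | ⟨_, ⟨a, rfl⟩, rfl⟩)
      exacts [⟨.lambda, rfl⟩, ⟨.endmarker, rfl⟩, ⟨.letter a, rfl⟩]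
    · rintro ⟨a | _ | _, rfl⟩
      exacts [.inr (.inr ⟨_, ⟨a, rfl⟩, rfl⟩), .inr (.inl rfl), .inl rfl]
  simp only [moves, mem_tableMoves, mem_tableKeys hxs, List.mem_singleton, PDAwtl.isMove_iff]
  constructor
  · rintro ⟨⟨q, t, z, rfl⟩, v, hv, rfl⟩
    exact ⟨q, t, z, _, ⟨t, rfl, move c.numStates c.numG v,
      by simp only [automaton, hv, Option.map_some], rfl⟩, rfl,
      c.entryMove_eq v⟩
  · rintro ⟨q, t, z, o', ⟨t', ht, v, hv, rfl⟩, rfl, rfl⟩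
    obtain rfl := Scan.toOption_injective ht
    simp only [automaton, Option.map_eq_some_iff] at hv
    obtain ⟨v, hv, rfl⟩ := hv
    exact ⟨⟨q, t, z, rfl⟩, v, hv, (c.entryMove_eq v).symm⟩

theorem describes (c : PDCode) : c.toMach.Describes c.automaton.init
    (fun q a => a ∈ c.automaton.transl q) c.automaton.IsMove Fin.val
    (fun a => ((0, a.val) : InSym)) Fin.val where
  injQ := Fin.val_injective
  injS a b h := Fin.ext (Prod.mk.inj h).2
  injG := Fin.val_injective
  init_eq := rfl
  mem_letters a := by
    simp only [toMach, Mach.letters, List.mem_map, IDCode.mem_range_iff]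
    constructor
    · rintro ⟨_, ⟨x, rfl⟩, rfl⟩
      exact ⟨x, rfl⟩
    · rintro ⟨x, rfl⟩
      exact ⟨_, ⟨x, rfl⟩, rfl⟩
  mem_transl q a := by simp [toMach, Mach.transl, automaton]
  mem_rules k o := by
    have hcode : ∀ t : Scan (Fin c.numS), (scanCode t).map (Option.map fun a => ((0, a) : InSym)) =
        t.toOption.map (Option.map fun a => ((0, a.val) : InSym)) := by
      rintro (a | _ | _) <;> rfl
    simp only [toMach, Mach.rules, List.mem_map]
    constructor
    · rintro ⟨⟨e, o⟩, h, he⟩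
      obtain ⟨rfl, rfl⟩ := Prod.mk.inj he
      obtain ⟨q, t, z, o', h', rfl, rfl⟩ := mem_moves.1 h
      exact ⟨q, t.toOption, z, o', h', by rw [hcode], rfl⟩
    · rintro ⟨q, s, z, o', h, rfl, rfl⟩
      obtain ⟨t, rfl, -⟩ := PDAwtl.isMove_iff.1 h
      exact ⟨((q.val, scanCode t, z.map Fin.val), _), mem_moves.2 ⟨q, t, z, o', h, rfl, rfl⟩,
        by rw [hcode]⟩

theorem primrec_equivProd : Primrec equivProd :=
  @Primrec.of_equiv _ _ _ equivProd

theorem primrec_toMach : Primrec toMach := by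
  have h0 := primrec_equivProd
  have hK : Primrec numStates := (Primrec.fst.comp h0 : Primrec fun c => (equivProd c).1)
  have h1 : Primrec fun c => (equivProd c).2 := Primrec.snd.comp h0
  have hS : Primrec numS := (Primrec.fst.comp h1 : Primrec fun c => (equivProd c).2.1)
  have h2 : Primrec fun c => (equivProd c).2.2 := Primrec.snd.comp h1
  have hG : Primrec numG := (Primrec.fst.comp h2 : Primrec fun c => (equivProd c).2.2.1)
  have h3 : Primrec fun c => (equivProd c).2.2.2 := Primrec.snd.comp h2
  have hI : Primrec PDCode.init := (Primrec.fst.comp h3 : Primrec fun c => (equivProd c).2.2.2.1)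
  have h4 : Primrec fun c => (equivProd c).2.2.2.2 := Primrec.snd.comp h3
  have hτ : Primrec PDCode.transl :=
    (Primrec.fst.comp h4 : Primrec fun c => (equivProd c).2.2.2.2.1)
  have hT : Primrec table := (Primrec.snd.comp h4 : Primrec fun c => (equivProd c).2.2.2.2.2)
  have hentry : Primrec₂ entryMove := by
    refine Primrec.option_map .snd (Primrec.pair ?_ ?_)
    · exact Primrec.nat_mod.comp (Primrec.fst.comp .snd)
        (Primrec.succ.comp (hK.comp (Primrec.fst.comp .fst)))
    · exact primrec_list_filter (Primrec.snd.comp .snd)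
        (Primrec.nat_lt.comp .snd (hG.comp (Primrec.fst.comp (Primrec.fst.comp .fst))))
  have hmoves : Primrec moves := by
    refine primrec_tableMoves (primrec_tableKeys hK (Primrec.list_cons.comp (.const none)
      (Primrec.list_cons.comp (.const (some none)) (Primrec.list_map (Primrec.list_range.comp hS)
        (Primrec.option_some.comp (Primrec.option_some.comp .snd))))) hG) hT ?_
    exact Primrec.list_cons.comp (hentry.comp (Primrec.fst.comp .fst) .snd) (.const [])
  refine Primrec.pair (Primrec.nat_mod.comp hI (Primrec.succ.comp hK)) (.pair
    (Primrec.list_map (Primrec.list_range.comp hS) (Primrec.pair (.const 0) .snd)) (.pair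
    (Primrec.list_map hτ (Primrec.pair (Primrec.fst.comp .snd)
      (.pair (.const 0) (Primrec.snd.comp .snd)))) (Primrec.list_map hmoves ?_)))
  exact Primrec.pair (.pair (Primrec.fst.comp (Primrec.fst.comp .snd)) (.pair
    (Primrec.option_map (Primrec.fst.comp (Primrec.snd.comp (Primrec.fst.comp .snd)))
      (Primrec.option_map .snd (Primrec.pair (.const 0) .snd)))
    (Primrec.snd.comp (Primrec.snd.comp (Primrec.fst.comp .snd))))) (Primrec.snd.comp .snd)

end PDCode

/-! ### The theorem. -/

instance Letter.instFinite {D R N : Type*} [Finite D] [Finite R] [Finite N] :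
    Finite (Letter D R N) :=
  Finite.of_surjective (fun s : D ⊕ R ⊕ N => s.elim .push (Sum.elim .pop .neutral)) (by
    rintro (a | a | a)
    exacts [⟨.inl a, rfl⟩, ⟨.inr (.inl a), rfl⟩, ⟨.inr (.inr a), rfl⟩])

theorem ComputablePred.decidableFor {α : Type*} [Primcodable α] {inst p q : α → Prop}
    (hp : ComputablePred p) (h : ∀ x, inst x → (p x ↔ q x)) : DecidableFor inst q := by
  obtain ⟨f, hf, rfl⟩ := ComputablePred.computable_iff.1 hp
  exact ⟨f, hf, h⟩

theorem theorem7 :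
    -- DIDPDAwtl
    (DecidableFor (fun c : IDCode => c.automaton.IsDeterministic)
        (fun c => c.automaton.language = (∅ : Set _)) ∧
      DecidableFor (fun c : IDCode => c.automaton.IsDeterministic)
        (fun c => Set.Finite c.automaton.language) ∧
      DecidableFor (fun c : IDCode => c.automaton.IsDeterministic)
        (fun c => c.automaton.language = (Set.univ : Set _))) ∧
    -- DPDAwtl
    (DecidableFor (fun c : PDCode => c.automaton.IsDeterministic)
        (fun c => c.automaton.language = (∅ : Set _)) ∧
      DecidableFor (fun c : PDCode => c.automaton.IsDeterministic)
        (fun c => Set.Finite c.automaton.language) ∧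
      DecidableFor (fun c : PDCode => c.automaton.IsDeterministic)
        (fun c => c.automaton.language = (Set.univ : Set _))) ∧
    -- NIDPDAwtl
    (ComputablePred (fun c : IDCode => c.automaton.language = (∅ : Set _)) ∧
      ComputablePred (fun c : IDCode => Set.Finite c.automaton.language)) := by
  obtain ⟨h1, h2, p, hp, h3⟩ :=
    computablePred_of_describes IDCode.primrec_toMach.to_comp IDCode.describes
  obtain ⟨h1', h2', p', hp', h3'⟩ :=
    computablePred_of_describes PDCode.primrec_toMach.to_comp PDCode.describes
  simp only [← NIDPDAwtl.language_eq] at h1 h2 h3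
  simp only [← PDAwtl.language_eq] at h1' h2' h3'
  refine ⟨⟨h1.decidableFor fun _ _ => Iff.rfl, h2.decidableFor fun _ _ => Iff.rfl,
    hp.decidableFor fun c hc => h3 c ?_⟩, ⟨h1'.decidableFor fun _ _ => Iff.rfl,
    h2'.decidableFor fun _ _ => Iff.rfl, hp'.decidableFor fun c hc => h3' c ?_⟩, h1, h2⟩
  -- Input-driven automata have no `λ`-moves, so the second condition holds vacuously.
  · exact (IDCode.describes c).deterministic (fun _ _ _ _ _ h h' => hc.isMove_unique h h')
      fun _ _ _ _ _ h _ => h.elim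
  · exact (PDCode.describes c).deterministic (fun _ _ _ _ _ h h' => h.unique h')
      fun _ _ _ _ _ h h' => hc.eq_none h h'
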